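/- Let $G$ be a locally compact Hausdorff group and let $M(G)$ be the Banach space of bounded (real- or complex-valued) Radon measures on $G$, identified with the Banach dual $C_0(G)^*$ via $\langle\mu,f\rangle=\int f\,d\mu$, with convolution $\langle\mu\star\nu,f\rangle=\iint f(xy)\,d\nu(y)\,d\mu(x)$. For a compact subgroup $L$ of $G$ let $\lambda_L\in M(G)$ be the normalized Haar measure of $L$, and let $\chi(G/L)$ be the character of the space $G/L$ of left cosets, i.e. the least cardinality of a neighbourhood base at a point. The space $M(G/L)$ is identified with $\{\mu\in M(G):\mu=\mu\star\lambda_L\}$. Let $K$ be a compact subgroup of $G$ such that $G/K$ is not metrizable, and put $\tau=\chi(G/K)$. A measure $\mu\in M(G/K)$ is called approximately invariant if $\mu=\lim_L\mu\star\lambda_L$ in norm, where $L$ runs over all compact subgroups of $G$ with $\chi(G/L)<\tau$, directed downwards by inclusion. Let $\mathcal K_K$ be the set of all compact subgroups $L\supseteq K$ of $G$ with $\chi(G/L)<\chi(G/K)$, directed downwards by inclusion. If $\mu\in M(G/K)$ is not approximately invariant, then the net $(\mu\star\lambda_L)_{L\in\mathcal K_K}$ does not converge in the weak* topology of $M(G)^{**}$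 (to any limit); that is, there exists $h\in M(G)^*$ such that the net of scalars $(\langle h,\mu\star\lambda_L\rangle)_{L\in\mathcal K_K}$ does not converge. -/

import Mathlib

open Filter Topology MeasureTheory Cardinal
open scoped ZeroAtInfty

noncomputable section

namespace GroupMeas

universe u

/-- The Banach dual of a normed space. -/
abbrev NormedDual (𝕜 E : Type*) [RCLike 𝕜] [NormedAddCommGroup E] [NormedSpace 𝕜 E] : Type _ :=
  StrongDual 𝕜 E

/-- `M(Ω)`: the bounded `𝕜`-valued Radon measures on a locally compact Hausdorff space `Ω`,
identified (Riesz representation) with the Banach dual of `C₀(Ω, 𝕜)` through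
`⟨μ, f⟩ = ∫ f dμ`. The dual norm is the total variation norm. -/
abbrev Meas (𝕜 : Type*) [RCLike 𝕜] (Ω : Type*) [TopologicalSpace Ω] : Type _ :=
  NormedDual 𝕜 C₀(Ω, 𝕜)

/-- The compact subgroups of `G`, ordered by inclusion. -/
abbrev CompactSubgroup (G : Type*) [TopologicalSpace G] [Group G] : Type _ :=
  {L : Subgroup G // IsCompact (L : Set G)}

instance {G : Type*} [TopologicalSpace G] [Group G] (L : CompactSubgroup G) :
    CompactSpace L.1 :=
  isCompact_iff_compactSpace.mp L.2

lemma norm_le_of_forall {𝕜 Ω : Type*} [RCLike 𝕜] [TopologicalSpace Ω]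
    {f : C₀(Ω, 𝕜)} {C : ℝ} (hC : 0 ≤ C) (h : ∀ x, ‖f x‖ ≤ C) :
    ‖f‖ ≤ C := by
  rw [← ZeroAtInftyContinuousMap.norm_toBCF_eq_norm]
  exact (BoundedContinuousFunction.norm_le hC).2 h

lemma norm_apply_le {𝕜 Ω : Type*} [RCLike 𝕜] [TopologicalSpace Ω]
    (f : C₀(Ω, 𝕜)) (x : Ω) : ‖f x‖ ≤ ‖f‖ := by
  rw [← ZeroAtInftyContinuousMap.norm_toBCF_eq_norm]
  exact BoundedContinuousFunction.norm_coe_le_norm f.toBCF x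

lemma exists_isCompact_norm_le {𝕜 Ω : Type*} [RCLike 𝕜] [TopologicalSpace Ω]
    (f : C₀(Ω, 𝕜)) {δ : ℝ} (hδ : 0 < δ) :
    ∃ A : Set Ω, IsCompact A ∧ ∀ x ∉ A, ‖f x‖ ≤ δ := by
  have h := Metric.tendsto_nhds.1 (zero_at_infty f) δ hδ
  obtain ⟨A, hA, hs⟩ := mem_cocompact.1 h
  refine ⟨A, hA, fun x hx => ?_⟩
  have h1 : dist (f x) 0 < δ := hs hx
  rw [dist_zero_right] at h1
  exact h1.le

section Convolution

variable {𝕜 : Type*} [RCLike 𝕜] {G : Type*} [TopologicalSpace G] [Group G]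
  [IsTopologicalGroup G]

/-- The left translate `y ↦ f (x y)` of `f ∈ C₀(G)`. -/
def translate (f : C₀(G, 𝕜)) (x : G) : C₀(G, 𝕜) where
  toFun y := f (x * y)
  continuous_toFun := (map_continuous f).comp (continuous_const_mul x)
  zero_at_infty' :=
    (zero_at_infty f).comp (Homeomorph.mulLeft x).isClosedEmbedding.tendsto_cocompact

@[simp] lemma translate_apply (f : C₀(G, 𝕜)) (x y : G) : translate f x y = f (x * y) := rfl

lemma norm_translate_le (f : C₀(G, 𝕜)) (x : G) : ‖translate f x‖ ≤ ‖f‖ :=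
  norm_le_of_forall (norm_nonneg f) fun y => norm_apply_le f (x * y)

lemma continuous_translate (f : C₀(G, 𝕜)) : Continuous (translate f) := by
  let U : UniformSpace G := IsTopologicalGroup.rightUniformSpace G
  have hu : UniformContinuous (f : G → 𝕜) := ZeroAtInftyContinuousMap.uniformContinuous f
  rw [continuous_iff_continuousAt]
  intro x₀
  rw [ContinuousAt, Metric.tendsto_nhds]
  intro ε hε
  have h2 : {p : G × G | dist (f p.1) (f p.2) < ε / 2} ∈ uniformity G :=
    hu (Metric.dist_mem_uniformity (half_pos hε))
  obtain ⟨V, hV, hVs⟩ := h2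
  have h3 : Tendsto (fun x : G => x₀ * x⁻¹) (𝓝 x₀) (𝓝 1) := by
    have : Continuous fun x : G => x₀ * x⁻¹ := by fun_prop
    simpa using this.tendsto x₀
  filter_upwards [h3 hV] with x hx
  rw [dist_eq_norm]
  refine (norm_le_of_forall (half_pos hε).le fun y => ?_).trans_lt (half_lt_self hε)
  have h4 : ((x * y, x₀ * y) : G × G) ∈ {p : G × G | dist (f p.1) (f p.2) < ε / 2} := by
    apply hVs
    have h5 : x₀ * y * (x * y)⁻¹ = x₀ * x⁻¹ := by group
    simpa [div_eq_mul_inv, h5] using hx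
  have h6 : dist (f (x * y)) (f (x₀ * y)) ≤ ε / 2 := le_of_lt h4
  rwa [dist_eq_norm] at h6

lemma exists_mul_eq_norm (a : 𝕜) : ∃ p : 𝕜, ‖p‖ ≤ 1 ∧ p * a = (‖a‖ : 𝕜) := by
  rcases eq_or_ne a 0 with rfl | ha
  · exact ⟨0, by simp, by simp⟩
  · have h : (‖a‖ : 𝕜) ≠ 0 := by simpa using ha
    refine ⟨(‖a‖ : 𝕜) / a, ?_, by field_simp⟩
    rw [norm_div, RCLike.norm_coe_norm, div_self (norm_ne_zero_iff.2 ha)]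

lemma tendsto_translate (ν : Meas 𝕜 G) (f : C₀(G, 𝕜)) :
    Tendsto (fun x => ν (translate f x)) (cocompact G) (𝓝 0) := by
  rw [Metric.tendsto_nhds]
  intro ε hε
  set F : ℝ := ‖f‖ + 1 with hF
  have hF1 : 1 ≤ F := by have := norm_nonneg f; linarith
  set N : ℝ := ‖ν‖ with hN
  have hN0 : 0 ≤ N := norm_nonneg ν
  set δ : ℝ := ε / (2 * F * (N + 1)) with hδ
  have hδ0 : 0 < δ := by positivity
  have hδF : F * (δ * (N + 1)) < ε := by
    have : F * (δ * (N + 1)) = ε / 2 := by rw [hδ]; field_simp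
    linarith
  obtain ⟨g, hg1, hg⟩ := ContinuousLinearMap.exists_lt_apply_of_lt_opNorm ν
    (show N - δ < ‖ν‖ by linarith)
  obtain ⟨A, hA, hgA⟩ := exists_isCompact_norm_le g hδ0
  obtain ⟨C, hC, hfC⟩ := exists_isCompact_norm_le f hδ0
  filter_upwards [(hC.mul hA.inv).compl_mem_cocompact] with x hx
  rw [dist_zero_right]
  set h := translate f x with hh
  obtain ⟨p, hp, hpa⟩ := exists_mul_eq_norm (ν g)
  obtain ⟨q, hq, hqb⟩ := exists_mul_eq_norm (ν h)
  have hFn : ‖((F⁻¹ : ℝ) : 𝕜)‖ = F⁻¹ := by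
    rw [RCLike.norm_ofReal, abs_of_pos (by positivity)]
  have key : ‖p • g + (((F⁻¹ : ℝ) : 𝕜) * q) • h‖ ≤ 1 + δ := by
    refine norm_le_of_forall (by positivity) fun y => ?_
    have e1 : ‖(p • g + (((F⁻¹ : ℝ) : 𝕜) * q) • h) y‖ ≤ ‖g y‖ + F⁻¹ * ‖f (x * y)‖ := by
      rw [ZeroAtInftyContinuousMap.add_apply, ZeroAtInftyContinuousMap.smul_apply,
        ZeroAtInftyContinuousMap.smul_apply, hh, translate_apply]
      refine (norm_add_le _ _).trans ?_
      rw [norm_smul, norm_smul, norm_mul, hFn]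
      gcongr
      · exact mul_le_of_le_one_left (norm_nonneg _) hp
      · exact mul_le_of_le_one_right (by positivity) hq
    refine e1.trans ?_
    have hFi : F⁻¹ ≤ 1 := inv_le_one_of_one_le₀ hF1
    by_cases hy : y ∈ A
    · have hxy : x * y ∉ C := fun hc => hx
        ⟨x * y, hc, y⁻¹, Set.inv_mem_inv.2 hy, by simp⟩
      have e2 := hfC _ hxy
      have e3 := (norm_apply_le g y).trans hg1.le
      have e4 : F⁻¹ * ‖f (x * y)‖ ≤ ‖f (x * y)‖ :=
        mul_le_of_le_one_left (norm_nonneg _) hFi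
      linarith
    · have e2 := hgA _ hy
      have e3 : F⁻¹ * ‖f (x * y)‖ ≤ 1 := by
        rw [inv_mul_le_iff₀ (by positivity)]
        have := norm_apply_le f (x * y)
        linarith
      linarith
  have e5 : ν (p • g + (((F⁻¹ : ℝ) : 𝕜) * q) • h) = ((‖ν g‖ + F⁻¹ * ‖ν h‖ : ℝ) : 𝕜) := by
    rw [map_add, map_smul, map_smul, smul_eq_mul, smul_eq_mul, hpa, mul_assoc, hqb]
    push_cast
    rfl
  have e6 : ‖ν g‖ + F⁻¹ * ‖ν h‖ ≤ N * (1 + δ) := by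
    have e7 := (ν.le_opNorm _).trans (mul_le_mul_of_nonneg_left key hN0)
    rw [e5, RCLike.norm_ofReal, abs_of_nonneg (by positivity)] at e7
    exact e7
  have e8 : F⁻¹ * ‖ν h‖ ≤ δ * (N + 1) := by linarith
  rw [inv_mul_le_iff₀ (by positivity)] at e8
  linarith

/-- The left action `ν ⊙ f` of `ν ∈ M(G)` on `f ∈ C₀(G)`: `(ν ⊙ f)(x) = ∫ f (x y) dν(y)`. -/
def odot (ν : Meas 𝕜 G) : C₀(G, 𝕜) →L[𝕜] C₀(G, 𝕜) :=
  LinearMap.mkContinuous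
    { toFun := fun f =>
        { toFun := fun x => ν (translate f x)
          continuous_toFun := ν.continuous.comp (continuous_translate f)
          zero_at_infty' := tendsto_translate ν f }
      map_add' := fun f g => by
        ext x
        exact ν.map_add (translate f x) (translate g x)
      map_smul' := fun c f => by
        ext x
        exact ν.map_smul c (translate f x) }
    ‖ν‖ fun f => norm_le_of_forall (by positivity) fun x =>
      (ν.le_opNorm _).trans (by gcongr; exact norm_translate_le f x)

lemma odot_apply (ν : Meas 𝕜 G) (f : C₀(G, 𝕜)) (x : G) :
    odot ν f x = ν (translate f x) := rfl

/-- Convolution in `M(G)`: `⟨μ ⋆ ν, f⟩ = ∫ ∫ f (x y) dν(y) dμ(x) = ⟨μ, ν ⊙ f⟩`. -/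
def conv (μ ν : Meas 𝕜 G) : Meas 𝕜 G := μ.comp (odot ν)

end Convolution

section Haar

variable (𝕜 : Type*) [RCLike 𝕜] {G : Type*} [TopologicalSpace G] [Group G]
  [IsTopologicalGroup G] [MeasurableSpace G] [BorelSpace G]

/-- The Haar measure of total mass one on a compact subgroup. -/
def probHaar (L : CompactSubgroup G) : Measure L.1 := Measure.haarMeasure ⊤

instance (L : CompactSubgroup G) : IsProbabilityMeasure (probHaar L) :=
  ⟨Measure.haarMeasure_self (K₀ := (⊤ : TopologicalSpace.PositiveCompacts L.1))⟩

lemma integrable_restrict (L : CompactSubgroup G) (f : C₀(G, 𝕜)) :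
    Integrable (fun x : L.1 => f (x : G)) (probHaar L) := by
  have h : Continuous fun x : L.1 => f (x : G) := (map_continuous f).comp continuous_subtype_val
  exact h.integrable_of_hasCompactSupport (HasCompactSupport.of_compactSpace _)

/-- `λ_L ∈ M(L) ⊆ M(G)`: the normalized Haar measure of the compact subgroup `L`, as a measure
on `G`, i.e. `⟨λ_L, f⟩ = ∫_L f dλ_L`. -/
def haarMeas (L : CompactSubgroup G) : Meas 𝕜 G :=
  LinearMap.mkContinuous
    { toFun := fun f => ∫ x : L.1, f (x : G) ∂(probHaar L)
      map_add' := fun f g => integral_add (integrable_restrict 𝕜 L f) (integrable_restrict 𝕜 L g)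
      map_smul' := fun c _ => integral_const_mul c _ }
    1 fun f => by
      have h := norm_integral_le_of_norm_le_const (μ := probHaar L)
        (Eventually.of_forall fun x : L.1 => norm_apply_le f (x : G))
      simpa using h

/-- `M(G/K)`, regarded as the subspace `M(G, K) = {μ ∈ M(G) : μ = μ ⋆ λ_K}` of `M(G)`
(the usual identification, under which `μ` corresponds to its image on the space `G/K` of left
cosets). -/
def cosetMeas (K : CompactSubgroup G) : Set (Meas 𝕜 G) :=
  {μ | μ = conv μ (haarMeas 𝕜 K)}

end Haar

section Character

/-- The character of a space `X` at `x`: the least cardinality of a base of neighbourhoods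
of `x`. -/
def characterAt {X : Type u} [TopologicalSpace X] (x : X) : Cardinal.{u} :=
  sInf {c | ∃ B : Set (Set X), #B = c ∧ (𝓝 x).HasBasis (fun V => V ∈ B) id}

/-- `χ(G/L)`: the character of the (homogeneous) space of left cosets of `L`. -/
def cosetCharacter {G : Type u} [TopologicalSpace G] [Group G] (L : CompactSubgroup G) :
    Cardinal.{u} :=
  characterAt ((1 : G) : G ⧸ L.1)

end Character

section Approx

variable (𝕜 : Type*) [RCLike 𝕜] {G : Type u} [TopologicalSpace G] [Group G]
  [IsTopologicalGroup G] [MeasurableSpace G] [BorelSpace G]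

/-- The compact subgroups `L` with `χ(G/L) < τ`. -/
def subgroupsBelow (G : Type u) [TopologicalSpace G] [Group G] (τ : Cardinal.{u}) :
    Set (CompactSubgroup G) :=
  {L | cosetCharacter L < τ}

/-- The compact subgroups `L ⊇ K` with `χ(G/L) < χ(G/K)`. -/
def subgroupsAbove (K : CompactSubgroup G) : Set (CompactSubgroup G) :=
  {L | K ≤ L ∧ cosetCharacter L < cosetCharacter K}

/-- `M_τ(G)`: measures of character `τ`, the union of all `M(G/K)` with `K` a compact subgroup
such that `χ(G/K) ≤ τ`. -/
def measOfCharacter (G : Type u) [TopologicalSpace G] [Group G]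
    [IsTopologicalGroup G] [MeasurableSpace G] [BorelSpace G] (τ : Cardinal.{u}) :
    Set (Meas 𝕜 G) :=
  ⋃ K ∈ {K : CompactSubgroup G | cosetCharacter K ≤ τ}, cosetMeas 𝕜 K

/-- The approximately invariant measures of character `τ`, for an uncountable cardinal `τ`:
those `μ ∈ M_τ(G)` that are the norm limit of the net `μ ⋆ λ_L`, where `L` runs over the compact
subgroups with `χ(G/L) < τ`, directed downwards by inclusion. -/
def approxInvariant (G : Type u) [TopologicalSpace G] [Group G]
    [IsTopologicalGroup G] [MeasurableSpace G] [BorelSpace G] (τ : Cardinal.{u}) :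
    Set (Meas 𝕜 G) :=
  {μ | μ ∈ measOfCharacter 𝕜 G τ ∧
    Tendsto (fun L : subgroupsBelow G τ => conv μ (haarMeas 𝕜 L.1)) atBot (𝓝 μ)}

/-- The approximately invariant measures in `M(G/K)`, for a compact subgroup `K` with `χ(G/K)`
uncountable (equivalently, with `G/K` non-metrizable). -/
def approxInvariantCoset (K : CompactSubgroup G) : Set (Meas 𝕜 G) :=
  cosetMeas 𝕜 K ∩ approxInvariant 𝕜 G (cosetCharacter K)

end Approx

end GroupMeas

end

/-! Put τ = χ(G/K); non-metrizability gives τ > ℵ₀. A band here is a closed subspace of M(G) stable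
under multiplication by C₀ functions; each has a linear projection whose remainder is singular to
the band (`exists_bandProj`). Split μ along the band generated by the measures that are right
invariant under some L in 𝒦_K. Both parts are K-invariant. The averages of the band part converge to
it in norm (`exists_norm_convHaar_sub_le`), so the band part is approximately invariant. Hence the
singular part is nonzero, and it suffices that its averages oscillate. Call it μ again.

Oscillation (`exists_not_tendsto_of_sing`): suppose 𝒦_K has two cofinal subsets A, B such that every
average over a member of A is singular to every average over a member of B. The norm is additive on
sums a + b from the two spans, so a + b ↦ ⟨a, f⟩ is bounded, and Hahn–Banach extends it to some h.
For fixed f the number ⟨μ ⋆ λ_L, f⟩ equals ⟨μ, f⟩ once L is small; normalizing this to 1, h is 1 far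
along A and 0 on B.

Singular averages (`exists_forall_sing_convHaar`): let H ⊇ K have character at most κ < τ, with κ
infinite, and let P project onto the band of the H-invariant measures. The distance from μ ⋆ λ_L to
this band can only grow as L shrinks. Subgroups of character at most κ are stable under countable
intersections, so the distance becomes constant, and then P(μ ⋆ λ_L) also becomes a constant p.
Testing on single functions gives ‖μ - p‖ ≤ ‖μ ⋆ λ_L - p‖, while singularity turns this into ‖μ‖ +
‖p‖ ≤ ‖μ‖ - ‖p‖. So averages over all small L are singular to everything H-invariant.

Cofinal sets: if τ = κ⁺, a recursion of length κ⁺ gives a decreasing cofinal chain in which each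
average is singular to the earlier ones, and alternate members form A and B. Otherwise every κ < τ
has κ⁺ < τ. Intersecting a chain of length κ⁺ gives L of character at most κ⁺ whose average is
singular to every measure invariant under some subgroup of character at most κ
(`exists_convHaar_sing_band`). Taking κ = ℵ_α, the parity of α separates A from B. -/

open scoped Pointwise

noncomputable section

namespace GroupMeas

universe u

open scoped NNReal ENNReal

/-! ### Hahn–Banach extension of dominated functionals -/

section Extension

/-- A linear functional on a vector space `J` that is dominated by the norm of a linear map
`Φ : J → V` factors through `Φ` by a bounded functional on `V`. -/
lemma exists_strongDual_comp_eq {𝕜 J V : Type*} [RCLike 𝕜] [AddCommGroup J] [Module 𝕜 J]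
    [NormedAddCommGroup V] [NormedSpace 𝕜 V] (Φ : J →ₗ[𝕜] V) (Ψ : J →ₗ[𝕜] 𝕜) (C : ℝ)
    (h : ∀ c, ‖Ψ c‖ ≤ C * ‖Φ c‖) : ∃ f : StrongDual 𝕜 V, ∀ c, f (Φ c) = Ψ c := by
  have hker : LinearMap.ker Φ ≤ LinearMap.ker Ψ := fun c hc => by
    have := h c
    rw [LinearMap.mem_ker] at hc ⊢
    rw [hc, norm_zero, mul_zero] at this
    exact norm_le_zero_iff.1 this
  let g₀ : LinearMap.range Φ →ₗ[𝕜] 𝕜 :=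
    ((LinearMap.ker Φ).liftQ Ψ hker).comp Φ.quotKerEquivRange.symm.toLinearMap
  have hg₀ : ∀ c (hc : Φ c ∈ LinearMap.range Φ), g₀ ⟨Φ c, hc⟩ = Ψ c := fun c hc => by
    have : Φ.quotKerEquivRange.symm ⟨Φ c, hc⟩ = (LinearMap.ker Φ).mkQ c :=
      LinearMap.quotKerEquivRange_symm_apply_image Φ c hc
    simp [g₀, this]
  let g : StrongDual 𝕜 (LinearMap.range Φ) := g₀.mkContinuous C fun y => by
    obtain ⟨_, c, rfl⟩ := y
    exact (congrArg norm (hg₀ c ⟨c, rfl⟩)).trans_le (h c)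
  obtain ⟨f, hf, -⟩ := exists_extension_norm_eq (LinearMap.range Φ) g
  exact ⟨f, fun c => (hf ⟨Φ c, c, rfl⟩).trans (hg₀ c _)⟩

end Extension

/-! ### Approximation of bounded measurable functions by C₀ functions -/

section Approximation

variable {𝕜 Ω : Type*} [RCLike 𝕜] [TopologicalSpace Ω]

/-- The function in `C₀(Ω)` given by a continuous function that is dominated by one in `C₀(Ω)`. -/
def ofNormLe (f : C₀(Ω, 𝕜)) (g : Ω → 𝕜) (hg : Continuous g) (h : ∀ x, ‖g x‖ ≤ ‖f x‖) :
    C₀(Ω, 𝕜) where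
  toFun := g
  continuous_toFun := hg
  zero_at_infty' := by
    rw [tendsto_zero_iff_norm_tendsto_zero]
    refine squeeze_zero (fun _ => norm_nonneg _) h ?_
    exact tendsto_zero_iff_norm_tendsto_zero.1 (zero_at_infty f)

@[simp] lemma ofNormLe_apply (f : C₀(Ω, 𝕜)) (g : Ω → 𝕜) (hg : Continuous g)
    (h : ∀ x, ‖g x‖ ≤ ‖f x‖) (x : Ω) : ofNormLe f g hg h x = g x := rfl

/-- A compactly supported continuous function, as an element of `C₀(Ω)`. -/
def ofCompactSupport (g : Ω → 𝕜) (hg : Continuous g) (h : HasCompactSupport g) : C₀(Ω, 𝕜) where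
  toFun := g
  continuous_toFun := hg
  zero_at_infty' := h.is_zero_at_infty

@[simp] lemma ofCompactSupport_apply (g : Ω → 𝕜) (hg : Continuous g) (h : HasCompactSupport g)
    (x : Ω) : ofCompactSupport g hg h x = g x := rfl

/-- Soft thresholding: the modulus is lowered by δ and cut off at 0, the phase is kept. The result
lives on {δ ≤ |f|}, which is compact because f vanishes at infinity. The maximum in the denominator
keeps the factor continuous at zeros of f. -/
lemma exists_hasCompactSupport_norm_sub_le (f : C₀(Ω, 𝕜)) {δ : ℝ} (hδ : 0 < δ) :
    ∃ g : C₀(Ω, 𝕜), HasCompactSupport g ∧ ‖f - g‖ ≤ δ ∧ ∀ x, ‖g x‖ ≤ ‖f x‖ := by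
  set r : Ω → ℝ := fun x => max (‖f x‖ - δ) 0 / max ‖f x‖ δ with hr
  have hfc : Continuous fun x => ‖f x‖ := (map_continuous f).norm
  have hpos : ∀ x, 0 < max ‖f x‖ δ := fun x => lt_max_of_lt_right hδ
  have hrc : Continuous r :=
    ((hfc.sub continuous_const).max continuous_const).div (hfc.max continuous_const)
      fun x => (hpos x).ne'
  have hr0 : ∀ x, 0 ≤ r x := fun x => div_nonneg (le_max_right _ _) (hpos x).le
  have hr1 : ∀ x, r x ≤ 1 := fun x => by
    rw [hr]
    refine div_le_one_of_le₀ (max_le ?_ ?_) (hpos x).le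
    · exact le_max_of_le_left (by linarith)
    · exact (hpos x).le
  have hn : ∀ x, ‖((r x : ℝ) : 𝕜) * f x‖ ≤ ‖f x‖ := fun x => by
    rw [norm_mul, RCLike.norm_ofReal, abs_of_nonneg (hr0 x)]
    exact mul_le_of_le_one_left (norm_nonneg _) (hr1 x)
  refine ⟨ofNormLe f (fun x => ((r x : ℝ) : 𝕜) * f x)
    ((RCLike.continuous_ofReal.comp hrc).mul (map_continuous f)) hn, ?_, ?_, hn⟩
  · obtain ⟨A, hA, hfA⟩ := exists_isCompact_norm_le f hδ
    refine HasCompactSupport.intro' (K := {x | δ ≤ ‖f x‖}) ?_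
      (isClosed_le continuous_const hfc) fun x hx => ?_
    · obtain ⟨B, hB, hfB⟩ := exists_isCompact_norm_le f (half_pos hδ)
      refine hB.of_isClosed_subset (isClosed_le continuous_const hfc) fun x hx => ?_
      by_contra hxB
      have := hfB x hxB
      have hx' : δ ≤ ‖f x‖ := hx
      linarith
    · replace hx : ‖f x‖ < δ := not_le.1 hx
      have : r x = 0 := by
        rw [hr]
        simp only
        rw [max_eq_right (by linarith), zero_div]
      simp [this]
  · refine norm_le_of_forall hδ.le fun x => ?_
    have e : (f - ofNormLe f (fun x => ((r x : ℝ) : 𝕜) * f x)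
        ((RCLike.continuous_ofReal.comp hrc).mul (map_continuous f)) hn) x
        = ((1 - r x : ℝ) : 𝕜) * f x := by
      simp [sub_mul]
    rw [e, norm_mul, RCLike.norm_ofReal, abs_of_nonneg (by linarith [hr1 x])]
    rcases le_total ‖f x‖ δ with h | h
    · have := hr0 x
      exact (mul_le_of_le_one_left (norm_nonneg _) (by linarith)).trans h
    · have hf0 : 0 < ‖f x‖ := hδ.trans_le h
      have : r x = (‖f x‖ - δ) / ‖f x‖ := by
        rw [hr]
        simp only
        rw [max_eq_left (by linarith), max_eq_left h]
      rw [this]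
      apply le_of_eq
      field_simp
      ring

variable [T2Space Ω] [LocallyCompactSpace Ω] [MeasurableSpace Ω] [BorelSpace Ω]

/-- Every integrable function is the `L¹` limit of continuous functions with compact support. -/
lemma exists_hasCompactSupport_eLpNorm_sub_le (m : Measure Ω) [IsFiniteMeasure m] [m.InnerRegular]
    {g : Ω → 𝕜} (hg : MemLp g 1 m) {ε : ℝ≥0∞} (hε : ε ≠ 0) :
    ∃ c : Ω → 𝕜, eLpNorm (g - c) 1 m ≤ ε ∧ Continuous c ∧ MemLp c 1 m ∧ HasCompactSupport c := by
  refine hg.induction_dense ENNReal.one_ne_top _ ?_ ?_ ?_ hε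
  · intro c t ht _ ε hε
    obtain ⟨η, hη, hle⟩ := exists_eLpNorm_indicator_le (μ := m) (p := 1) ENNReal.one_ne_top c hε
    -- The indicator of t is replaced by a Urysohn function between a compact s ⊆ t and an open u ⊇
    -- t. The error lives on u \ s, whose measure is at most η/2 + η/2.
    have hη2 : ((η / 2 : ℝ≥0) : ℝ≥0∞) ≠ 0 := by
      simpa using hη.ne'
    obtain ⟨s, hst, hs, hsc, hms⟩ := ht.exists_isCompact_isClosed_sdiff_lt (measure_ne_top m t) hη2
    obtain ⟨u, htu, hu, -, hmu⟩ := ht.exists_isOpen_sdiff_lt (measure_ne_top m t) hη2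
    obtain ⟨φ, hφ1, hφ0, hφc, hφI⟩ := exists_continuous_one_zero_of_isCompact hs hu.isClosed_compl
      (Set.disjoint_compl_right_iff_subset.2 (hst.trans htu))
    have hcont : Continuous fun x => ((φ x : ℝ) : 𝕜) * c :=
      (RCLike.continuous_ofReal.comp φ.continuous).mul continuous_const
    have hcomp : HasCompactSupport fun x => ((φ x : ℝ) : 𝕜) * c := by
      refine HasCompactSupport.mono hφc fun x hx => ?_
      simp only [Function.mem_support, ne_eq, mul_eq_zero, not_or, RCLike.ofReal_eq_zero] at hx
      exact hx.1
    refine ⟨_, ?_, hcont, ?_, hcomp⟩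
    · refine (eLpNorm_mono fun x => ?_).trans (hle (u \ s) ?_)
      · simp only [Pi.sub_apply]
        by_cases hxs : x ∈ s
        · have h1 : φ x = 1 := hφ1 hxs
          simp [h1, hst hxs]
        by_cases hxu : x ∈ u
        · have h2 := hφI x
          rw [Set.indicator_of_mem (show x ∈ u \ s from ⟨hxu, hxs⟩)]
          by_cases hxt : x ∈ t
          · rw [Set.indicator_of_mem hxt]
            have : ((φ x : ℝ) : 𝕜) * c - c = ((φ x - 1 : ℝ) : 𝕜) * c := by push_cast; ring
            rw [this, norm_mul, RCLike.norm_ofReal]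
            refine mul_le_of_le_one_left (norm_nonneg _) ?_
            rw [abs_le]
            constructor <;> linarith [h2.1, h2.2]
          · rw [Set.indicator_of_notMem hxt, sub_zero, norm_mul, RCLike.norm_ofReal]
            refine mul_le_of_le_one_left (norm_nonneg _) ?_
            rw [abs_of_nonneg h2.1]
            exact h2.2
        · have h3 : φ x = 0 := hφ0 hxu
          have hxt : x ∉ t := fun h => hxu (htu h)
          simp [h3, hxt]
      · have : u \ s ⊆ (u \ t) ∪ (t \ s) := fun x hx => by
          by_cases hxt : x ∈ t
          · exact Or.inr ⟨hxt, hx.2⟩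
          · exact Or.inl ⟨hx.1, hxt⟩
        calc m (u \ s) ≤ m (u \ t) + m (t \ s) := (measure_mono this).trans (measure_union_le _ _)
          _ ≤ ((η / 2 : ℝ≥0) : ℝ≥0∞) + ((η / 2 : ℝ≥0) : ℝ≥0∞) := add_le_add hmu.le hms.le
          _ = η := by rw [← ENNReal.coe_add, add_halves]
    · exact memLp_one_iff_integrable.2 (hcont.integrable_of_hasCompactSupport hcomp)
  · rintro f g ⟨h1, h2, h3⟩ ⟨h4, h5, h6⟩
    exact ⟨h1.add h4, h2.add h5, h3.add h6⟩
  · rintro f ⟨_, h2, _⟩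
    exact h2.aestronglyMeasurable

/-- The radial retraction onto the ball of radius C; fixing 0 lets it preserve compact supports. -/
lemma exists_clamp (𝕜 : Type*) [RCLike 𝕜] {C : ℝ} (hC : 0 < C) : ∃ clamp : 𝕜 → 𝕜,
    Continuous clamp ∧ clamp 0 = 0 ∧ (∀ z, ‖clamp z‖ ≤ C) ∧ ∀ z, ‖z‖ ≤ C → clamp z = z := by
  let clamp : 𝕜 → 𝕜 := fun z => ((C / max C ‖z‖ : ℝ) : 𝕜) * z
  have hclamp : clamp = fun z => ((C / max C ‖z‖ : ℝ) : 𝕜) * z := rfl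
  have hpos : ∀ z : 𝕜, 0 < max C ‖z‖ := fun z => lt_max_of_lt_left hC
  have hcl : Continuous clamp :=
    (RCLike.continuous_ofReal.comp (continuous_const.div (continuous_const.max continuous_norm)
      fun z => (hpos z).ne')).mul continuous_id
  have hcl0 : clamp 0 = 0 := by simp [hclamp]
  have hclC : ∀ z, ‖clamp z‖ ≤ C := fun z => by
    rw [hclamp]
    simp only
    rw [norm_mul, RCLike.norm_ofReal, abs_of_pos (by have := hpos z; positivity), div_mul_eq_mul_div,
      div_le_iff₀ (hpos z)]
    exact mul_le_mul_of_nonneg_left (le_max_right _ _) hC.le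
  have hcl1 : ∀ z, ‖z‖ ≤ C → clamp z = z := fun z hz => by
    rw [hclamp]
    simp only
    rw [max_eq_left hz, div_self hC.ne']
    simp
  exact ⟨clamp, hcl, hcl0, hclC, hcl1⟩

/-- Every bounded measurable function is the almost everywhere limit of a sequence in `C₀(Ω)` with
the same bound. -/
lemma exists_seq_tendsto_ae (m : Measure Ω) [IsFiniteMeasure m] [m.InnerRegular]
    {g : Ω → 𝕜} (hg : AEStronglyMeasurable g m) {C : ℝ} (hC : 0 < C) (hgC : ∀ x, ‖g x‖ ≤ C) :
    ∃ c : ℕ → C₀(Ω, 𝕜), (∀ n x, ‖c n x‖ ≤ C) ∧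
      ∀ᵐ x ∂m, Tendsto (fun n => c n x) atTop (𝓝 (g x)) := by
  have hgi : MemLp g 1 m :=
    memLp_one_iff_integrable.2 (Integrable.of_bound hg C (Eventually.of_forall hgC))
  have h1 : ∀ n : ℕ, ∃ c : Ω → 𝕜, eLpNorm (g - c) 1 m ≤ ((n : ℝ≥0∞) + 1)⁻¹ ∧ Continuous c ∧
      MemLp c 1 m ∧ HasCompactSupport c := fun n =>
    exists_hasCompactSupport_eLpNorm_sub_le m hgi (by simp)
  choose c hc1 hc2 hc3 hc4 using h1
  have hlim : Tendsto (fun n => eLpNorm (c n - g) 1 m) atTop (𝓝 0) := by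
    refine tendsto_of_tendsto_of_tendsto_of_le_of_le tendsto_const_nhds ?_ (fun _ => zero_le)
      (fun n => (eLpNorm_sub_comm _ _ _ _).trans_le (hc1 n))
    have := ENNReal.tendsto_inv_nat_nhds_zero.comp (tendsto_add_atTop_nat 1)
    simpa [Function.comp_def] using this
  obtain ⟨ns, -, hns⟩ := (tendstoInMeasure_of_tendsto_eLpNorm one_ne_zero
    (fun n => (hc2 n).aestronglyMeasurable) hg hlim).exists_seq_tendsto_ae
  -- Clamping restores the bound C and does not disturb the limit, whose values are already in the
  -- ball.
  obtain ⟨clamp, hcl, hcl0, hclC, hcl1⟩ := exists_clamp 𝕜 hC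
  refine ⟨fun n => ofCompactSupport (fun x => clamp (c (ns n) x)) (hcl.comp (hc2 _))
    ((hc4 _).comp_left hcl0), fun n x => hclC _, ?_⟩
  filter_upwards [hns] with x hx
  have := (hcl.tendsto (g x)).comp hx
  rw [hcl1 _ (hgC x)] at this
  exact this

end Approximation

open scoped CompactlySupported

/-! ### Total variation and dominating Radon measures -/

section TotalVariation

variable {𝕜 Ω : Type*} [RCLike 𝕜] [TopologicalSpace Ω]

/-- The total variation of `ν` at a nonnegative function `f`: the supremum of `|ν(g)|` over all
`g ∈ C₀(Ω)` with `|g| ≤ f`. -/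
def totalVar (ν : Meas 𝕜 Ω) (f : C_c(Ω, ℝ≥0)) : ℝ :=
  ⨆ g : {g : C₀(Ω, 𝕜) // ∀ x, ‖g x‖ ≤ f x}, ‖ν g.1‖

lemma exists_bound_compactlySupported (f : C_c(Ω, ℝ≥0)) : ∃ C : ℝ, 0 ≤ C ∧ ∀ x, (f x : ℝ) ≤ C := by
  have hc : HasCompactSupport fun x => ((f x : ℝ≥0) : ℝ) :=
    f.hasCompactSupport.comp_left (g := fun r : ℝ≥0 => (r : ℝ)) rfl
  obtain ⟨C, hC⟩ := hc.exists_bound_of_continuous (NNReal.continuous_coe.comp f.continuous)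
  exact ⟨max C 0, le_max_right _ _, fun x => le_max_of_le_left ((le_abs_self _).trans (hC x))⟩

lemma bddAbove_totalVar (ν : Meas 𝕜 Ω) (f : C_c(Ω, ℝ≥0)) :
    BddAbove (Set.range fun g : {g : C₀(Ω, 𝕜) // ∀ x, ‖g x‖ ≤ f x} => ‖ν g.1‖) := by
  obtain ⟨C, hC0, hC⟩ := exists_bound_compactlySupported f
  refine ⟨‖ν‖ * C, ?_⟩
  rintro _ ⟨g, rfl⟩
  refine (ν.le_opNorm _).trans ?_
  gcongr
  exact norm_le_of_forall hC0 fun x => (g.2 x).trans (hC x)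

lemma le_totalVar (ν : Meas 𝕜 Ω) {f : C_c(Ω, ℝ≥0)} {g : C₀(Ω, 𝕜)} (h : ∀ x, ‖g x‖ ≤ f x) :
    ‖ν g‖ ≤ totalVar ν f :=
  le_ciSup (bddAbove_totalVar ν f) ⟨g, h⟩

lemma totalVar_le (ν : Meas 𝕜 Ω) {f : C_c(Ω, ℝ≥0)} {c : ℝ}
    (h : ∀ g : C₀(Ω, 𝕜), (∀ x, ‖g x‖ ≤ f x) → ‖ν g‖ ≤ c) : totalVar ν f ≤ c :=
  haveI : Nonempty {g : C₀(Ω, 𝕜) // ∀ x, ‖g x‖ ≤ f x} := ⟨0, fun x => by simp⟩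
  ciSup_le fun g => h g.1 g.2

lemma totalVar_nonneg (ν : Meas 𝕜 Ω) (f : C_c(Ω, ℝ≥0)) : 0 ≤ totalVar ν f :=
  Real.iSup_nonneg fun _ => norm_nonneg _

/-- A competitor g for f₁ + f₂ is split in the proportions f₁ : f₂ : δ. The extra δ avoids division
by zero, and its share costs at most ‖ν‖δ ≤ ε. -/
lemma totalVar_add_le (ν : Meas 𝕜 Ω) (f₁ f₂ : C_c(Ω, ℝ≥0)) :
    totalVar ν (f₁ + f₂) ≤ totalVar ν f₁ + totalVar ν f₂ := by
  refine totalVar_le ν fun g hg => le_of_forall_pos_le_add fun ε hε => ?_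
  set δ : ℝ := ε / (‖ν‖ + 1) with hδ
  have hν := norm_nonneg ν
  have hδ0 : 0 < δ := by positivity
  have hc₁ : Continuous fun x => (f₁ x : ℝ) := NNReal.continuous_coe.comp f₁.continuous
  have hc₂ : Continuous fun x => (f₂ x : ℝ) := NNReal.continuous_coe.comp f₂.continuous
  have hpos : ∀ x, 0 < (f₁ x : ℝ) + f₂ x + δ := fun x => by positivity
  have hgle : ∀ x, ‖g x‖ ≤ f₁ x + f₂ x := fun x => by simpa using hg x
  have key : ∀ s : Ω → ℝ, Continuous s → (∀ x, 0 ≤ s x) → (∀ x, s x ≤ f₁ x + f₂ x + δ) →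
      ∃ g' : C₀(Ω, 𝕜), (∀ x, g' x = ((s x / (f₁ x + f₂ x + δ) : ℝ) : 𝕜) * g x) ∧
        ∀ x, ‖g' x‖ ≤ s x := by
    intro s hs hs0 hs1
    have hsc : Continuous fun x => ((s x / (f₁ x + f₂ x + δ) : ℝ) : 𝕜) * g x :=
      (RCLike.continuous_ofReal.comp (hs.div ((hc₁.add hc₂).add continuous_const)
        fun x => (hpos x).ne')).mul (map_continuous g)
    have hn : ∀ x, ‖((s x / (f₁ x + f₂ x + δ) : ℝ) : 𝕜) * g x‖
        = s x / (f₁ x + f₂ x + δ) * ‖g x‖ := fun x => by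
      rw [norm_mul, RCLike.norm_ofReal, abs_of_nonneg (div_nonneg (hs0 x) (hpos x).le)]
    refine ⟨ofNormLe g _ hsc fun x => ?_, fun x => rfl, fun x => ?_⟩
    · rw [hn]
      exact mul_le_of_le_one_left (norm_nonneg _) (div_le_one_of_le₀ (hs1 x) (hpos x).le)
    · rw [ofNormLe_apply, hn, div_mul_eq_mul_div, div_le_iff₀ (hpos x)]
      exact mul_le_mul_of_nonneg_left ((hgle x).trans (by linarith)) (hs0 x)
  obtain ⟨g₁, hg₁, hg₁'⟩ := key _ hc₁ (fun x => (f₁ x).2) fun x => by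
    have := (f₂ x).2; simp only [NNReal.val_eq_coe] at this; linarith
  obtain ⟨g₂, hg₂, hg₂'⟩ := key _ hc₂ (fun x => (f₂ x).2) fun x => by
    have := (f₁ x).2; simp only [NNReal.val_eq_coe] at this; linarith
  obtain ⟨g₃, hg₃, hg₃'⟩ := key (fun _ => δ) continuous_const (fun x => hδ0.le) fun x => by
    have := (f₁ x).2; have := (f₂ x).2; simp only [NNReal.val_eq_coe] at *; linarith
  have hsum : g = g₁ + g₂ + g₃ := by
    ext x
    rw [ZeroAtInftyContinuousMap.add_apply, ZeroAtInftyContinuousMap.add_apply, hg₁, hg₂, hg₃,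
      ← add_mul, ← add_mul, ← RCLike.ofReal_add, ← RCLike.ofReal_add, ← add_div, ← add_div,
      div_self (hpos x).ne', RCLike.ofReal_one, one_mul]
  have h₃ : ‖ν g₃‖ ≤ ε := by
    refine (ν.le_opNorm _).trans ((mul_le_mul_of_nonneg_left
      (norm_le_of_forall hδ0.le hg₃') hν).trans ?_)
    rw [hδ, mul_div_assoc', div_le_iff₀ (by positivity)]
    nlinarith
  calc ‖ν g‖ = ‖ν g₁ + ν g₂ + ν g₃‖ := by rw [hsum, map_add, map_add]
    _ ≤ ‖ν g₁‖ + ‖ν g₂‖ + ‖ν g₃‖ := norm_add₃_le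
    _ ≤ totalVar ν f₁ + totalVar ν f₂ + ε :=
      add_le_add (add_le_add (le_totalVar ν hg₁') (le_totalVar ν hg₂')) h₃

/-- Competitors for f₁ and f₂ are rotated by scalars so that ν takes nonnegative real values on
both; their sum then competes for f₁ + f₂. -/
lemma le_totalVar_add (ν : Meas 𝕜 Ω) (f₁ f₂ : C_c(Ω, ℝ≥0)) :
    totalVar ν f₁ + totalVar ν f₂ ≤ totalVar ν (f₁ + f₂) := by
  have key : ∀ g₁ : C₀(Ω, 𝕜), (∀ x, ‖g₁ x‖ ≤ f₁ x) → ∀ g₂ : C₀(Ω, 𝕜), (∀ x, ‖g₂ x‖ ≤ f₂ x) →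
      ‖ν g₁‖ + ‖ν g₂‖ ≤ totalVar ν (f₁ + f₂) := by
    intro g₁ h₁ g₂ h₂
    obtain ⟨p, hp, hp'⟩ := exists_mul_eq_norm (ν g₁)
    obtain ⟨q, hq, hq'⟩ := exists_mul_eq_norm (ν g₂)
    have e : ‖ν (p • g₁ + q • g₂)‖ = ‖ν g₁‖ + ‖ν g₂‖ := by
      rw [map_add, map_smul, map_smul, smul_eq_mul, smul_eq_mul, hp', hq', ← RCLike.ofReal_add,
        RCLike.norm_ofReal, abs_of_nonneg (by positivity)]
    rw [← e]
    refine le_totalVar ν fun x => ?_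
    rw [ZeroAtInftyContinuousMap.add_apply, ZeroAtInftyContinuousMap.smul_apply,
      ZeroAtInftyContinuousMap.smul_apply, CompactlySupportedContinuousMap.add_apply,
      NNReal.coe_add]
    refine (norm_add_le _ _).trans (add_le_add ?_ ?_)
    · rw [norm_smul]
      exact (mul_le_of_le_one_left (norm_nonneg _) hp).trans (h₁ x)
    · rw [norm_smul]
      exact (mul_le_of_le_one_left (norm_nonneg _) hq).trans (h₂ x)
  rw [← le_sub_iff_add_le]
  refine totalVar_le ν fun g₁ h₁ => ?_
  rw [le_sub_comm]
  exact totalVar_le ν fun g₂ h₂ => by linarith [key g₁ h₁ g₂ h₂]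

lemma totalVar_smul_le (ν : Meas 𝕜 Ω) (f : C_c(Ω, ℝ≥0)) {c : ℝ≥0} (hc : c ≠ 0) :
    totalVar ν (c • f) ≤ c * totalVar ν f := by
  refine totalVar_le ν fun g hg => ?_
  have hc' : ((c : ℝ) : 𝕜) ≠ 0 := by simpa using hc
  have e : g = ((c : ℝ) : 𝕜) • (((c : ℝ) : 𝕜)⁻¹ • g) := by rw [smul_inv_smul₀ hc']
  rw [e, map_smul, norm_smul, RCLike.norm_ofReal, abs_of_nonneg c.coe_nonneg]
  refine mul_le_mul_of_nonneg_left (le_totalVar ν fun x => ?_) c.2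
  rw [ZeroAtInftyContinuousMap.smul_apply, norm_smul, norm_inv, RCLike.norm_ofReal,
    abs_of_nonneg c.coe_nonneg, inv_mul_le_iff₀ (by positivity)]
  simpa using hg x

/-- The total variation, as a positive linear functional. -/
def totalVarFunctional (ν : Meas 𝕜 Ω) : C_c(Ω, ℝ≥0) →ₗ[ℝ≥0] ℝ≥0 where
  toFun f := ⟨totalVar ν f, totalVar_nonneg ν f⟩
  map_add' f₁ f₂ := by
    ext
    exact le_antisymm (totalVar_add_le ν f₁ f₂) (le_totalVar_add ν f₁ f₂)
  map_smul' c f := by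
    ext
    change totalVar ν (c • f) = c * totalVar ν f
    rcases eq_or_ne c 0 with rfl | hc
    · refine le_antisymm ?_ (by simpa using totalVar_nonneg ν _)
      refine totalVar_le ν fun g hg => ?_
      have : g = 0 := by
        ext x
        simpa using hg x
      simp [this]
    · refine le_antisymm (totalVar_smul_le ν f hc) ?_
      have h := totalVar_smul_le ν (c • f) (inv_ne_zero hc)
      rw [inv_smul_smul₀ hc, NNReal.coe_inv] at h
      rwa [le_inv_mul_iff₀ (by positivity)] at h

variable [MeasurableSpace Ω] [BorelSpace Ω]

/-- A functional that is dominated by a finite measure has a density. -/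
lemma exists_density (m : Measure Ω) [IsFiniteMeasure m] (ν : Meas 𝕜 Ω)
    (h : ∀ f : C₀(Ω, 𝕜), ‖ν f‖ ≤ ∫ x, ‖f x‖ ∂m) :
    ∃ a : Ω → 𝕜, Integrable a m ∧ ∀ f : C₀(Ω, 𝕜), ν f = ∫ x, f x * a x ∂m := by
  have hmem : ∀ f : C₀(Ω, 𝕜), MemLp f 2 m := fun f =>
    MemLp.of_bound (map_continuous f).aestronglyMeasurable ‖f‖
      (Eventually.of_forall (norm_apply_le f))
  let Φ : C₀(Ω, 𝕜) →ₗ[𝕜] Lp 𝕜 2 m :=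
    { toFun := fun f => (hmem f).toLp f
      map_add' := fun f g => (MemLp.toLp_congr (hmem (f + g)) ((hmem f).add (hmem g))
        (Eventually.of_forall fun _ => rfl)).trans (MemLp.toLp_add _ _)
      map_smul' := fun c f => (MemLp.toLp_congr (hmem (c • f)) ((hmem f).const_smul c)
        (Eventually.of_forall fun _ => rfl)).trans (MemLp.toLp_const_smul c _) }
  -- On a finite measure the L¹ norm is at most m(Ω)^(1/2) times the L² norm, so ν factors through
  -- the Hilbert space L². The Riesz vector enters the density through its conjugate.
  obtain ⟨F, hF⟩ := exists_strongDual_comp_eq Φ ν.toLinearMap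
    ((m Set.univ ^ (1 / 2 : ℝ)).toReal) fun f => by
      refine (h f).trans ?_
      have e1 : ∫ x, ‖f x‖ ∂m = (eLpNorm f 1 m).toReal := by
        rw [eLpNorm_one_eq_lintegral_enorm,
          integral_norm_eq_lintegral_enorm (map_continuous f).aestronglyMeasurable]
      have e2 : ‖Φ f‖ = (eLpNorm f 2 m).toReal := Lp.norm_toLp _ (hmem f)
      rw [e1, e2, mul_comm, ← ENNReal.toReal_mul]
      refine ENNReal.toReal_mono (ENNReal.mul_ne_top (hmem f).2.ne (by simp)) ?_
      convert eLpNorm_le_eLpNorm_mul_rpow_measure_univ (μ := m) (p := 1) (q := 2) (by norm_num)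
        (map_continuous f).aestronglyMeasurable using 2
      norm_num
  obtain ⟨v, rfl⟩ := (InnerProductSpace.toDual 𝕜 (Lp 𝕜 2 m)).surjective F
  have hv : MemLp (fun x => starRingEnd 𝕜 (v x)) 2 m := (Lp.memLp v).star
  refine ⟨fun x => starRingEnd 𝕜 (v x), hv.integrable (by norm_num), fun f => ?_⟩
  have h1 : ν f = inner 𝕜 v (Φ f) := (hF f).symm
  rw [h1, L2.inner_def]
  refine integral_congr_ae ?_
  filter_upwards [MemLp.coeFn_toLp (hmem f)] with x hx
  change inner 𝕜 (v x) ((hmem f).toLp f x) = _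
  rw [hx, RCLike.inner_apply]

variable [T2Space Ω] [LocallyCompactSpace Ω]

/-- Every functional on `C₀(Ω)` is dominated by a finite Radon measure. -/
lemma exists_measure_dominating (ν : Meas 𝕜 Ω) : ∃ m : Measure Ω, IsFiniteMeasure m ∧
    m.InnerRegular ∧ ∀ f : C₀(Ω, 𝕜), ‖ν f‖ ≤ ∫ x, ‖f x‖ ∂m := by
  set m := NNRealRMK.rieszMeasure (totalVarFunctional ν) with hm
  have hreg : m.Regular := inferInstance
  have hfin : IsFiniteMeasure m := by
    refine ⟨lt_of_le_of_lt ?_ (ENNReal.ofReal_lt_top (r := ‖ν‖))⟩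
    rw [isOpen_univ.measure_eq_iSup_isCompact]
    -- The mass of a compact set is at most the total variation at a Urysohn function bounded by 1,
    -- hence at most ‖ν‖.
    refine iSup_le fun K => iSup_le fun _ => iSup_le fun hK => ?_
    obtain ⟨φ, hφ1, -, hφc, hφI⟩ := exists_continuous_one_zero_of_isCompact hK isClosed_empty
      (Set.disjoint_empty K)
    let f : C_c(Ω, ℝ≥0) := ⟨⟨fun x => (φ x).toNNReal, by fun_prop⟩,
      hφc.comp_left (g := Real.toNNReal) (by simp)⟩
    have h1 : m K ≤ ∫⁻ x, f x ∂m := by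
      rw [← setLIntegral_one]
      refine (setLIntegral_mono' hK.measurableSet fun x hx => ?_).trans
        (setLIntegral_le_lintegral K _)
      have : φ x = 1 := hφ1 hx
      simp [f, this]
    refine h1.trans ?_
    rw [NNRealRMK.lintegral_rieszMeasure, ENNReal.coe_nnreal_eq]
    refine ENNReal.ofReal_le_ofReal ?_
    refine totalVar_le ν fun g hg => ?_
    have : ‖g‖ ≤ 1 := norm_le_of_forall zero_le_one fun x => (hg x).trans (by
      change (((φ x).toNNReal : ℝ≥0) : ℝ) ≤ 1
      rw [Real.coe_toNNReal _ (hφI x).1]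
      exact (hφI x).2)
    exact (ν.le_opNorm g).trans (mul_le_of_le_one_right (norm_nonneg _) this)
  refine ⟨m, hfin, inferInstance, fun f => le_of_forall_pos_le_add fun ε hε => ?_⟩
  set δ : ℝ := ε / (‖ν‖ + 1) with hδ
  have hν := norm_nonneg ν
  have hδ0 : 0 < δ := by positivity
  obtain ⟨g, hgc, hfg, hgf⟩ := GroupMeas.exists_hasCompactSupport_norm_sub_le f hδ0
  let k : C_c(Ω, ℝ≥0) := ⟨⟨fun x => ‖g x‖₊, (map_continuous g).nnnorm⟩,
    hgc.comp_left (g := fun z : 𝕜 => ‖z‖₊) (by simp)⟩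
  have h1 : ‖ν g‖ ≤ ∫ x, ‖g x‖ ∂m := by
    have h2 := NNRealRMK.integral_rieszMeasure (totalVarFunctional ν) k
    have h3 : ‖ν g‖ ≤ totalVar ν k := le_totalVar ν fun x => le_rfl
    exact h3.trans h2.ge
  have h2 : ∫ x, ‖g x‖ ∂m ≤ ∫ x, ‖f x‖ ∂m := by
    refine integral_mono ?_ ?_ hgf
    · exact (Integrable.of_bound (map_continuous g).aestronglyMeasurable ‖g‖
        (Eventually.of_forall (norm_apply_le g))).norm
    · exact (Integrable.of_bound (map_continuous f).aestronglyMeasurable ‖f‖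
        (Eventually.of_forall (norm_apply_le f))).norm
  have h3 : ‖ν (f - g)‖ ≤ ε := by
    refine (ν.le_opNorm _).trans ((mul_le_mul_of_nonneg_left hfg hν).trans ?_)
    rw [hδ, mul_div_assoc', div_le_iff₀ (by positivity)]
    nlinarith
  have h4 : ν f = ν g + ν (f - g) := by rw [← map_add, add_sub_cancel]
  rw [h4]
  exact (norm_add_le _ _).trans (add_le_add (h1.trans h2) h3)

end TotalVariation


/-! ### Measures given by densities -/

section Density

variable {𝕜 Ω : Type*} [RCLike 𝕜] [TopologicalSpace Ω]

/-- The product `φ · ν` of a function and a measure. -/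
def smulMeas (φ : C₀(Ω, 𝕜)) : Meas 𝕜 Ω →L[𝕜] Meas 𝕜 Ω :=
  (ContinuousLinearMap.compL 𝕜 C₀(Ω, 𝕜) C₀(Ω, 𝕜) 𝕜).flip (ContinuousLinearMap.mul 𝕜 C₀(Ω, 𝕜) φ)

@[simp] lemma smulMeas_apply (φ f : C₀(Ω, 𝕜)) (ν : Meas 𝕜 Ω) : smulMeas φ ν f = ν (φ * f) := rfl

variable [MeasurableSpace Ω]

/-- `ν = a · m`. -/
structure HasDensity (m : Measure Ω) (a : Ω → 𝕜) (ν : Meas 𝕜 Ω) : Prop where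
  integrable : Integrable a m
  apply_eq : ∀ f : C₀(Ω, 𝕜), ν f = ∫ x, f x * a x ∂m

namespace HasDensity

variable {m : Measure Ω} {a b : Ω → 𝕜} {ν ρ : Meas 𝕜 Ω}

lemma unique (h₁ : HasDensity m a ν) (h₂ : HasDensity m a ρ) : ν = ρ := by
  ext f
  rw [h₁.apply_eq, h₂.apply_eq]

lemma congr (h : HasDensity m a ν) (hab : a =ᵐ[m] b) : HasDensity m b ν :=
  ⟨h.integrable.congr hab, fun f => (h.apply_eq f).trans
    (integral_congr_ae (hab.mono fun x hx => by simp only [hx]))⟩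

lemma smul (h : HasDensity m a ν) (c : 𝕜) :
    HasDensity m (fun x => c * a x) (c • ν) :=
  ⟨h.integrable.const_mul c, fun f => by
    rw [smul_apply, h.apply_eq, smul_eq_mul, ← integral_const_mul]
    exact integral_congr_ae (Eventually.of_forall fun x => by simp only; ring)⟩

variable [BorelSpace Ω]

lemma integrable_mul (h : Integrable a m) (f : C₀(Ω, 𝕜)) : Integrable (fun x => f x * a x) m :=
  h.bdd_mul (map_continuous f).aestronglyMeasurable (Eventually.of_forall (norm_apply_le f))

lemma add (h₁ : HasDensity m a ν) (h₂ : HasDensity m b ρ) : HasDensity m (a + b) (ν + ρ) :=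
  ⟨h₁.integrable.add h₂.integrable, fun f => by
    rw [add_apply, h₁.apply_eq, h₂.apply_eq, ← integral_add
      (integrable_mul h₁.integrable f) (integrable_mul h₂.integrable f)]
    simp only [Pi.add_apply, mul_add]⟩

lemma sub (h₁ : HasDensity m a ν) (h₂ : HasDensity m b ρ) : HasDensity m (a - b) (ν - ρ) :=
  ⟨h₁.integrable.sub h₂.integrable, fun f => by
    rw [sub_apply, h₁.apply_eq, h₂.apply_eq, ← integral_sub
      (integrable_mul h₁.integrable f) (integrable_mul h₂.integrable f)]
    simp only [Pi.sub_apply, mul_sub]⟩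

lemma smulMeas (h : HasDensity m a ν) (φ : C₀(Ω, 𝕜)) :
    HasDensity m (fun x => φ x * a x) (smulMeas φ ν) :=
  ⟨integrable_mul h.integrable φ, fun f => by
    rw [smulMeas_apply, h.apply_eq]
    refine integral_congr_ae (Eventually.of_forall fun x => ?_)
    change φ x * f x * a x = f x * (φ x * a x)
    ring⟩

lemma exists_of_integrable (h : Integrable a m) : ∃ ν : Meas 𝕜 Ω, HasDensity m a ν :=
  ⟨LinearMap.mkContinuous
    { toFun := fun f => ∫ x, f x * a x ∂m
      map_add' := fun f g => by
        rw [← integral_add (integrable_mul h f) (integrable_mul h g)]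
        simp only [ZeroAtInftyContinuousMap.add_apply, add_mul]
      map_smul' := fun c f => by
        rw [RingHom.id_apply, smul_eq_mul, ← integral_const_mul]
        simp only [ZeroAtInftyContinuousMap.smul_apply, smul_eq_mul, mul_assoc] }
    (∫ x, ‖a x‖ ∂m) fun f => by
      rw [mul_comm, ← integral_const_mul]
      refine norm_integral_le_of_norm_le (h.norm.const_mul _) (Eventually.of_forall fun x => ?_)
      rw [norm_mul]
      exact mul_le_mul_of_nonneg_right (norm_apply_le f x) (norm_nonneg _),
  h, fun _ => rfl⟩

omit [BorelSpace Ω] in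
lemma norm_le (h : HasDensity m a ν) : ‖ν‖ ≤ ∫ x, ‖a x‖ ∂m := by
  refine ν.opNorm_le_bound (integral_nonneg fun _ => norm_nonneg _) fun f => ?_
  rw [h.apply_eq, mul_comm, ← integral_const_mul]
  refine norm_integral_le_of_norm_le (h.integrable.norm.const_mul _)
    (Eventually.of_forall fun x => ?_)
  rw [norm_mul]
  exact mul_le_mul_of_nonneg_right (norm_apply_le f x) (norm_nonneg _)

variable [T2Space Ω] [LocallyCompactSpace Ω] [IsFiniteMeasure m] [m.InnerRegular]

/-- The phase conj(a)/|a| would attain the L¹ norm. It is an almost everywhere limit of C₀ functions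
bounded by 1, and dominated convergence transfers the bound. -/
lemma norm_eq (h : HasDensity m a ν) : ‖ν‖ = ∫ x, ‖a x‖ ∂m := by
  refine le_antisymm h.norm_le ?_
  wlog ham : StronglyMeasurable a generalizing a
  · have h' := h.congr h.integrable.1.ae_eq_mk
    refine le_of_eq_of_le (integral_congr_ae ?_) (this h' h.integrable.1.stronglyMeasurable_mk)
    filter_upwards [h.integrable.1.ae_eq_mk] with x hx
    rw [← hx]
  set g : Ω → 𝕜 := fun x => ((‖a x‖⁻¹ : ℝ) : 𝕜) * starRingEnd 𝕜 (a x) with hg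
  have hgm : AEStronglyMeasurable g m := by
    refine Measurable.aestronglyMeasurable ?_
    exact (RCLike.measurable_ofReal.comp ham.measurable.norm.inv).mul
      (RCLike.continuous_conj.measurable.comp ham.measurable)
  have hg1 : ∀ x, ‖g x‖ ≤ 1 := fun x => by
    rw [hg]
    simp only
    rw [norm_mul, RCLike.norm_conj, RCLike.norm_ofReal, abs_inv, abs_norm]
    exact inv_mul_le_one
  have hga : ∀ x, g x * a x = ((‖a x‖ : ℝ) : 𝕜) := fun x => by
    rcases eq_or_ne (a x) 0 with h0 | h0
    · simp [h0]
    · have : ((‖a x‖ : ℝ) : 𝕜) ≠ 0 := by simpa using h0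
      rw [hg]
      simp only
      rw [mul_assoc, RCLike.conj_mul, RCLike.ofReal_inv, sq, inv_mul_cancel_left₀ this]
  obtain ⟨c, hc1, hc⟩ := exists_seq_tendsto_ae m hgm one_pos hg1
  have hlim : Tendsto (fun n => ν (c n)) atTop (𝓝 (∫ x, g x * a x ∂m)) := by
    simp only [h.apply_eq]
    refine tendsto_integral_of_dominated_convergence (fun x => ‖a x‖)
      (fun n => (integrable_mul h.integrable (c n)).1) h.integrable.norm (fun n => ?_) ?_
    · refine Eventually.of_forall fun x => ?_
      rw [norm_mul]
      exact mul_le_of_le_one_left (norm_nonneg _) (hc1 n x)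
    · filter_upwards [hc] with x hx
      exact hx.mul_const _
  have h1 := le_of_tendsto hlim.norm (Eventually.of_forall fun n =>
    (ν.le_opNorm (c n)).trans (mul_le_of_le_one_right (norm_nonneg _)
      (norm_le_of_forall zero_le_one (hc1 n))))
  simp only [hga] at h1
  rw [integral_ofReal, RCLike.norm_ofReal] at h1
  exact (le_abs_self _).trans h1

/-- Multiplication by a bounded measurable function is a well defined operation on measures. -/
lemma mul_of_hasDensity_mul {m' : Measure Ω} [IsFiniteMeasure m'] [m'.InnerRegular]
    {g : Ω → 𝕜} (hg : StronglyMeasurable g) {C : ℝ} (hC : 0 < C) (hgC : ∀ x, ‖g x‖ ≤ C)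
    (h₁ : HasDensity m a ν) (h₂ : HasDensity m (fun x => g x * a x) ρ)
    (h₃ : HasDensity m' b ν) : HasDensity m' (fun x => g x * b x) ρ := by
  have hb : Integrable (fun x => g x * b x) m' :=
    h₃.integrable.bdd_mul hg.aestronglyMeasurable (Eventually.of_forall hgC)
  refine ⟨hb, fun f => ?_⟩
  -- Approximating with respect to m + m' gives one sequence that serves both representations of ν.
  obtain ⟨c, hc1, hc⟩ := exists_seq_tendsto_ae (m + m') hg.aestronglyMeasurable hC hgC
  rw [ae_add_measure_iff] at hc
  have key : ∀ (n : Measure Ω) (d : Ω → 𝕜), HasDensity n d ν →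
      (∀ᵐ x ∂n, Tendsto (fun k => c k x) atTop (𝓝 (g x))) →
      Tendsto (fun k => ν (f * c k)) atTop (𝓝 (∫ x, f x * (g x * d x) ∂n)) := by
    intro n d hd hn
    simp only [hd.apply_eq]
    refine tendsto_integral_of_dominated_convergence (fun x => ‖f‖ * C * ‖d x‖)
      (fun k => (integrable_mul hd.integrable (f * c k)).1) (hd.integrable.norm.const_mul _)
      (fun k => ?_) ?_
    · refine Eventually.of_forall fun x => ?_
      rw [norm_mul, ZeroAtInftyContinuousMap.mul_apply, norm_mul]
      gcongr
      · exact norm_apply_le f x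
      · exact hc1 k x
    · filter_upwards [hn] with x hx
      simp only [ZeroAtInftyContinuousMap.mul_apply, mul_assoc]
      exact (hx.mul_const _).const_mul _
  rw [h₂.apply_eq]
  exact tendsto_nhds_unique (key m a h₁ hc.1) (key m' b h₃ hc.2)

omit [T2Space Ω] [LocallyCompactSpace Ω] [m.InnerRegular] [IsFiniteMeasure m] in
lemma tendsto_of_tendsto_ae {c : ℕ → Ω → 𝕜} {νs : ℕ → Meas 𝕜 Ω} {B : Ω → ℝ}
    (h : HasDensity m a ν) (hc : ∀ n, HasDensity m (c n) (νs n)) (hB : Integrable B m)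
    (hcB : ∀ n, ∀ᵐ x ∂m, ‖c n x‖ ≤ B x)
    (hlim : ∀ᵐ x ∂m, Tendsto (fun n => c n x) atTop (𝓝 (a x))) :
    Tendsto νs atTop (𝓝 ν) := by
  rw [tendsto_iff_norm_sub_tendsto_zero]
  refine squeeze_zero (fun _ => norm_nonneg _) (fun n => ((hc n).sub h).norm_le) ?_
  have := tendsto_integral_of_dominated_convergence (F := fun n x => ‖(c n - a) x‖)
    (f := fun _ => (0 : ℝ)) (μ := m) (fun x => B x + ‖a x‖)
    (fun n => ((hc n).integrable.sub h.integrable).norm.1) (hB.add h.integrable.norm)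
    (fun n => (hcB n).mono fun x hx => ?_) ?_
  · simpa using this
  · rw [norm_norm]
    exact (norm_sub_le _ _).trans (by gcongr)
  · filter_upwards [hlim] with x hx
    simpa using (hx.sub_const (a x)).norm

/-- A closed subspace that is stable under multiplication by functions in `C₀(Ω)` is stable under
multiplication by bounded measurable functions. -/
lemma mem_of_mul {X : Submodule 𝕜 (Meas 𝕜 Ω)} (hX : IsClosed (X : Set (Meas 𝕜 Ω)))
    (hXm : ∀ (φ : C₀(Ω, 𝕜)), ∀ ν ∈ X, GroupMeas.smulMeas φ ν ∈ X)
    {g : Ω → 𝕜} (hg : AEStronglyMeasurable g m) {C : ℝ} (hgC : ∀ x, ‖g x‖ ≤ C)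
    (h₁ : HasDensity m a ν) (hν : ν ∈ X) (h₂ : HasDensity m (fun x => g x * a x) ρ) : ρ ∈ X := by
  have hC : 0 < max C 1 := lt_max_of_lt_right one_pos
  obtain ⟨c, hc1, hc⟩ := exists_seq_tendsto_ae m hg hC fun x => (hgC x).trans (le_max_left C 1)
  refine hX.mem_of_tendsto (h₂.tendsto_of_tendsto_ae (fun n => h₁.smulMeas (c n))
    (h₁.integrable.norm.const_mul (max C 1)) (fun n => Eventually.of_forall fun x => ?_) ?_)
    (Eventually.of_forall fun n => hXm (c n) ν hν)
  · rw [norm_mul]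
    exact mul_le_mul_of_nonneg_right (hc1 n x) (norm_nonneg _)
  · filter_upwards [hc] with x hx
    exact hx.mul_const _

end HasDensity

variable [BorelSpace Ω] [T2Space Ω] [LocallyCompactSpace Ω]

/-- The sum of three dominating measures serves all at once, so that identities between up to three
measures can be checked pointwise on densities. -/
lemma exists_hasDensity₃ (ν₁ ν₂ ν₃ : Meas 𝕜 Ω) : ∃ m : Measure Ω, IsFiniteMeasure m ∧
    m.InnerRegular ∧ (∃ a, HasDensity m a ν₁) ∧ (∃ a, HasDensity m a ν₂) ∧
    ∃ a, HasDensity m a ν₃ := by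
  obtain ⟨m₁, hf₁, hr₁, h₁⟩ := exists_measure_dominating ν₁
  obtain ⟨m₂, hf₂, hr₂, h₂⟩ := exists_measure_dominating ν₂
  obtain ⟨m₃, hf₃, hr₃, h₃⟩ := exists_measure_dominating ν₃
  have hi : ∀ f : C₀(Ω, 𝕜), Integrable (fun x => ‖f x‖) (m₁ + m₂ + m₃) := fun f =>
    (Integrable.of_bound (map_continuous f).aestronglyMeasurable ‖f‖
        (Eventually.of_forall (norm_apply_le f))).norm
  have key : ∀ (ν : Meas 𝕜 Ω) (m : Measure Ω), m ≤ m₁ + m₂ + m₃ →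
      (∀ f : C₀(Ω, 𝕜), ‖ν f‖ ≤ ∫ x, ‖f x‖ ∂m) → ∃ a, HasDensity (m₁ + m₂ + m₃) a ν := by
    intro ν m hm h
    obtain ⟨a, ha, ha'⟩ := exists_density (m₁ + m₂ + m₃) ν fun f =>
      (h f).trans (integral_mono_measure hm (Eventually.of_forall fun _ => norm_nonneg _) (hi f))
    exact ⟨a, ha, ha'⟩
  exact ⟨m₁ + m₂ + m₃, inferInstance, inferInstance,
    key ν₁ m₁ (by rw [add_assoc]; exact Measure.le_add_right le_rfl) h₁,
    key ν₂ m₂ (Measure.le_add_right (Measure.le_add_left le_rfl)) h₂,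
    key ν₃ m₃ (Measure.le_add_left le_rfl) h₃⟩

end Density


/-! ### Indicator functions as multipliers -/

section Indicator

variable {𝕜 Ω : Type*} [RCLike 𝕜]

lemma stronglyMeasurable_indicator_one [MeasurableSpace Ω] {E : Set Ω} (hE : MeasurableSet E) :
    StronglyMeasurable (E.indicator fun _ => (1 : 𝕜)) := stronglyMeasurable_const.indicator hE

lemma norm_indicator_one_le (E : Set Ω) (x : Ω) : ‖E.indicator (fun _ => (1 : 𝕜)) x‖ ≤ 1 := by
  by_cases h : x ∈ E <;> simp [h]

lemma indicator_one_mul (E : Set Ω) (a : Ω → 𝕜) :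
    (fun x => E.indicator (fun _ => (1 : 𝕜)) x * a x) = E.indicator a := by
  ext x
  by_cases h : x ∈ E <;> simp [h]

end Indicator

/-! ### Mutual singularity and band projections -/

section Singular

variable {𝕜 Ω : Type*} [RCLike 𝕜] [TopologicalSpace Ω]

/-- Mutual singularity, expressed by the norm. -/
def Sing (ν ρ : Meas 𝕜 Ω) : Prop := ‖ν + ρ‖ = ‖ν‖ + ‖ρ‖ ∧ ‖ν - ρ‖ = ‖ν‖ + ‖ρ‖

lemma Sing.symm {ν ρ : Meas 𝕜 Ω} (h : Sing ν ρ) : Sing ρ ν :=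
  ⟨by rw [add_comm, h.1, add_comm], by rw [norm_sub_rev, h.2, add_comm]⟩

lemma Sing.zero_right (ν : Meas 𝕜 Ω) : Sing ν 0 := by simp [Sing]

lemma Sing.eq_zero {ν : Meas 𝕜 Ω} (h : Sing ν ν) : ν = 0 := by
  have := h.2
  rw [sub_self, norm_zero] at this
  have h0 := norm_nonneg ν
  exact norm_eq_zero.1 (by linarith)

/-- The parallelogram law turns the two equalities into |a||b| = 0. Both signs are needed, since
positive a and b satisfy the first equality. -/
lemma norm_add_eq_and_norm_sub_eq_iff (a b : 𝕜) :
    (‖a + b‖ = ‖a‖ + ‖b‖ ∧ ‖a - b‖ = ‖a‖ + ‖b‖) ↔ a * b = 0 := by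
  constructor
  · rintro ⟨h₁, h₂⟩
    have h := parallelogram_law_with_norm 𝕜 a b
    rw [h₁, h₂] at h
    have : ‖a‖ * ‖b‖ = 0 := by nlinarith
    rwa [← norm_mul, norm_eq_zero] at this
  · intro h
    rcases mul_eq_zero.1 h with rfl | rfl <;> simp

variable [MeasurableSpace Ω] [BorelSpace Ω] [T2Space Ω] [LocallyCompactSpace Ω]

/-- Norms are integrals of moduli of densities, and the triangle inequality holds pointwise;
equality of integrals therefore forces equality almost everywhere. -/
lemma HasDensity.sing_iff {m : Measure Ω} [IsFiniteMeasure m] [m.InnerRegular] {a b : Ω → 𝕜}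
    {ν ρ : Meas 𝕜 Ω} (h₁ : HasDensity m a ν) (h₂ : HasDensity m b ρ) :
    Sing ν ρ ↔ ∀ᵐ x ∂m, a x * b x = 0 := by
  have key : ∀ c : Ω → 𝕜, Integrable c m → (∀ x, ‖c x‖ ≤ ‖a x‖ + ‖b x‖) →
      (∫ x, ‖c x‖ ∂m = ∫ x, ‖a x‖ ∂m + ∫ x, ‖b x‖ ∂m ↔ ∀ᵐ x ∂m, ‖c x‖ = ‖a x‖ + ‖b x‖) := by
    intro c hc hle
    rw [← integral_add h₁.integrable.norm h₂.integrable.norm,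
      show (∫ x, ‖c x‖ ∂m = ∫ x, (‖a x‖ + ‖b x‖) ∂m ↔ _) from
        integral_eq_iff_of_ae_le hc.norm (h₁.integrable.norm.add h₂.integrable.norm)
          (Eventually.of_forall hle)]
    rfl
  rw [Sing, (h₁.add h₂).norm_eq, (h₁.sub h₂).norm_eq, h₁.norm_eq, h₂.norm_eq,
    key _ (h₁.add h₂).integrable fun x => norm_add_le _ _,
    key _ (h₁.sub h₂).integrable fun x => norm_sub_le _ _, ← eventually_and]
  exact eventually_congr (Eventually.of_forall fun x => norm_add_eq_and_norm_sub_eq_iff _ _)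

lemma Sing.add_right {ν ρ₁ ρ₂ : Meas 𝕜 Ω} (h₁ : Sing ν ρ₁) (h₂ : Sing ν ρ₂) :
    Sing ν (ρ₁ + ρ₂) := by
  obtain ⟨m, _, _, ⟨a, ha⟩, ⟨b, hb⟩, ⟨c, hc⟩⟩ := exists_hasDensity₃ ν ρ₁ ρ₂
  rw [ha.sing_iff hb] at h₁
  rw [ha.sing_iff hc] at h₂
  rw [ha.sing_iff (hb.add hc)]
  filter_upwards [h₁, h₂] with x h1 h2
  rw [Pi.add_apply, mul_add, h1, h2, add_zero]

lemma Sing.smul_right {ν ρ : Meas 𝕜 Ω} (h : Sing ν ρ) (c : 𝕜) : Sing ν (c • ρ) := by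
  obtain ⟨m, _, _, ⟨a, ha⟩, ⟨b, hb⟩, -⟩ := exists_hasDensity₃ ν ρ ρ
  rw [ha.sing_iff hb] at h
  rw [ha.sing_iff (hb.smul c)]
  filter_upwards [h] with x h1
  rw [mul_left_comm, h1, mul_zero]

/-- The measures that are singular to `ν`. -/
def singTo (ν : Meas 𝕜 Ω) : Submodule 𝕜 (Meas 𝕜 Ω) where
  carrier := {ρ | Sing ν ρ}
  add_mem' := Sing.add_right
  zero_mem' := Sing.zero_right ν
  smul_mem' c _ h := h.smul_right c

lemma Sing.sub_right {ν ρ₁ ρ₂ : Meas 𝕜 Ω} (h₁ : Sing ν ρ₁) (h₂ : Sing ν ρ₂) :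
    Sing ν (ρ₁ - ρ₂) := (singTo ν).sub_mem h₁ h₂

/-- Spans of mutually singular sets are mutually singular. -/
lemma sing_of_mem_span {A B : Set (Meas 𝕜 Ω)} (h : ∀ ν ∈ A, ∀ ρ ∈ B, Sing ν ρ)
    {ν ρ : Meas 𝕜 Ω} (hν : ν ∈ Submodule.span 𝕜 A) (hρ : ρ ∈ Submodule.span 𝕜 B) : Sing ν ρ := by
  have h₁ : ∀ ν ∈ A, Sing ν ρ := fun ν' hν' =>
    (Submodule.span_le (p := singTo ν')).2 (fun ρ' hρ' => h ν' hν' ρ' hρ') hρ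
  exact ((Submodule.span_le (p := singTo ρ)).2 (fun ν' hν' => (h₁ ν' hν').symm) hν).symm

/-- The restriction is built from one density and then works for every other, which makes
restriction independent of the reference measure. -/
lemma exists_restriction (ν : Meas 𝕜 Ω) {E : Set Ω} (hE : MeasurableSet E) :
    ∃ ρ : Meas 𝕜 Ω, ∀ (m : Measure Ω) [IsFiniteMeasure m] [m.InnerRegular] (a : Ω → 𝕜),
      HasDensity m a ν → HasDensity m (E.indicator a) ρ := by
  obtain ⟨m₀, _, _, ⟨a₀, ha₀⟩, -, -⟩ := exists_hasDensity₃ ν ν ν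
  obtain ⟨ρ, hρ⟩ := HasDensity.exists_of_integrable (ha₀.integrable.indicator hE)
  refine ⟨ρ, fun m _ _ a ha => ?_⟩
  rw [← indicator_one_mul] at hρ ⊢
  exact ha₀.mul_of_hasDensity_mul (stronglyMeasurable_indicator_one hE) one_pos
    (norm_indicator_one_le E) hρ ha

open Classical in
/-- The restriction of a measure to a Borel set. -/
def cut (E : Set Ω) (ν : Meas 𝕜 Ω) : Meas 𝕜 Ω :=
  if hE : MeasurableSet E then (exists_restriction ν hE).choose else 0

lemma HasDensity.cut {m : Measure Ω} [IsFiniteMeasure m] [m.InnerRegular] {a : Ω → 𝕜}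
    {ν : Meas 𝕜 Ω} (h : HasDensity m a ν) {E : Set Ω} (hE : MeasurableSet E) :
    HasDensity m (E.indicator a) (cut E ν) := by
  rw [GroupMeas.cut, dif_pos hE]
  exact (exists_restriction ν hE).choose_spec m a h

variable {X : Submodule 𝕜 (Meas 𝕜 Ω)} (hX : IsClosed (X : Set (Meas 𝕜 Ω)))
  (hXm : ∀ (φ : C₀(Ω, 𝕜)), ∀ ν ∈ X, smulMeas φ ν ∈ X)

include hX hXm in
lemma cut_mem_of_mem {E : Set Ω} (hE : MeasurableSet E) {ν : Meas 𝕜 Ω} (hν : ν ∈ X) :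
    cut E ν ∈ X := by
  obtain ⟨m, _, _, ⟨a, ha⟩, -, -⟩ := exists_hasDensity₃ ν ν ν
  have h := ha.cut hE
  rw [← indicator_one_mul] at h
  exact ha.mem_of_mul hX hXm (stronglyMeasurable_indicator_one hE).aestronglyMeasurable
    (norm_indicator_one_le E) hν h

lemma cut_cut {E F : Set Ω} (hE : MeasurableSet E) (hF : MeasurableSet F) (ν : Meas 𝕜 Ω) :
    cut E (cut F ν) = cut (E ∩ F) ν := by
  obtain ⟨m, _, _, ⟨a, ha⟩, -, -⟩ := exists_hasDensity₃ ν ν ν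
  refine ((ha.cut hF).cut hE).unique ?_
  rw [Set.indicator_indicator]
  exact ha.cut (hE.inter hF)

lemma cut_union {E F : Set Ω} (hE : MeasurableSet E) (hF : MeasurableSet F) (h : Disjoint E F)
    (ν : Meas 𝕜 Ω) : cut (E ∪ F) ν = cut E ν + cut F ν := by
  obtain ⟨m, _, _, ⟨a, ha⟩, -, -⟩ := exists_hasDensity₃ ν ν ν
  refine (ha.cut (hE.union hF)).unique ?_
  rw [Set.indicator_union_of_disjoint h]
  exact (ha.cut hE).add (ha.cut hF)

lemma norm_cut_union {E F : Set Ω} (hE : MeasurableSet E) (hF : MeasurableSet F) (h : Disjoint E F)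
    (ν : Meas 𝕜 Ω) : ‖cut (E ∪ F) ν‖ = ‖cut E ν‖ + ‖cut F ν‖ := by
  obtain ⟨m, _, _, ⟨a, ha⟩, -, -⟩ := exists_hasDensity₃ ν ν ν
  have hs : Sing (cut E ν) (cut F ν) := by
    rw [(ha.cut hE).sing_iff (ha.cut hF)]
    refine Eventually.of_forall fun x => ?_
    by_cases hx : x ∈ E
    · simp [Set.disjoint_left.1 h hx]
    · simp [hx]
  rw [cut_union hE hF h, hs.1]

lemma norm_cut_le {E : Set Ω} (hE : MeasurableSet E) (ν : Meas 𝕜 Ω) : ‖cut E ν‖ ≤ ‖ν‖ := by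
  obtain ⟨m, _, _, ⟨a, ha⟩, -, -⟩ := exists_hasDensity₃ ν ν ν
  rw [(ha.cut hE).norm_eq, ha.norm_eq]
  exact integral_mono (ha.cut hE).integrable.norm ha.integrable.norm
    fun x => norm_indicator_le_norm_self _ _

-- Finite unions are handled by additivity on disjoint pieces; the partial unions then converge in
-- norm by dominated convergence, and X is closed.
include hX hXm in
lemma cut_iUnion_mem (ν : Meas 𝕜 Ω) {E : ℕ → Set Ω} (hE : ∀ n, MeasurableSet (E n))
    (h : ∀ n, cut (E n) ν ∈ X) : cut (⋃ n, E n) ν ∈ X := by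
  have hU : ∀ n, MeasurableSet (partialSups E n) := fun n => by
    rw [partialSups_eq_biUnion_range]
    exact Finset.measurableSet_biUnion _ fun k _ => hE k
  have h1 : ∀ n, cut (partialSups E n) ν ∈ X := by
    intro n
    induction n with
    | zero => simpa using h 0
    | succ n ih =>
      have e : partialSups E (n + 1) = partialSups E n ∪ ((partialSups E n)ᶜ ∩ E (n + 1)) := by
        rw [← Order.succ_eq_add_one, partialSups_succ, Set.union_inter_distrib_left]
        simp [Set.sup_eq_union]
      rw [e, cut_union (hU n) ((hU n).compl.inter (hE _)) (Set.disjoint_left.2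
        fun x hx hx' => hx'.1 hx), ← cut_cut (hU n).compl (hE _)]
      exact X.add_mem ih (cut_mem_of_mem hX hXm (hU n).compl (h _))
  obtain ⟨m, _, _, ⟨a, ha⟩, -, -⟩ := exists_hasDensity₃ ν ν ν
  refine hX.mem_of_tendsto ((ha.cut (MeasurableSet.iUnion hE)).tendsto_of_tendsto_ae
    (fun n => ha.cut (hU n)) ha.integrable.norm
    (fun n => Eventually.of_forall fun x => norm_indicator_le_norm_self _ _) ?_)
    (Eventually.of_forall h1)
  refine Eventually.of_forall fun x => tendsto_const_nhds.congr' ?_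
  by_cases hx : x ∈ ⋃ n, E n
  · obtain ⟨k, hk⟩ := Set.mem_iUnion.1 hx
    filter_upwards [eventually_ge_atTop k] with n hn
    have : x ∈ partialSups E n := (le_partialSups_of_le E hn) hk
    rw [Set.indicator_of_mem hx, Set.indicator_of_mem this]
  · refine Eventually.of_forall fun n => ?_
    have : x ∉ partialSups E n := fun h' => hx (by
      have h2 : partialSups E n ≤ ⋃ n, E n := partialSups_le E n _ fun k _ => Set.subset_iUnion E k
      exact h2 h')
    simp only [Set.indicator_of_notMem hx, Set.indicator_of_notMem this]

include hX hXm in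
/-- The projection theorem for bands: a closed subspace that is stable under multiplication by
functions in `C₀(Ω)` has a complement that is singular to it. -/
lemma exists_sub_sing (ρ : Meas 𝕜 Ω) : ∃ p ∈ X, ∀ ν ∈ X, Sing ν (ρ - p) := by
  -- Exhaustion: a union of sets along which the norm of the part in X approaches its supremum
  -- carries all of the part of ρ in X.
  let S : Set ℝ := {s | ∃ E, MeasurableSet E ∧ cut E ρ ∈ X ∧ s = ‖cut E ρ‖}
  have hS0 : S.Nonempty := ⟨_, ∅, MeasurableSet.empty, by
    obtain ⟨m, _, _, ⟨a, ha⟩, -, -⟩ := exists_hasDensity₃ ρ ρ ρ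
    have h := ha.cut MeasurableSet.empty
    have : cut ∅ ρ = 0 := by
      rw [← norm_eq_zero, h.norm_eq]
      simp
    rw [this]
    exact X.zero_mem, rfl⟩
  have hSb : BddAbove S := ⟨‖ρ‖, by
    rintro _ ⟨E, hE, -, rfl⟩
    exact norm_cut_le hE ρ⟩
  obtain ⟨u, -, hu, huS⟩ := exists_seq_tendsto_sSup hS0 hSb
  choose E hE hEX hEu using huS
  set E₀ := ⋃ n, E n with hE₀
  have hE₀m : MeasurableSet E₀ := MeasurableSet.iUnion hE
  have hE₀X : cut E₀ ρ ∈ X := cut_iUnion_mem hX hXm ρ hE hEX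
  have hmax : ∀ F, MeasurableSet F → Disjoint E₀ F → cut F ρ ∈ X → cut F ρ = 0 := by
    intro F hF hd hFX
    have h1 : ‖cut (E₀ ∪ F) ρ‖ ≤ sSup S := le_csSup hSb ⟨_, hE₀m.union hF, by
      rw [cut_union hE₀m hF hd]
      exact X.add_mem hE₀X hFX, rfl⟩
    have h2 : sSup S ≤ ‖cut E₀ ρ‖ := by
      refine le_of_tendsto' hu fun n => ?_
      have : E₀ = E n ∪ (E₀ \ E n) := (Set.union_sdiff_cancel (Set.subset_iUnion E n)).symm
      rw [hEu, this, norm_cut_union (hE n) (hE₀m.diff (hE n)) Set.disjoint_sdiff_right]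
      exact le_add_of_nonneg_right (norm_nonneg _)
    rw [norm_cut_union hE₀m hF hd] at h1
    exact norm_le_zero_iff.1 (by linarith)
  refine ⟨cut E₀ ρ, hE₀X, fun ν hν => ?_⟩
  obtain ⟨m, _, _, ⟨a, ha⟩, ⟨b, hb⟩, -⟩ := exists_hasDensity₃ ν ρ ρ
  wlog hab : StronglyMeasurable a ∧ StronglyMeasurable b generalizing a b
  · exact this _ (ha.congr ha.integrable.1.ae_eq_mk) _ (hb.congr hb.integrable.1.ae_eq_mk)
      ⟨ha.integrable.1.stronglyMeasurable_mk, hb.integrable.1.stronglyMeasurable_mk⟩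
  obtain ⟨ham, hbm⟩ := hab
  rw [ha.sing_iff (hb.sub (hb.cut hE₀m))]
  -- Where a ≠ 0 and |b| ≤ N|a|, b is a bounded multiple of a, so this piece of ρ lies in X. Off E₀
  -- it must vanish by maximality; letting N grow covers every point with a ≠ 0.
  have hF : ∀ N : ℕ, ∀ᵐ x ∂m, x ∉ E₀ → a x ≠ 0 → ‖b x‖ ≤ N * ‖a x‖ → b x = 0 := by
    intro N
    set F : Set Ω := E₀ᶜ ∩ ({x | a x ≠ 0} ∩ {x | ‖b x‖ ≤ N * ‖a x‖}) with hFdef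
    have hFm : MeasurableSet F := by
      refine hE₀m.compl.inter (MeasurableSet.inter ?_ ?_)
      · exact (ham.measurable (measurableSet_singleton 0)).compl
      · exact measurableSet_le hbm.measurable.norm (ham.measurable.norm.const_mul _)
    have hd : Disjoint E₀ F := Set.disjoint_left.2 fun x hx hx' => hx'.1 hx
    have hFX : cut F ρ ∈ X := by
      have h := hb.cut hFm
      have e : F.indicator b = fun x => F.indicator (fun x => b x / a x) x * a x := by
        ext x
        by_cases hx : x ∈ F
        · rw [Set.indicator_of_mem hx, Set.indicator_of_mem hx, div_mul_cancel₀ _ hx.2.1]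
        · simp [hx]
      rw [e] at h
      refine ha.mem_of_mul hX hXm (C := N) ?_ (fun x => ?_) hν h
      · exact ((hbm.measurable.div ham.measurable).indicator hFm).aestronglyMeasurable
      · by_cases hx : x ∈ F
        · rw [Set.indicator_of_mem hx, norm_div, div_le_iff₀ (norm_pos_iff.2 hx.2.1)]
          exact hx.2.2
        · simp [hx]
    have h0 := hmax F hFm hd hFX
    have h1 := (hb.cut hFm).norm_eq
    rw [h0, norm_zero, eq_comm, integral_eq_zero_iff_of_nonneg (fun _ => norm_nonneg _)
      (hb.cut hFm).integrable.norm] at h1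
    filter_upwards [h1] with x hx h2 h3 h4
    have hxF : x ∈ F := ⟨h2, h3, h4⟩
    simpa [hxF] using hx
  rw [← ae_all_iff] at hF
  filter_upwards [hF] with x hx
  by_cases hxE : x ∈ E₀
  · simp [hxE]
  rcases eq_or_ne (a x) 0 with h0 | h0
  · simp [h0]
  · obtain ⟨N, hN⟩ := exists_nat_ge (‖b x‖ / ‖a x‖)
    rw [div_le_iff₀ (norm_pos_iff.2 h0)] at hN
    simp [hx N hxE h0 hN]

include hX hXm in
/-- The band projection. -/
lemma exists_bandProj : ∃ P : Meas 𝕜 Ω →ₗ[𝕜] Meas 𝕜 Ω, (∀ ρ, P ρ ∈ X) ∧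
    ∀ ρ, ∀ ν ∈ X, Sing ν (ρ - P ρ) := by
  choose P hP hPs using exists_sub_sing hX hXm
  -- Uniqueness yields linearity: two candidates differ by an element of X that is singular to
  -- itself.
  have huniq : ∀ ρ p, p ∈ X → (∀ ν ∈ X, Sing ν (ρ - p)) → P ρ = p := by
    intro ρ p hp h
    have hd : P ρ - p ∈ X := X.sub_mem (hP ρ) hp
    have h1 : Sing (P ρ - p) (ρ - p - (ρ - P ρ)) :=
      (h _ hd).sub_right (hPs ρ _ hd)
    rw [sub_sub_sub_cancel_left] at h1
    exact sub_eq_zero.1 h1.eq_zero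
  refine ⟨{ toFun := P, map_add' := fun x y => ?_, map_smul' := fun c x => ?_ }, hP, hPs⟩
  · refine huniq _ _ (X.add_mem (hP x) (hP y)) fun ν hν => ?_
    rw [add_sub_add_comm]
    exact (hPs x ν hν).add_right (hPs y ν hν)
  · refine huniq _ _ (X.smul_mem c (hP x)) fun ν hν => ?_
    rw [RingHom.id_apply, ← smul_sub]
    exact (hPs x ν hν).smul_right c

end Singular

/-! ### Right translations and stabilizers -/

section Translation

variable {𝕜 : Type*} [RCLike 𝕜] {G : Type*} [TopologicalSpace G]

/-- Evaluation at a point, i.e. the Dirac measure. -/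
def dirac (𝕜 : Type*) [RCLike 𝕜] (x : G) : Meas 𝕜 G :=
  LinearMap.mkContinuous
    { toFun := fun f => f x
      map_add' := fun _ _ => rfl
      map_smul' := fun _ _ => rfl } 1 fun f => by
    rw [one_mul]
    exact norm_apply_le f x

@[simp] lemma dirac_apply (x : G) (f : C₀(G, 𝕜)) : dirac 𝕜 x f = f x := rfl

variable [Group G] [IsTopologicalGroup G]

/-- The right translate `y ↦ f (y x)` of `f ∈ C₀(G)`. -/
def rTranslate (x : G) : C₀(G, 𝕜) →L[𝕜] C₀(G, 𝕜) :=
  LinearMap.mkContinuous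
    { toFun := fun f =>
        { toFun := fun y => f (y * x)
          continuous_toFun := (map_continuous f).comp (continuous_mul_const x)
          zero_at_infty' :=
            (zero_at_infty f).comp (Homeomorph.mulRight x).isClosedEmbedding.tendsto_cocompact }
      map_add' := fun _ _ => rfl
      map_smul' := fun _ _ => rfl } 1 fun f => by
    rw [one_mul]
    exact norm_le_of_forall (norm_nonneg f) fun y => norm_apply_le f (y * x)

@[simp] lemma rTranslate_apply (x : G) (f : C₀(G, 𝕜)) (y : G) : rTranslate x f y = f (y * x) := rfl

lemma norm_rTranslate_le (x : G) (f : C₀(G, 𝕜)) : ‖rTranslate x f‖ ≤ ‖f‖ :=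
  norm_le_of_forall (norm_nonneg f) fun y => norm_apply_le f (y * x)

lemma rTranslate_one (f : C₀(G, 𝕜)) : rTranslate 1 f = f := by
  ext y
  simp

lemma rTranslate_rTranslate (x y : G) (f : C₀(G, 𝕜)) :
    rTranslate x (rTranslate y f) = rTranslate (x * y) f := by
  ext z
  simp [mul_assoc]

lemma rTranslate_mul (x : G) (f g : C₀(G, 𝕜)) :
    rTranslate x (f * g) = rTranslate x f * rTranslate x g := rfl

/-- The function `x ↦ f (x⁻¹)`. -/
def invC : C₀(G, 𝕜) →L[𝕜] C₀(G, 𝕜) :=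
  LinearMap.mkContinuous
    { toFun := fun f =>
        { toFun := fun y => f y⁻¹
          continuous_toFun := (map_continuous f).comp continuous_inv
          zero_at_infty' :=
            (zero_at_infty f).comp (Homeomorph.inv G).isClosedEmbedding.tendsto_cocompact }
      map_add' := fun _ _ => rfl
      map_smul' := fun _ _ => rfl } 1 fun f => by
    rw [one_mul]
    exact norm_le_of_forall (norm_nonneg f) fun y => norm_apply_le f y⁻¹

@[simp] lemma invC_apply (f : C₀(G, 𝕜)) (y : G) : invC f y = f y⁻¹ := rfl

/-- Inversion exchanges left and right translation, so continuity and vanishing at infinity carry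
over from the left case. -/
lemma rTranslate_eq (x : G) (f : C₀(G, 𝕜)) :
    rTranslate x f = invC (translate (invC f) x⁻¹) := by
  ext y
  simp

lemma continuous_rTranslate (f : C₀(G, 𝕜)) : Continuous fun x => rTranslate x f := by
  simp only [rTranslate_eq]
  exact invC.continuous.comp ((continuous_translate (invC f)).comp continuous_inv)

lemma tendsto_rTranslate (ν : Meas 𝕜 G) (f : C₀(G, 𝕜)) :
    Tendsto (fun x => ν (rTranslate x f)) (cocompact G) (𝓝 0) := by
  simp only [rTranslate_eq]
  exact (tendsto_translate (ν.comp invC) (invC f)).comp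
    (Homeomorph.inv G).isClosedEmbedding.tendsto_cocompact

/-- This makes stabilizers of nonzero functions and measures compact: a matrix coefficient tends to
0 at infinity but is a nonzero constant on the stabilizer. -/
lemma _root_.IsClosed.isCompact_of_tendsto_cocompact {X E : Type*} [TopologicalSpace X]
    [TopologicalSpace E] [T1Space E] {φ : X → E} {z c : E}
    (hφ : Tendsto φ (cocompact X) (𝓝 z)) {S : Set X}
    (hS : IsClosed S) (hc : c ≠ z) (h : ∀ x ∈ S, φ x = c) : IsCompact S := by
  have h1 : ∀ᶠ x in cocompact X, φ x ≠ c := hφ.eventually_ne hc.symm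
  obtain ⟨A, hA, hAs⟩ := mem_cocompact.1 h1
  refine hA.of_isClosed_subset hS fun x hx => ?_
  by_contra hxA
  exact hAs hxA (h x hx)

/-- The elements under which a function is right invariant. -/
def fStab (f : C₀(G, 𝕜)) : Subgroup G where
  carrier := {x | rTranslate x f = f}
  mul_mem' {x y} hx hy := by
    rw [Set.mem_ofPred_eq, ← rTranslate_rTranslate, show rTranslate y f = f from hy]
    exact hx
  one_mem' := rTranslate_one f
  inv_mem' {x} hx := by
    have : rTranslate x⁻¹ (rTranslate x f) = f := by
      rw [rTranslate_rTranslate, inv_mul_cancel, rTranslate_one]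
    rwa [show rTranslate x f = f from hx] at this

lemma mem_fStab {f : C₀(G, 𝕜)} {x : G} : x ∈ fStab f ↔ rTranslate x f = f := Iff.rfl

lemma isClosed_fStab (f : C₀(G, 𝕜)) : IsClosed (fStab f : Set G) :=
  isClosed_eq (continuous_rTranslate f) continuous_const

lemma isCompact_fStab {f : C₀(G, 𝕜)} (hf : f ≠ 0) : IsCompact (fStab f : Set G) := by
  obtain ⟨y, hy⟩ : ∃ y, f y ≠ 0 := by
    by_contra! h
    exact hf (ZeroAtInftyContinuousMap.ext h)
  exact (isClosed_fStab f).isCompact_of_tendsto_cocompact (tendsto_rTranslate (dirac 𝕜 y) f) hy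
    fun x hx => by rw [mem_fStab.1 hx, dirac_apply]

/-- The right translate of a measure. -/
def rMeas (x : G) : Meas 𝕜 G →L[𝕜] Meas 𝕜 G :=
  (ContinuousLinearMap.compL 𝕜 C₀(G, 𝕜) C₀(G, 𝕜) 𝕜).flip (rTranslate x)

@[simp] lemma rMeas_apply (x : G) (ν : Meas 𝕜 G) (f : C₀(G, 𝕜)) :
    rMeas x ν f = ν (rTranslate x f) := rfl

lemma rMeas_rMeas (x y : G) (ν : Meas 𝕜 G) : rMeas x (rMeas y ν) = rMeas (y * x) ν := by
  ext f
  simp only [rMeas_apply, rTranslate_rTranslate]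

lemma rMeas_one (ν : Meas 𝕜 G) : rMeas 1 ν = ν := by
  ext f
  rw [rMeas_apply, rTranslate_one]

lemma norm_rMeas_le (x : G) (ν : Meas 𝕜 G) : ‖rMeas x ν‖ ≤ ‖ν‖ :=
  (rMeas x ν).opNorm_le_bound (norm_nonneg _) fun f => (ν.le_opNorm _).trans (by
    gcongr
    exact norm_rTranslate_le x f)

lemma norm_rMeas (x : G) (ν : Meas 𝕜 G) : ‖rMeas x ν‖ = ‖ν‖ := by
  refine le_antisymm (norm_rMeas_le x ν) ?_
  have := norm_rMeas_le x⁻¹ (rMeas x ν)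
  rwa [rMeas_rMeas, mul_inv_cancel, rMeas_one] at this

lemma rMeas_smulMeas (x : G) (φ : C₀(G, 𝕜)) (ν : Meas 𝕜 G) :
    rMeas x (smulMeas φ ν) = smulMeas (rTranslate x⁻¹ φ) (rMeas x ν) := by
  ext f
  simp only [rMeas_apply, smulMeas_apply, rTranslate_mul, rTranslate_rTranslate, mul_inv_cancel,
    rTranslate_one]

/-- The elements under which a measure is right invariant. -/
def mStab (ν : Meas 𝕜 G) : Subgroup G where
  carrier := {x | rMeas x ν = ν}
  mul_mem' {x y} hx hy := by
    rw [Set.mem_ofPred_eq, ← rMeas_rMeas, show rMeas x ν = ν from hx]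
    exact hy
  one_mem' := rMeas_one ν
  inv_mem' {x} hx := by
    have : rMeas x⁻¹ (rMeas x ν) = ν := by
      rw [rMeas_rMeas, mul_inv_cancel, rMeas_one]
    rwa [show rMeas x ν = ν from hx] at this

lemma mem_mStab {ν : Meas 𝕜 G} {x : G} : x ∈ mStab ν ↔ rMeas x ν = ν := Iff.rfl

lemma isClosed_mStab (ν : Meas 𝕜 G) : IsClosed (mStab ν : Set G) := by
  have : (mStab ν : Set G) = ⋂ f : C₀(G, 𝕜), {x | ν (rTranslate x f) = ν f} := by
    ext x
    simp only [SetLike.mem_coe, mem_mStab, ContinuousLinearMap.ext_iff, rMeas_apply,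
      Set.mem_iInter, Set.mem_ofPred_eq]
  rw [this]
  exact isClosed_iInter fun f =>
    isClosed_eq (ν.continuous.comp (continuous_rTranslate f)) continuous_const

lemma isCompact_mStab {ν : Meas 𝕜 G} (hν : ν ≠ 0) : IsCompact (mStab ν : Set G) := by
  obtain ⟨f, hf⟩ : ∃ f, ν f ≠ 0 := by
    by_contra! h
    exact hν (ContinuousLinearMap.ext h)
  exact (isClosed_mStab ν).isCompact_of_tendsto_cocompact (tendsto_rTranslate ν f) hf
    fun x hx => by rw [← rMeas_apply, mem_mStab.1 hx]

lemma mStab_inf_fStab_le (ν : Meas 𝕜 G) (φ : C₀(G, 𝕜)) :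
    mStab ν ⊓ fStab φ ≤ mStab (smulMeas φ ν) := fun x hx => by
  rw [mem_mStab, rMeas_smulMeas, mem_mStab.1 hx.1, mem_fStab.1 ((fStab φ).inv_mem hx.2)]

lemma mStab_inf_le_add (ν ρ : Meas 𝕜 G) : mStab ν ⊓ mStab ρ ≤ mStab (ν + ρ) := fun x hx => by
  rw [mem_mStab, map_add, mem_mStab.1 hx.1, mem_mStab.1 hx.2]

lemma mStab_le_smul (c : 𝕜) (ν : Meas 𝕜 G) : mStab ν ≤ mStab (c • ν) := fun x hx => by
  rw [mem_mStab, map_smul, mem_mStab.1 hx]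

lemma mStab_zero : mStab (0 : Meas 𝕜 G) = ⊤ := by
  rw [eq_top_iff]
  intro x _
  rw [mem_mStab, map_zero]

lemma iInf_mStab_le_of_tendsto {νs : ℕ → Meas 𝕜 G} {ν : Meas 𝕜 G} (h : Tendsto νs atTop (𝓝 ν)) :
    ⨅ n, mStab (νs n) ≤ mStab ν := fun x hx => by
  have h1 : Tendsto (fun n => rMeas x (νs n)) atTop (𝓝 (rMeas x ν)) :=
    ((rMeas x).continuous.tendsto ν).comp h
  refine tendsto_nhds_unique h1 (h.congr fun n => ?_)
  exact (mem_mStab.1 ((Subgroup.mem_iInf.1 hx) n)).symm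

end Translation

/-! ### Averaging over compact subgroups -/

section Average

variable {𝕜 : Type*} [RCLike 𝕜] {G : Type*} [TopologicalSpace G] [Group G]
  [IsTopologicalGroup G] [MeasurableSpace G] [BorelSpace G]

instance (L : CompactSubgroup G) : (probHaar L).IsHaarMeasure :=
  inferInstanceAs (Measure.haarMeasure ⊤).IsHaarMeasure

/-- Compact groups are unimodular: a right translate of the Haar probability is again a Haar
probability, hence the same. -/
instance (L : CompactSubgroup G) : (probHaar L).IsMulRightInvariant := ⟨fun g => by
  have : IsProbabilityMeasure (Measure.map (· * g) (probHaar L)) :=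
    Measure.isProbabilityMeasure_map (continuous_mul_const g).aemeasurable
  exact Measure.isHaarMeasure_eq_of_isProbabilityMeasure _ _⟩

/-- The average of a function over the right translations by a compact subgroup. -/
def avg (L : CompactSubgroup G) : C₀(G, 𝕜) →L[𝕜] C₀(G, 𝕜) := odot (haarMeas 𝕜 L)

lemma avg_apply (L : CompactSubgroup G) (f : C₀(G, 𝕜)) (x : G) :
    avg L f x = ∫ y : L.1, f (x * y) ∂(probHaar L) := rfl

lemma norm_avg_le (L : CompactSubgroup G) (f : C₀(G, 𝕜)) : ‖avg L f‖ ≤ ‖f‖ := by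
  refine norm_le_of_forall (norm_nonneg f) fun x => ?_
  rw [avg_apply]
  have h := norm_integral_le_of_norm_le_const (μ := probHaar L)
    (Eventually.of_forall fun y : L.1 => norm_apply_le f (x * y))
  simpa using h

lemma avg_mul (L : CompactSubgroup G) {f : C₀(G, 𝕜)} (hf : L.1 ≤ fStab f) (g : C₀(G, 𝕜)) :
    avg L (f * g) = f * avg L g := by
  ext x
  rw [ZeroAtInftyContinuousMap.mul_apply, avg_apply, avg_apply, ← integral_const_mul]
  refine integral_congr_ae (Eventually.of_forall fun y => ?_)
  have h := DFunLike.congr_fun (mem_fStab.1 (hf y.2)) x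
  rw [rTranslate_apply] at h
  simp only [ZeroAtInftyContinuousMap.mul_apply, h]

lemma avg_eq_self {L : CompactSubgroup G} {f : C₀(G, 𝕜)} (hf : L.1 ≤ fStab f) : avg L f = f := by
  ext x
  rw [avg_apply]
  have h : ∀ y : L.1, f (x * y) = f x := fun y =>
    DFunLike.congr_fun (mem_fStab.1 (hf y.2)) x
  simp [h]

lemma avg_rTranslate {L : CompactSubgroup G} {z : G} (hz : z ∈ L.1) (f : C₀(G, 𝕜)) :
    avg L (rTranslate z f) = avg L f := by
  ext x
  rw [avg_apply, avg_apply]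
  have := integral_mul_right_eq_self (μ := probHaar L) (fun y : L.1 => f (x * y)) ⟨z, hz⟩
  simpa [mul_assoc] using this

lemma le_fStab_avg (L : CompactSubgroup G) (f : C₀(G, 𝕜)) : L.1 ≤ fStab (avg L f) := fun z hz => by
  ext x
  rw [rTranslate_apply, avg_apply, avg_apply]
  have := integral_mul_left_eq_self (μ := probHaar L) (fun y : L.1 => f (x * y)) ⟨z, hz⟩
  simpa [mul_assoc] using this

/-- As a C₀-valued Bochner integral, the average can be passed through any continuous functional. -/
lemma avg_eq_integral (L : CompactSubgroup G) (f : C₀(G, 𝕜)) :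
    Integrable (fun y : L.1 => rTranslate (y : G) f) (probHaar L) ∧
      avg L f = ∫ y : L.1, rTranslate (y : G) f ∂(probHaar L) := by
  have hi : Integrable (fun y : L.1 => rTranslate (y : G) f) (probHaar L) :=
    ((continuous_rTranslate f).comp continuous_subtype_val).integrable_of_hasCompactSupport
      (HasCompactSupport.of_compactSpace _)
  refine ⟨hi, ?_⟩
  ext x
  have := (dirac 𝕜 x).integral_comp_comm hi
  rw [dirac_apply] at this
  rw [← this]
  rfl

lemma apply_avg (L : CompactSubgroup G) {ν : Meas 𝕜 G} (h : L.1 ≤ mStab ν) (f : C₀(G, 𝕜)) :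
    ν (avg L f) = ν f := by
  obtain ⟨hi, he⟩ := avg_eq_integral L f
  rw [he, ← ν.integral_comp_comm hi]
  have : ∀ y : L.1, ν (rTranslate (y : G) f) = ν f := fun y => by
    rw [← rMeas_apply, mem_mStab.1 (h y.2)]
  simp [this]

lemma norm_avg_sub_le (L : CompactSubgroup G) {f : C₀(G, 𝕜)} {ε : ℝ}
    (h : ∀ y ∈ L.1, ‖rTranslate y f - f‖ ≤ ε) (hε : 0 ≤ ε) : ‖avg L f - f‖ ≤ ε := by
  refine norm_le_of_forall hε fun x => ?_
  have h1 : (avg L f - f) x = ∫ y : L.1, (f (x * y) - f x) ∂(probHaar L) := by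
    rw [integral_sub]
    · simp [avg_apply]
    · exact integrable_restrict 𝕜 L (translate f x)
    · exact integrable_const _
  rw [h1]
  have h2 := norm_integral_le_of_norm_le_const (μ := probHaar L)
    (f := fun y : L.1 => f (x * y) - f x) (Eventually.of_forall fun y : L.1 =>
      (norm_apply_le (rTranslate (y : G) f - f) x).trans (h y y.2))
  simpa using h2

/-- Convolution by `λ_L` from the right. -/
def convHaar (L : CompactSubgroup G) : Meas 𝕜 G →L[𝕜] Meas 𝕜 G :=
  (ContinuousLinearMap.compL 𝕜 C₀(G, 𝕜) C₀(G, 𝕜) 𝕜).flip (avg L)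

lemma conv_haarMeas (ν : Meas 𝕜 G) (L : CompactSubgroup G) :
    conv ν (haarMeas 𝕜 L) = convHaar L ν := rfl

lemma convHaar_apply (L : CompactSubgroup G) (ν : Meas 𝕜 G) (f : C₀(G, 𝕜)) :
    convHaar L ν f = ν (avg L f) := rfl

lemma norm_convHaar_le (L : CompactSubgroup G) (ν : Meas 𝕜 G) : ‖convHaar L ν‖ ≤ ‖ν‖ :=
  (convHaar L ν).opNorm_le_bound (norm_nonneg _) fun f => (ν.le_opNorm _).trans (by
    gcongr
    exact norm_avg_le L f)

lemma le_mStab_convHaar (L : CompactSubgroup G) (ν : Meas 𝕜 G) : L.1 ≤ mStab (convHaar L ν) :=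
  fun z hz => by
    ext f
    rw [rMeas_apply, convHaar_apply, convHaar_apply, avg_rTranslate hz]

lemma convHaar_eq_self {L : CompactSubgroup G} {ν : Meas 𝕜 G} (h : L.1 ≤ mStab ν) :
    convHaar L ν = ν := by
  ext f
  rw [convHaar_apply, apply_avg L h]

lemma mem_cosetMeas_iff {L : CompactSubgroup G} {ν : Meas 𝕜 G} :
    ν ∈ cosetMeas 𝕜 L ↔ L.1 ≤ mStab ν := by
  constructor
  · intro h
    rw [show ν = convHaar L ν from h]
    exact le_mStab_convHaar L ν
  · intro h
    exact (convHaar_eq_self h).symm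

lemma convHaar_convHaar_of_le {L' L : CompactSubgroup G} (h : L' ≤ L) (ν : Meas 𝕜 G) :
    convHaar L (convHaar L' ν) = convHaar L ν := by
  ext f
  rw [convHaar_apply, convHaar_apply, convHaar_apply, avg_eq_self (le_trans h (le_fStab_avg L f))]

lemma avg_avg_of_le {L' L : CompactSubgroup G} (h : L' ≤ L) (f : C₀(G, 𝕜)) :
    avg L (avg L' f) = avg L f := by
  ext x
  have := DFunLike.congr_fun (convHaar_eq_self (L := L')
    (le_trans h (le_mStab_convHaar L (dirac 𝕜 x)))) f
  simpa [convHaar_apply] using this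

/-- Only the factor φ feels the averaging when ν is already invariant. Norm convergence of averaged
measures thus reduces to uniform convergence of averaged functions. -/
lemma convHaar_smulMeas {L : CompactSubgroup G} {ν : Meas 𝕜 G} (h : L.1 ≤ mStab ν)
    (φ : C₀(G, 𝕜)) : convHaar L (smulMeas φ ν) = smulMeas (avg L φ) ν := by
  ext f
  rw [convHaar_apply, smulMeas_apply, smulMeas_apply, ← apply_avg L h, mul_comm φ,
    avg_mul L (le_fStab_avg L f), mul_comm, ← avg_mul L (le_fStab_avg L φ), apply_avg L h]

variable [T2Space G]

/-- By compactness the decreasing subgroups eventually enter the open set of elements that move f by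
less than ε. -/
lemma exists_norm_avg_sub_le {L : ℕ → CompactSubgroup G} (hL : Antitone L) {f : C₀(G, 𝕜)}
    (hf : ⨅ n, (L n).1 ≤ fStab f) {ε : ℝ} (hε : 0 < ε) : ∃ n, ∀ k ≥ n, ‖avg (L k) f - f‖ ≤ ε := by
  have ho : IsOpen {y | ‖rTranslate y f - f‖ < ε} :=
    isOpen_lt ((continuous_rTranslate f).sub continuous_const).norm continuous_const
  obtain ⟨n, hn⟩ := exists_subset_nhds_of_isCompact (V := fun n => ((L n).1 : Set G))
    (Antitone.directed_ge fun i j hij => hL hij) (fun n => (L n).2)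
    (U := {y | ‖rTranslate y f - f‖ < ε}) fun x hx => ho.mem_nhds (by
      have : x ∈ fStab f := hf (by simpa [Subgroup.mem_iInf] using hx)
      rw [Set.mem_ofPred_eq, mem_fStab.1 this, sub_self, norm_zero]
      exact hε)
  exact ⟨n, fun k hk => norm_avg_sub_le (L k) (fun y hy => le_of_lt (hn (hL hk hy))) hε.le⟩

lemma tendsto_avg {L : ℕ → CompactSubgroup G} (hL : Antitone L) {M : CompactSubgroup G}
    (hM : M.1 = ⨅ n, (L n).1) (f : C₀(G, 𝕜)) :
    Tendsto (fun n => avg (L n) f) atTop (𝓝 (avg M f)) := by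
  rw [Metric.tendsto_atTop]
  intro ε hε
  have hML : ∀ n, M ≤ L n := fun n => hM.le.trans (iInf_le _ n)
  obtain ⟨n, hn⟩ := exists_norm_avg_sub_le hL (hM.symm.le.trans (le_fStab_avg M f)) (half_pos hε)
  refine ⟨n, fun k hk => ?_⟩
  rw [dist_eq_norm, ← avg_avg_of_le (hML k)]
  exact (hn k hk).trans_lt (half_lt_self hε)

end Average

/-! ### Bands generated by invariant measures -/

section Band

variable {𝕜 : Type*} [RCLike 𝕜] {G : Type*} [TopologicalSpace G] [Group G]
  [IsTopologicalGroup G]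

lemma isClosed_setOf_tendsto {E : Type*} [NormedAddCommGroup E] [NormedSpace 𝕜 E]
    {T : ℕ → E →L[𝕜] E} {S : E →L[𝕜] E} (hT : ∀ n x, ‖T n x‖ ≤ ‖x‖) (hS : ∀ x, ‖S x‖ ≤ ‖x‖) :
    IsClosed {x | Tendsto (fun n => T n x) atTop (𝓝 (S x))} := by
  refine isClosed_of_closure_subset fun x hx => ?_
  rw [Set.mem_ofPred_eq, Metric.tendsto_atTop]
  intro ε hε
  obtain ⟨y, hy, hxy⟩ := Metric.mem_closure_iff.1 hx (ε / 3) (by positivity)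
  obtain ⟨N, hN⟩ := Metric.tendsto_atTop.1 hy (ε / 3) (by positivity)
  refine ⟨N, fun n hn => ?_⟩
  have h1 : dist (T n x) (T n y) < ε / 3 := by
    rw [dist_eq_norm, ← map_sub]
    exact (hT n _).trans_lt (by rwa [← dist_eq_norm])
  have h2 : dist (S y) (S x) < ε / 3 := by
    rw [dist_eq_norm, ← map_sub]
    exact (hS _).trans_lt (by rwa [← dist_eq_norm, dist_comm])
  calc dist (T n x) (S x) ≤ dist (T n x) (T n y) + dist (T n y) (S y) + dist (S y) (S x) :=
        dist_triangle4 _ _ _ _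
    _ < ε := by linarith [hN n hn]

lemma norm_smulMeas_le {Ω : Type*} [TopologicalSpace Ω] (φ : C₀(Ω, 𝕜)) (ν : Meas 𝕜 Ω) :
    ‖smulMeas φ ν‖ ≤ ‖φ‖ * ‖ν‖ :=
  (smulMeas φ ν).opNorm_le_bound (by positivity) fun f => by
    rw [smulMeas_apply, mul_comm ‖φ‖, mul_assoc]
    exact (ν.le_opNorm _).trans (by gcongr; exact norm_mul_le _ _)

lemma smulMeas_sub {Ω : Type*} [TopologicalSpace Ω] (φ ψ : C₀(Ω, 𝕜)) (ν : Meas 𝕜 Ω) :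
    smulMeas (φ - ψ) ν = smulMeas φ ν - smulMeas ψ ν := by
  ext f
  simp only [smulMeas_apply, sub_mul, map_sub, sub_apply]

lemma smulMeas_smulMeas {Ω : Type*} [TopologicalSpace Ω] (φ ψ : C₀(Ω, 𝕜)) (ν : Meas 𝕜 Ω) :
    smulMeas φ (smulMeas ψ ν) = smulMeas (ψ * φ) ν := by
  ext f
  simp only [smulMeas_apply, mul_assoc]

lemma tendsto_smulMeas {Ω ι : Type*} [TopologicalSpace Ω] {l : Filter ι} {φ : ι → C₀(Ω, 𝕜)}
    {ψ : C₀(Ω, 𝕜)} (h : Tendsto φ l (𝓝 ψ)) (ν : Meas 𝕜 Ω) :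
    Tendsto (fun i => smulMeas (φ i) ν) l (𝓝 (smulMeas ψ ν)) := by
  rw [tendsto_iff_norm_sub_tendsto_zero] at h ⊢
  refine squeeze_zero (fun _ => norm_nonneg _) (fun i => ?_) (by simpa using h.mul_const ‖ν‖)
  rw [← smulMeas_sub]
  exact norm_smulMeas_le _ _

/-- C₀ functions bounded by 1 and tending to 1 almost everywhere act as an approximate unit; thus an
invariant measure itself, not only its multiples, lies in the band. -/
lemma exists_tendsto_smulMeas {Ω : Type*} [TopologicalSpace Ω] [LocallyCompactSpace Ω] [T2Space Ω]
    [MeasurableSpace Ω] [BorelSpace Ω] (ν : Meas 𝕜 Ω) :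
    ∃ φ : ℕ → C₀(Ω, 𝕜), Tendsto (fun n => smulMeas (φ n) ν) atTop (𝓝 ν) := by
  obtain ⟨m, _, _, ⟨a, ha⟩, -, -⟩ := exists_hasDensity₃ ν ν ν
  obtain ⟨c, hc1, hc⟩ := exists_seq_tendsto_ae m (g := fun _ => (1 : 𝕜))
    aestronglyMeasurable_const one_pos (by simp)
  refine ⟨c, ha.tendsto_of_tendsto_ae (fun n => ha.smulMeas (c n)) ha.integrable.norm
    (fun n => Eventually.of_forall fun x => ?_) ?_⟩
  · rw [norm_mul]
    exact mul_le_of_le_one_left (norm_nonneg _) (hc1 n x)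
  · filter_upwards [hc] with x hx
    simpa using hx.mul_const (a x)

variable (𝕜) in
/-- The band generated by the measures that are right invariant under a subgroup in `𝓢`. -/
def band (𝓢 : Set (CompactSubgroup G)) : Submodule 𝕜 (Meas 𝕜 G) :=
  (Submodule.span 𝕜 {σ | ∃ H ∈ 𝓢, ∃ (ρ : Meas 𝕜 G) (φ : C₀(G, 𝕜)), H.1 ≤ mStab ρ ∧
    σ = smulMeas φ ρ}).topologicalClosure

lemma isClosed_band (𝓢 : Set (CompactSubgroup G)) : IsClosed (band 𝕜 𝓢 : Set (Meas 𝕜 G)) :=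
  Submodule.isClosed_topologicalClosure _

lemma smulMeas_mem_band_of_le {𝓢 : Set (CompactSubgroup G)} {H : CompactSubgroup G} (hH : H ∈ 𝓢)
    {ρ : Meas 𝕜 G} (hρ : H.1 ≤ mStab ρ) (φ : C₀(G, 𝕜)) : smulMeas φ ρ ∈ band 𝕜 𝓢 :=
  Submodule.le_topologicalClosure _ (Submodule.subset_span ⟨H, hH, ρ, φ, hρ, rfl⟩)

lemma band_le {𝓢 : Set (CompactSubgroup G)} {Y : Submodule 𝕜 (Meas 𝕜 G)}
    (hY : IsClosed (Y : Set (Meas 𝕜 G)))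
    (h : ∀ H ∈ 𝓢, ∀ (ρ : Meas 𝕜 G) (φ : C₀(G, 𝕜)), H.1 ≤ mStab ρ → smulMeas φ ρ ∈ Y) :
    band 𝕜 𝓢 ≤ Y := by
  refine Submodule.topologicalClosure_minimal _ (Submodule.span_le.2 ?_) hY
  rintro _ ⟨H, hH, ρ, φ, hρ, rfl⟩
  exact h H hH ρ φ hρ

lemma map_mem_band {𝓢 : Set (CompactSubgroup G)} {T : Meas 𝕜 G →L[𝕜] Meas 𝕜 G}
    {Y : Submodule 𝕜 (Meas 𝕜 G)} (hY : IsClosed (Y : Set (Meas 𝕜 G)))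
    (h : ∀ H ∈ 𝓢, ∀ (ρ : Meas 𝕜 G) (φ : C₀(G, 𝕜)), H.1 ≤ mStab ρ → T (smulMeas φ ρ) ∈ Y)
    {ν : Meas 𝕜 G} (hν : ν ∈ band 𝕜 𝓢) : T ν ∈ Y :=
  band_le (Y := Y.comap T.toLinearMap) (hY.preimage T.continuous) h hν

lemma band_mono {𝓢 𝓣 : Set (CompactSubgroup G)} (h : ∀ H ∈ 𝓢, ∃ H' ∈ 𝓣, H' ≤ H) :
    band 𝕜 𝓢 ≤ band 𝕜 𝓣 :=
  band_le (isClosed_band 𝓣) fun H hH _ φ hρ =>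
    let ⟨_, hH', hle⟩ := h H hH
    smulMeas_mem_band_of_le hH' (le_trans hle hρ) φ

lemma smulMeas_mem_band {𝓢 : Set (CompactSubgroup G)} (ψ : C₀(G, 𝕜)) (ν : Meas 𝕜 G)
    (hν : ν ∈ band 𝕜 𝓢) : smulMeas ψ ν ∈ band 𝕜 𝓢 :=
  map_mem_band (isClosed_band 𝓢) (fun H hH ρ φ hρ => by
    rw [smulMeas_smulMeas]
    exact smulMeas_mem_band_of_le hH hρ _) hν

lemma mem_band_of_le_mStab [LocallyCompactSpace G] [T2Space G] [MeasurableSpace G] [BorelSpace G]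
    {𝓢 : Set (CompactSubgroup G)} {H : CompactSubgroup G} (hH : H ∈ 𝓢)
    {ρ : Meas 𝕜 G} (hρ : H.1 ≤ mStab ρ) : ρ ∈ band 𝕜 𝓢 := by
  obtain ⟨φ, hφ⟩ := exists_tendsto_smulMeas ρ
  exact (isClosed_band 𝓢).mem_of_tendsto hφ
    (Eventually.of_forall fun n => smulMeas_mem_band_of_le hH hρ (φ n))

/-- Translating an H-invariant measure by x makes it invariant under x⁻¹Hx, so it suffices that the
family absorbs conjugation by x up to passing to smaller subgroups. -/
lemma rMeas_mem_band {𝓢 : Set (CompactSubgroup G)} {x : G}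
    (hx : ∀ H ∈ 𝓢, ∃ H' ∈ 𝓢, ∀ y ∈ H'.1, x * y * x⁻¹ ∈ H.1) {ν : Meas 𝕜 G}
    (hν : ν ∈ band 𝕜 𝓢) : rMeas x ν ∈ band 𝕜 𝓢 :=
  map_mem_band (isClosed_band 𝓢) (fun H hH ρ φ hρ => by
    obtain ⟨H', hH', hc⟩ := hx H hH
    rw [rMeas_smulMeas]
    refine smulMeas_mem_band_of_le hH' (fun y hy => ?_) _
    have h := mem_mStab.1 (hρ (hc y hy))
    rw [mem_mStab, rMeas_rMeas]
    conv_rhs => rw [← h, rMeas_rMeas]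
    simp) hν

section Projection

variable [LocallyCompactSpace G] [T2Space G] [MeasurableSpace G] [BorelSpace G]

variable (𝕜) in
/-- The projection onto a band. -/
def bandProj (𝓢 : Set (CompactSubgroup G)) : Meas 𝕜 G →ₗ[𝕜] Meas 𝕜 G :=
  (exists_bandProj (isClosed_band 𝓢) (smulMeas_mem_band (𝕜 := 𝕜))).choose

variable {𝓢 : Set (CompactSubgroup G)}

lemma bandProj_mem (ν : Meas 𝕜 G) : bandProj 𝕜 𝓢 ν ∈ band 𝕜 𝓢 :=
  (exists_bandProj (isClosed_band 𝓢) (smulMeas_mem_band (𝕜 := 𝕜))).choose_spec.1 ν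

lemma sing_sub_bandProj (ν : Meas 𝕜 G) {σ : Meas 𝕜 G} (hσ : σ ∈ band 𝕜 𝓢) :
    Sing σ (ν - bandProj 𝕜 𝓢 ν) :=
  (exists_bandProj (isClosed_band 𝓢) (smulMeas_mem_band (𝕜 := 𝕜))).choose_spec.2 ν σ hσ

lemma eq_bandProj {ν p : Meas 𝕜 G} (hp : p ∈ band 𝕜 𝓢) (h : ∀ σ ∈ band 𝕜 𝓢, Sing σ (ν - p)) :
    bandProj 𝕜 𝓢 ν = p := by
  have hd : bandProj 𝕜 𝓢 ν - p ∈ band 𝕜 𝓢 := Submodule.sub_mem _ (bandProj_mem ν) hp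
  have h1 : Sing (bandProj 𝕜 𝓢 ν - p) (ν - p - (ν - bandProj 𝕜 𝓢 ν)) :=
    (h _ hd).sub_right (sing_sub_bandProj ν hd)
  rw [sub_sub_sub_cancel_left] at h1
  exact sub_eq_zero.1 h1.eq_zero

lemma norm_eq_bandProj_add (ν : Meas 𝕜 G) :
    ‖ν‖ = ‖bandProj 𝕜 𝓢 ν‖ + ‖ν - bandProj 𝕜 𝓢 ν‖ := by
  have := (sing_sub_bandProj ν (bandProj_mem (𝓢 := 𝓢) ν)).1
  rwa [add_sub_cancel] at this

/-- The band projection is a nearest point: by singularity ‖ν - σ‖ = ‖Pν - σ‖ + ‖ν - Pν‖. The same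
identity makes the nearest point unique. -/
lemma norm_sub_bandProj_le (ν : Meas 𝕜 G) {σ : Meas 𝕜 G} (hσ : σ ∈ band 𝕜 𝓢) :
    ‖ν - bandProj 𝕜 𝓢 ν‖ ≤ ‖ν - σ‖ := by
  have hd : bandProj 𝕜 𝓢 ν - σ ∈ band 𝕜 𝓢 := Submodule.sub_mem _ (bandProj_mem ν) hσ
  have := (sing_sub_bandProj ν hd).1
  rw [add_comm (bandProj 𝕜 𝓢 ν - σ), sub_add_sub_cancel] at this
  rw [this]
  exact le_add_of_nonneg_left (norm_nonneg _)

lemma sing_of_bandProj_eq_zero {ν σ : Meas 𝕜 G} (h : bandProj 𝕜 𝓢 ν = 0) (hσ : σ ∈ band 𝕜 𝓢) :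
    Sing σ ν := by
  have := sing_sub_bandProj ν hσ
  rwa [h, sub_zero] at this

lemma bandProj_eq_zero_of_sing {ν : Meas 𝕜 G} (h : Sing (bandProj 𝕜 𝓢 ν) ν) :
    bandProj 𝕜 𝓢 ν = 0 := by
  have h1 := norm_eq_bandProj_add (𝓢 := 𝓢) ν
  have h2 := h.2
  rw [norm_sub_rev] at h2
  have := norm_nonneg (bandProj 𝕜 𝓢 ν)
  exact norm_eq_zero.1 (by linarith)

/-- Translation by x is an isometry, so it preserves singularity; translations by x and x⁻¹ preserve
the band, and uniqueness of the decomposition concludes. -/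
lemma rMeas_bandProj {x : G}
    (hx : ∀ H ∈ 𝓢, ∃ H' ∈ 𝓢, ∀ y ∈ H'.1, x * y * x⁻¹ ∈ H.1)
    (hx' : ∀ H ∈ 𝓢, ∃ H' ∈ 𝓢, ∀ y ∈ H'.1, x⁻¹ * y * x ∈ H.1) (ν : Meas 𝕜 G) :
    rMeas x (bandProj 𝕜 𝓢 ν) = bandProj 𝕜 𝓢 (rMeas x ν) := by
  refine (eq_bandProj (rMeas_mem_band hx (bandProj_mem ν)) fun σ hσ => ?_).symm
  have hσ' : rMeas x⁻¹ σ ∈ band 𝕜 𝓢 := rMeas_mem_band (by simpa using hx') hσ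
  have h := sing_sub_bandProj ν hσ'
  have e : σ = rMeas x (rMeas x⁻¹ σ) := by rw [rMeas_rMeas, inv_mul_cancel, rMeas_one]
  rw [e]
  generalize rMeas x⁻¹ σ = σ' at h
  rw [← map_sub, Sing, ← map_add, ← map_sub, norm_rMeas, norm_rMeas, norm_rMeas, norm_rMeas]
  exact h

end Projection

section ConvHaar

variable [MeasurableSpace G] [BorelSpace G] {𝓢 : Set (CompactSubgroup G)}

lemma convHaar_mem_band {L : CompactSubgroup G} (hL : ∀ H ∈ 𝓢, L ≤ H) {ν : Meas 𝕜 G}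
    (hν : ν ∈ band 𝕜 𝓢) : convHaar L ν ∈ band 𝕜 𝓢 :=
  map_mem_band (isClosed_band 𝓢) (fun H hH ρ φ hρ => by
    rw [convHaar_smulMeas (le_trans (hL H hH) hρ)]
    exact smulMeas_mem_band_of_le hH hρ _) hν

lemma tendsto_convHaar_of_mem_band [T2Space G] {L : ℕ → CompactSubgroup G} (hL : Antitone L)
    (hL𝓢 : ∀ n, ∀ H ∈ 𝓢, L n ≤ H) {M : CompactSubgroup G} (hM : M.1 = ⨅ n, (L n).1)
    {ν : Meas 𝕜 G} (hν : ν ∈ band 𝕜 𝓢) :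
    Tendsto (fun n => convHaar (L n) ν) atTop (𝓝 (convHaar M ν)) := by
  let Y : Submodule 𝕜 (Meas 𝕜 G) :=
    { carrier := {ν | Tendsto (fun n => convHaar (L n) ν) atTop (𝓝 (convHaar M ν))}
      add_mem' := fun {a b} ha hb => by
        simp only [Set.mem_ofPred_eq, map_add] at ha hb ⊢
        exact ha.add hb
      zero_mem' := by simp
      smul_mem' := fun c a ha => by
        simp only [Set.mem_ofPred_eq, map_smul] at ha ⊢
        exact ha.const_smul c }
  have hY : IsClosed (Y : Set (Meas 𝕜 G)) :=
    isClosed_setOf_tendsto (fun n => norm_convHaar_le (L n)) (norm_convHaar_le M)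
  refine band_le (Y := Y) hY (fun H hH ρ φ hρ => ?_) hν
  change Tendsto _ _ _
  have hML : M ≤ L 0 := hM.le.trans (iInf_le _ 0)
  rw [convHaar_smulMeas (le_trans hML (le_trans (hL𝓢 0 H hH) hρ))]
  refine (tendsto_smulMeas (tendsto_avg hL hM φ) ρ).congr fun n => ?_
  rw [convHaar_smulMeas (le_trans (hL𝓢 n H hH) hρ)]

end ConvHaar

end Band

/-! ### Characters of coset spaces as intersections of open sets -/

section Pseudocharacter

variable {G : Type u} [TopologicalSpace G] [Group G]

/-- `H` is the intersection of at most `κ` open sets. -/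
def IsInterOpen (H : Subgroup G) (κ : Cardinal.{u}) : Prop :=
  ∃ 𝓤 : Set (Set G), #𝓤 ≤ κ ∧ (∀ U ∈ 𝓤, IsOpen U ∧ (H : Set G) ⊆ U) ∧ ⋂₀ 𝓤 ⊆ H

lemma IsInterOpen.iInf {ι : Type u} {κ : Cardinal.{u}} (hκ : ℵ₀ ≤ κ) (hι : #ι ≤ κ)
    {H : ι → Subgroup G} (h : ∀ i, IsInterOpen (H i) κ) : IsInterOpen (⨅ i, H i) κ := by
  choose 𝓤 h1 h2 h3 using h
  refine ⟨⋃ i, 𝓤 i, ?_, fun U hU => ?_, fun x hx => ?_⟩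
  · exact (mk_iUnion_le _).trans ((mul_le_mul' hι (ciSup_le' h1)).trans (mul_eq_self hκ).le)
  · obtain ⟨i, hi⟩ := Set.mem_iUnion.1 hU
    exact ⟨(h2 i U hi).1, fun x hx => (h2 i U hi).2 ((iInf_le H i) hx)⟩
  · rw [SetLike.mem_coe, Subgroup.mem_iInf]
    exact fun i => h3 i fun U hU => hx U (Set.mem_iUnion.2 ⟨i, hU⟩)

lemma IsInterOpen.inf {κ : Cardinal.{u}} (hκ : ℵ₀ ≤ κ)
    {H₁ H₂ : Subgroup G} (h₁ : IsInterOpen H₁ κ) (h₂ : IsInterOpen H₂ κ) :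
    IsInterOpen (H₁ ⊓ H₂) κ := by
  have := IsInterOpen.iInf (ι := ULift.{u} Bool) hκ
    ((lt_aleph0_of_finite _).le.trans hκ) (H := fun b => cond b.down H₁ H₂) (by
      rintro ⟨_ | _⟩
      exacts [h₂, h₁])
  rwa [iInf_ulift, iInf_bool_eq] at this

lemma IsInterOpen.mono {κ κ' : Cardinal.{u}} (h : κ ≤ κ') {H : Subgroup G}
    (hH : IsInterOpen H κ) : IsInterOpen H κ' :=
  let ⟨𝓤, h1, h2⟩ := hH
  ⟨𝓤, h1.trans h, h2⟩

variable [IsTopologicalGroup G]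

lemma isInterOpen_fStab {𝕜 : Type*} [RCLike 𝕜] (f : C₀(G, 𝕜)) : IsInterOpen (fStab f) ℵ₀ := by
  refine ⟨Set.range fun n : ℕ => {x | ‖rTranslate x f - f‖ < 1 / ((n : ℝ) + 1)},
    (Set.countable_range _).le_aleph0, ?_, fun x hx => ?_⟩
  · rintro _ ⟨n, rfl⟩
    refine ⟨isOpen_lt ((continuous_rTranslate f).sub continuous_const).norm continuous_const,
      fun x hx => ?_⟩
    rw [Set.mem_ofPred_eq, mem_fStab.1 hx, sub_self, norm_zero]
    positivity
  · rw [SetLike.mem_coe, mem_fStab, ← sub_eq_zero, ← norm_le_zero_iff]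
    exact ge_of_tendsto' tendsto_one_div_add_atTop_nhds_zero_nat fun n => le_of_lt (hx _ ⟨n, rfl⟩)

variable [T2Space G]

/-- The intersection of a family of compact subgroups. -/
def iInter {ι : Type*} [Nonempty ι] (L : ι → CompactSubgroup G) : CompactSubgroup G :=
  ⟨⨅ i, (L i).1, by
    rw [Subgroup.coe_iInf]
    exact (L (Classical.arbitrary ι)).2.of_isClosed_subset
      (isClosed_iInter fun i => (L i).2.isClosed) (Set.iInter_subset _ _)⟩

omit [T2Space G] in
/-- The characters of the coset spaces of compact subgroups give neighbourhood bases. -/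
lemma exists_basis_of_cosetCharacter_le (L : CompactSubgroup G) {κ : Cardinal.{u}}
    (h : cosetCharacter L ≤ κ) : ∃ 𝓤 : Set (Set G), #𝓤 ≤ κ ∧
      (∀ U ∈ 𝓤, IsOpen U ∧ (L.1 : Set G) ⊆ U) ∧
      ∀ V, IsOpen V → (L.1 : Set G) ⊆ V → ∃ U ∈ 𝓤, U ⊆ V := by
  obtain ⟨B, hB, hbasis⟩ : cosetCharacter L ∈ {c | ∃ B : Set (Set (G ⧸ L.1)), #B = c ∧
      (𝓝 ((1 : G) : G ⧸ L.1)).HasBasis (fun V => V ∈ B) id} :=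
    csInf_mem ⟨_, {V | V ∈ 𝓝 ((1 : G) : G ⧸ L.1)}, rfl, Filter.basis_sets _⟩
  refine ⟨(fun V => ((↑) : G → G ⧸ L.1) ⁻¹' interior V) '' B, mk_image_le.trans (hB.trans_le h),
    ?_, fun V hV hLV => ?_⟩
  · rintro _ ⟨V, hV, rfl⟩
    refine ⟨isOpen_interior.preimage QuotientGroup.continuous_mk, fun x hx => ?_⟩
    have : ((x : G) : G ⧸ L.1) = (1 : G) := by
      rw [QuotientGroup.eq]
      simpa using hx
    rw [Set.mem_preimage, this]
    exact mem_interior_iff_mem_nhds.2 (hbasis.mem_of_mem hV)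
  · have hc : IsClosed (((↑) : G → G ⧸ L.1) '' Vᶜ) :=
      QuotientGroup.isClosedMap_coe L.2 _ hV.isClosed_compl
    have h1 : (((↑) : G → G ⧸ L.1) '' Vᶜ)ᶜ ∈ 𝓝 ((1 : G) : G ⧸ L.1) := by
      refine hc.isOpen_compl.mem_nhds ?_
      rintro ⟨x, hx, hx'⟩
      rw [QuotientGroup.eq] at hx'
      exact hx (hLV (by simpa using hx'))
    obtain ⟨W, hW, hWs⟩ := hbasis.mem_iff.1 h1
    refine ⟨_, ⟨W, hW, rfl⟩, fun x hx => ?_⟩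
    by_contra hxV
    exact hWs (interior_subset hx) ⟨x, hxV, rfl⟩

-- If U runs over a neighbourhood base of L, the sets US cut out S: for x outside S the closed coset
-- xS misses L, hence misses some U, and then x is not in US.
omit [T2Space G] in
lemma isInterOpen_of_cosetCharacter_le {L : CompactSubgroup G} {κ : Cardinal.{u}}
    (h : cosetCharacter L ≤ κ) {S : Subgroup G} (hS : IsClosed (S : Set G)) (hLS : L.1 ≤ S) :
    IsInterOpen S κ := by
  obtain ⟨𝓤, h1, h2, h3⟩ := exists_basis_of_cosetCharacter_le L h
  refine ⟨(fun U => U * (S : Set G)) '' 𝓤, mk_image_le.trans h1, ?_, fun x hx => ?_⟩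
  · rintro _ ⟨U, hU, rfl⟩
    exact ⟨(h2 U hU).1.mul_right, fun x hx => ⟨1, (h2 U hU).2 L.1.one_mem, x, hx, one_mul x⟩⟩
  · by_contra hxS
    obtain ⟨U, hU, hUV⟩ := h3 {y | x⁻¹ * y ∈ S}ᶜ
      (hS.preimage (continuous_const_mul x⁻¹)).isOpen_compl fun y hy hxy => hxS (by
        have := S.mul_mem (hLS hy) (S.inv_mem hxy)
        simpa using this)
    obtain ⟨y, hy, s, hs, rfl⟩ := hx _ ⟨U, hU, rfl⟩
    refine hUV hy ?_
    have : (y * s)⁻¹ * y = s⁻¹ := by group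
    rw [Set.mem_ofPred_eq, this]
    exact S.inv_mem hs

variable [LocallyCompactSpace G]

-- Local compactness shrinks the given open sets to ones with compact closure. Compactness then
-- makes their finite intersections a neighbourhood base of L, and an infinite family of size at
-- most κ has at most κ finite subfamilies.
omit [T2Space G] in
lemma cosetCharacter_le_of_isInterOpen {L : CompactSubgroup G} {κ : Cardinal.{u}} (hκ : ℵ₀ ≤ κ)
    (h : IsInterOpen L.1 κ) : cosetCharacter L ≤ κ := by
  obtain ⟨𝓤, h1, h2, h3⟩ := h
  have h4 : ∀ U : 𝓤, ∃ V : Set G, IsOpen V ∧ (L.1 : Set G) ⊆ V ∧ closure V ⊆ U ∧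
      IsCompact (closure V) := fun U =>
    exists_open_between_and_isCompact_closure L.2 (h2 U U.2).1 (h2 U U.2).2
  choose V hVo hLV hVU hVc using h4
  obtain ⟨W, hWo, hLW, -, hWc⟩ :=
    exists_open_between_and_isCompact_closure L.2 isOpen_univ (Set.subset_univ _)
  let O : Finset 𝓤 → Set G := fun F => W ∩ ⋂ i ∈ F, V i
  have hO : ∀ F, IsOpen (O F) := fun F => hWo.inter (isOpen_biInter_finset fun i _ => hVo i)
  have hLO : ∀ F, (L.1 : Set G) ⊆ O F := fun F =>
    Set.subset_inter hLW (Set.subset_iInter₂ fun i _ => hLV i)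
  have hbase : ∀ N : Set G, IsOpen N → (L.1 : Set G) ⊆ N → ∃ F, O F ⊆ N := by
    intro N hN hLN
    obtain ⟨F, hF⟩ := (hWc.inter_right hN.isClosed_compl).elim_finite_subfamily_closed
      (fun i : 𝓤 => closure (V i)) (fun i => isClosed_closure) (by
        rw [Set.eq_empty_iff_forall_notMem]
        rintro x ⟨⟨-, hx⟩, hx'⟩
        refine hx (hLN (h3 fun U hU => ?_))
        exact hVU ⟨U, hU⟩ (Set.mem_iInter.1 hx' ⟨U, hU⟩))
    refine ⟨F, fun x hx => ?_⟩
    by_contra hxN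
    refine (Set.eq_empty_iff_forall_notMem.1 hF x) ⟨⟨subset_closure hx.1, hxN⟩, ?_⟩
    exact Set.mem_iInter₂.2 fun i hi => subset_closure (Set.mem_iInter₂.1 hx.2 i hi)
  have hcard : #(Finset 𝓤) ≤ κ := by
    cases finite_or_infinite 𝓤
    · exact (lt_aleph0_of_finite _).le.trans hκ
    · rw [mk_finset_of_infinite]
      exact h1
  have hmem : ∀ F, ((↑) : G → G ⧸ L.1) '' O F ∈ 𝓝 ((1 : G) : G ⧸ L.1) := fun F =>
    (QuotientGroup.isOpenMap_coe _ (hO F)).mem_nhds ⟨1, hLO F L.1.one_mem, rfl⟩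
  have hbasis : (𝓝 ((1 : G) : G ⧸ L.1)).HasBasis
      (fun V => V ∈ Set.range fun F => ((↑) : G → G ⧸ L.1) '' O F) id := ⟨fun t => ?_⟩
  · exact (csInf_le' (show _ ∈ {c | ∃ B : Set (Set (G ⧸ L.1)), #B = c ∧
      (𝓝 ((1 : G) : G ⧸ L.1)).HasBasis (fun V => V ∈ B) id} from ⟨_, rfl, hbasis⟩)).trans
      (mk_range_le.trans hcard)
  constructor
  · intro ht
    obtain ⟨F, hF⟩ := hbase (((↑) : G → G ⧸ L.1) ⁻¹' interior t)
      (isOpen_interior.preimage QuotientGroup.continuous_mk) fun x hx => by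
        have : ((x : G) : G ⧸ L.1) = (1 : G) := by
          rw [QuotientGroup.eq]
          simpa using hx
        rw [Set.mem_preimage, this]
        exact mem_interior_iff_mem_nhds.2 ht
    refine ⟨_, ⟨F, rfl⟩, ?_⟩
    rintro _ ⟨x, hx, rfl⟩
    exact interior_subset (hF hx)
  · rintro ⟨_, ⟨F, rfl⟩, hF⟩
    exact mem_of_superset (hmem F) hF

lemma cosetCharacter_le_iff {L : CompactSubgroup G} {κ : Cardinal.{u}} (hκ : ℵ₀ ≤ κ) :
    cosetCharacter L ≤ κ ↔ IsInterOpen L.1 κ :=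
  ⟨fun h => isInterOpen_of_cosetCharacter_le h L.2.isClosed le_rfl,
    cosetCharacter_le_of_isInterOpen hκ⟩

/-- The conjugate subgroup `{y | x y x⁻¹ ∈ L}`. -/
def conjSubgroup (x : G) (L : CompactSubgroup G) : CompactSubgroup G :=
  ⟨L.1.comap (MulAut.conj x).toMonoidHom, by
    have e : (L.1.comap (MulAut.conj x).toMonoidHom : Set G)
        = (fun y => x⁻¹ * y * x) '' (L.1 : Set G) := by
      ext y
      constructor
      · intro hy
        exact ⟨x * y * x⁻¹, hy, by group⟩
      · rintro ⟨z, hz, rfl⟩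
        have : x * (x⁻¹ * z * x) * x⁻¹ = z := by group
        simpa [this] using hz
    rw [e]
    exact L.2.image (by fun_prop)⟩

omit [T2Space G] [LocallyCompactSpace G] in
lemma mem_conjSubgroup {x y : G} {L : CompactSubgroup G} :
    y ∈ (conjSubgroup x L).1 ↔ x * y * x⁻¹ ∈ L.1 := Iff.rfl

lemma cosetCharacter_conjSubgroup_le {x : G} {L : CompactSubgroup G} {κ : Cardinal.{u}}
    (hκ : ℵ₀ ≤ κ) (h : cosetCharacter L ≤ κ) : cosetCharacter (conjSubgroup x L) ≤ κ := by
  rw [cosetCharacter_le_iff hκ] at h ⊢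
  obtain ⟨𝓤, h1, h2, h3⟩ := h
  refine ⟨(fun U => (fun y => x * y * x⁻¹) ⁻¹' U) '' 𝓤, mk_image_le.trans h1, ?_, fun y hy => ?_⟩
  · rintro _ ⟨U, hU, rfl⟩
    exact ⟨(h2 U hU).1.preimage (by fun_prop), fun y hy => (h2 U hU).2 hy⟩
  · exact mem_conjSubgroup.2 (h3 fun U hU => hy _ ⟨U, hU, rfl⟩)

variable [MeasurableSpace G] [BorelSpace G]

-- A Urysohn function equal to 1 on K and 0 on UᶜK is averaged over K; the set UᶜK is used so that
-- the average still vanishes off U.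
omit [T2Space G] in
lemma exists_avg_separating (𝕜 : Type*) [RCLike 𝕜] (K : CompactSubgroup G) {U : Set G}
    (hU : IsOpen U) (hKU : (K.1 : Set G) ⊆ U) :
    ∃ f : C₀(G, 𝕜), K.1 ≤ fStab f ∧ f 1 = 1 ∧ ∀ x ∉ U, f x = 0 := by
  obtain ⟨φ, hφ1, hφ0, hφc, hφI⟩ := exists_continuous_one_zero_of_isCompact K.2
    (hU.isClosed_compl.mul_right_of_isCompact K.2) (by
      rw [Set.disjoint_left]
      rintro _ hx ⟨y, hy, z, hz, rfl⟩
      have := K.1.mul_mem hx (K.1.inv_mem hz)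
      rw [mul_inv_cancel_right] at this
      exact hy (hKU this))
  let g : C₀(G, 𝕜) := ofCompactSupport (fun x => ((φ x : ℝ) : 𝕜))
    (RCLike.continuous_ofReal.comp φ.continuous) (hφc.comp_left (by simp))
  refine ⟨avg K g, le_fStab_avg K g, ?_, fun x hx => ?_⟩
  · have : ∀ y : K.1, g (y : G) = 1 := fun y => by
      have : φ y = 1 := hφ1 y.2
      simp [g, this]
    rw [avg_apply]
    simp only [one_mul, this]
    simp
  · have : ∀ y : K.1, g (x * y) = 0 := fun y => by
      have : φ (x * y) = 0 := hφ0 ⟨x, hx, y, y.2, rfl⟩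
      simp [g, this]
    rw [avg_apply]
    simp [this]

-- The right stabilizer of a K-invariant f with f(1) = 1 and f = 0 off U works: on it f takes the
-- value 1, and the norm of C₀(G) exhibits it as a countable intersection of open sets.
omit [T2Space G] in
lemma exists_le_cosetCharacter_le_aleph0 (K : CompactSubgroup G) {U : Set G}
    (hU : IsOpen U) (hKU : (K.1 : Set G) ⊆ U) :
    ∃ H : CompactSubgroup G, K ≤ H ∧ cosetCharacter H ≤ ℵ₀ ∧ (H.1 : Set G) ⊆ U := by
  obtain ⟨f, hf, hf1, hf0⟩ := exists_avg_separating ℝ K hU hKU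
  have hne : f ≠ 0 := fun h => by simp [h] at hf1
  refine ⟨⟨fStab f, isCompact_fStab hne⟩, hf,
    cosetCharacter_le_of_isInterOpen le_rfl (isInterOpen_fStab f), fun x hx => ?_⟩
  by_contra hxU
  have h1 := DFunLike.congr_fun (mem_fStab.1 hx) 1
  rw [rTranslate_apply, one_mul, hf0 x hxU, hf1] at h1
  exact zero_ne_one h1

/-- Translates of countably many separating functions embed G/K in a countable power of C₀(G). The
contrapositive makes χ(G/K) uncountable. -/
lemma metrizableSpace_of_cosetCharacter_le (K : CompactSubgroup G) (h : cosetCharacter K ≤ ℵ₀) :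
    TopologicalSpace.MetrizableSpace (G ⧸ K.1) := by
  obtain ⟨𝓤, h1, h2, h3⟩ := exists_basis_of_cosetCharacter_le K h
  have : Countable 𝓤 := mk_le_aleph0_iff.1 h1
  have h4 := fun U : 𝓤 => exists_avg_separating ℝ K (h2 U U.2).1 (h2 U U.2).2
  choose f hf hf1 hf0 using h4
  let Φ : G ⧸ K.1 → 𝓤 → C₀(G, ℝ) := Quotient.lift (fun x U => rTranslate x (f U)) (by
    intro x y hxy
    ext1 U
    have hk : x⁻¹ * y ∈ K.1 := QuotientGroup.leftRel_apply.1 hxy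
    have := mem_fStab.1 (hf U hk)
    change rTranslate x (f U) = rTranslate y (f U)
    conv_lhs => rw [← this, rTranslate_rTranslate]
    simp)
  have hΦ : ∀ x : G, Φ (x : G ⧸ K.1) = fun U => rTranslate x (f U) := fun x => rfl
  have hc : Continuous Φ :=
    Continuous.quotient_lift (continuous_pi fun U => continuous_rTranslate (f U)) _
  have hind : Topology.IsInducing Φ := by
    refine Topology.isInducing_iff_nhds.2 fun q => le_antisymm (hc.tendsto q).le_comap ?_
    induction q using QuotientGroup.induction_on with | _ x
    intro N hN
    obtain ⟨N', hN'N, hN', hxN'⟩ := mem_nhds_iff.1 hN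
    obtain ⟨U, hU, hUV⟩ := h3 {z | ((x * z : G) : G ⧸ K.1) ∈ N'}
      (hN'.preimage (QuotientGroup.continuous_mk.comp (continuous_const_mul x))) fun z hz => by
        have : ((x * z : G) : G ⧸ K.1) = x := by
          rw [QuotientGroup.eq]
          simpa using hz
        rw [Set.mem_ofPred_eq, this]
        exact hxN'
    refine ⟨{F | ‖F ⟨U, hU⟩ - rTranslate x (f ⟨U, hU⟩)‖ < 1}, ?_, ?_⟩
    · refine (isOpen_lt (by fun_prop) continuous_const).mem_nhds ?_
      simp [hΦ]
    · intro q hq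
      induction q using QuotientGroup.induction_on with | _ y
      rw [Set.mem_preimage, hΦ, Set.mem_ofPred_eq] at hq
      -- Evaluation at x⁻¹ compares f(x⁻¹y) with f(1) = 1; a difference below 1 makes f(x⁻¹y)
      -- nonzero and puts x⁻¹y in U.
      have h5 := (norm_apply_le (rTranslate y (f ⟨U, hU⟩) - rTranslate x (f ⟨U, hU⟩)) x⁻¹).trans_lt
        hq
      rw [ZeroAtInftyContinuousMap.sub_apply, rTranslate_apply, rTranslate_apply, inv_mul_cancel,
        hf1] at h5
      have h6 : x⁻¹ * y ∈ U := by
        by_contra h7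
        rw [hf0 ⟨U, hU⟩ _ h7] at h5
        simp at h5
      have h7 := hUV h6
      rw [Set.mem_ofPred_eq, mul_inv_cancel_left] at h7
      exact hN'N h7
  have : IsClosed (K.1 : Set G) := K.2.isClosed
  have hT : T1Space (G ⧸ K.1) := inferInstance
  exact (hind.isEmbedding).metrizableSpace

end Pseudocharacter

/-! ### Recursion and regularity of successor cardinals -/

section Order

/-- A function that is Cauchy along decreasing sequences in a countably codirected order is
eventually constant. -/
lemma exists_forall_le_eq {D E : Type*} [Preorder D] [MetricSpace E]
    (hD : ∀ s : ℕ → D, ∃ b, ∀ n, b ≤ s n) (F : D → E)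
    (hF : ∀ s : ℕ → D, Antitone s → CauchySeq (F ∘ s)) (a : D) :
    ∃ b ≤ a, ∀ c ≤ b, F c = F b := by
  -- Otherwise jumps of size at least ε could be repeated forever along a decreasing sequence. A
  -- common lower bound for ε = 1/(n+1) then works exactly.
  have h : ∀ ε : ℝ, 0 < ε → ∃ b ≤ a, ∀ c ≤ b, dist (F c) (F b) < ε := by
    intro ε hε
    by_contra! h
    choose! c hca hcb using h
    let s : ℕ → D := fun n => Nat.rec a (fun _ b => c b) n
    have hs : ∀ n, s n ≤ a := fun n => by
      induction n with
      | zero => exact le_rfl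
      | succ n ih => exact (hca _ ih).trans ih
    have hs' : Antitone s := antitone_nat_of_succ_le fun n => hca _ (hs n)
    obtain ⟨n, hn⟩ := Metric.cauchySeq_iff'.1 (hF s hs') ε hε
    exact (hcb _ (hs n)).not_gt (hn (n + 1) n.le_succ)
  choose b hba hb using fun n : ℕ => h (1 / ((n : ℝ) + 1)) (by positivity)
  obtain ⟨d, hd⟩ := hD b
  refine ⟨d, (hd 0).trans (hba 0), fun c hc => ?_⟩
  have h0 := (tendsto_one_div_add_atTop_nhds_zero_nat (𝕜 := ℝ)).add
    (tendsto_one_div_add_atTop_nhds_zero_nat (𝕜 := ℝ))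
  rw [add_zero] at h0
  refine dist_le_zero.1 (ge_of_tendsto' h0 fun n => ?_)
  exact (dist_triangle_right _ _ (F (b n))).trans
    (add_le_add (hb n c (hc.trans (hd n))).le (hb n d (hd n)).le)

lemma exists_chain {I D : Type*} [LinearOrder I] [WellFoundedLT I] [Preorder D]
    (hD : ∀ (ξ : I) (a : D) (s : Set.Iio ξ → D), ∃ b ≤ a, ∀ η, b ≤ s η) (g : D → D) (F : I → D) :
    ∃ N : I → D, ∀ ξ, N ξ ≤ F ξ ∧ ∀ η < ξ, N ξ ≤ g (N η) := by
  choose b hba hb using hD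
  let N : I → D := (wellFounded_lt (α := I)).fix fun ξ N => b ξ (F ξ) fun η => g (N η.1 η.2)
  have hN : ∀ ξ, N ξ = b ξ (F ξ) fun η : Set.Iio ξ => g (N η) := fun ξ =>
    WellFounded.fix_eq _ _ ξ
  refine ⟨N, fun ξ => ⟨?_, fun η hη => ?_⟩⟩
  · rw [hN]
    exact hba _ _ _
  · rw [hN]
    exact hb ξ _ _ ⟨η, hη⟩

/-- Regularity of κ⁺: an unbounded family of at most κ elements would cover κ⁺ by at most κ
segments, each of size at most κ. -/
lemma exists_forall_lt_of_mk_le {κ : Cardinal.{u}} (hκ : ℵ₀ ≤ κ) {ι : Type u} (hι : #ι ≤ κ)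
    (f : ι → (Order.succ κ).ord.ToType) : ∃ ξ, ∀ i, f i < ξ := by
  by_contra! h
  have h1 : (Set.univ : Set (Order.succ κ).ord.ToType) ⊆ ⋃ i, Set.Iic (f i) := fun ξ _ =>
    Set.mem_iUnion.2 (h ξ)
  have h2 : ∀ ξ : (Order.succ κ).ord.ToType, #(Set.Iic ξ) ≤ κ := fun ξ => by
    rw [← Set.Iio_insert]
    refine (mk_insert_le).trans ?_
    exact add_le_of_le hκ (Order.lt_succ_iff.1 (by simpa using mk_Iio_lt ξ (by simp))) (one_lt_aleph0.le.trans hκ)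
  have h3 := mk_le_mk_of_subset h1
  rw [mk_univ, mk_ord_toType] at h3
  exact (Order.lt_succ κ).not_ge (h3.trans ((mk_iUnion_le _).trans
    ((mul_le_mul' hι (ciSup_le' fun i => h2 (f i))).trans (mul_eq_self hκ).le)))

end Order

/-! ### Subgroups of bounded character -/

section Small

variable {G : Type u} [TopologicalSpace G] [Group G]

/-- The compact subgroups `L ⊇ K` with `χ(G/L) ≤ κ`. -/
def small (K : CompactSubgroup G) (κ : Cardinal.{u}) : Set (CompactSubgroup G) :=
  {L | K ≤ L ∧ cosetCharacter L ≤ κ}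

/-- The intersection of a compact subgroup and a closed subgroup. -/
def infClosed (L : CompactSubgroup G) (S : Subgroup G) (hS : IsClosed (S : Set G)) :
    CompactSubgroup G :=
  ⟨L.1 ⊓ S, L.2.inter_right hS⟩

variable [IsTopologicalGroup G] [T2Space G] [LocallyCompactSpace G]

lemma cosetCharacter_infClosed_le {L : CompactSubgroup G} {S : Subgroup G}
    {hS : IsClosed (S : Set G)} {κ : Cardinal.{u}} (hκ : ℵ₀ ≤ κ) (hL : cosetCharacter L ≤ κ)
    (h : IsInterOpen S κ) : cosetCharacter (infClosed L S hS) ≤ κ :=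
  cosetCharacter_le_of_isInterOpen hκ (((cosetCharacter_le_iff hκ).1 hL).inf hκ h)

lemma infClosed_mem_small {K L : CompactSubgroup G} {S : Subgroup G}
    {hS : IsClosed (S : Set G)} {κ : Cardinal.{u}} (hκ : ℵ₀ ≤ κ) (hL : L ∈ small K κ)
    (hKS : K.1 ≤ S) (h : IsInterOpen S κ) : infClosed L S hS ∈ small K κ :=
  ⟨le_inf (α := Subgroup G) hL.1 hKS, cosetCharacter_infClosed_le hκ hL.2 h⟩

lemma iInter_mem_small {K : CompactSubgroup G} {κ : Cardinal.{u}} (hκ : ℵ₀ ≤ κ) {ι : Type u}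
    [Nonempty ι] (hι : #ι ≤ κ) {N : ι → CompactSubgroup G} (h : ∀ i, N i ∈ small K κ) :
    iInter N ∈ small K κ :=
  ⟨le_iInf (α := Subgroup G) fun i => (h i).1, cosetCharacter_le_of_isInterOpen hκ
    (IsInterOpen.iInf hκ hι fun i => (cosetCharacter_le_iff hκ).1 (h i).2)⟩

omit [IsTopologicalGroup G] [LocallyCompactSpace G] in
lemma iInter_le {ι : Type*} [Nonempty ι] (N : ι → CompactSubgroup G) (i : ι) : iInter N ≤ N i :=
  iInf_le (fun i => (N i).1) i

lemma exists_le_small {K : CompactSubgroup G} {κ : Cardinal.{u}} (hκ : ℵ₀ ≤ κ) {ι : Type u}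
    (hι : #ι ≤ κ) (a : small K κ) (s : ι → small K κ) : ∃ b ≤ a, ∀ i, b ≤ s i := by
  let N : Option ι → CompactSubgroup G := fun o => (o.elim a s).1
  have hN : iInter N ∈ small K κ := iInter_mem_small hκ
    (mk_option.trans_le (add_le_of_le hκ hι (one_lt_aleph0.le.trans hκ))) fun o => (o.elim a s).2
  exact ⟨⟨iInter N, hN⟩, iInter_le N none, fun i => iInter_le N (some i)⟩

-- Compactness puts some member of the chain inside each of the at most κ open sets defining S, and
-- regularity of κ⁺ gives one index beyond all of these.
omit [IsTopologicalGroup G] [LocallyCompactSpace G] in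
lemma exists_le_of_iInf_le {κ : Cardinal.{u}} (hκ : ℵ₀ ≤ κ)
    {N : (Order.succ κ).ord.ToType → CompactSubgroup G} (hN : Antitone N) {S : Subgroup G}
    (hS : IsInterOpen S κ) (h : ⨅ ξ, (N ξ).1 ≤ S) : ∃ ξ, (N ξ).1 ≤ S := by
  obtain ⟨𝓤, h1, h2, h3⟩ := hS
  obtain ⟨ξ₀, -⟩ := exists_forall_lt_of_mk_le hκ (ι := PEmpty) (by simp) PEmpty.elim
  have : Nonempty (Order.succ κ).ord.ToType := ⟨ξ₀⟩
  have h4 : ∀ U : 𝓤, ∃ ξ, ((N ξ).1 : Set G) ⊆ U := fun U => by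
    refine exists_subset_nhds_of_isCompact (V := fun ξ => ((N ξ).1 : Set G))
      (directed_of_isDirected_le fun _ _ h => hN h) (fun ξ => (N ξ).2) fun x hx => ?_
    refine (h2 U U.2).1.mem_nhds ((h2 U U.2).2 (h ?_))
    rw [Subgroup.mem_iInf]
    exact fun ξ => Set.mem_iInter.1 hx ξ
  choose f hf using h4
  obtain ⟨ξ, hξ⟩ := exists_forall_lt_of_mk_le hκ h1 f
  exact ⟨ξ, fun x hx => h3 fun U hU => hf ⟨U, hU⟩ (hN (hξ ⟨U, hU⟩).le hx)⟩

variable {𝕜 : Type*} [RCLike 𝕜]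

/-- The condition holds for φ·ρ and survives sums, multiples and sequential limits, since countable
intersections stay within κ. Compactness is not demanded: for 0 the subgroup is G, as an empty
intersection. -/
lemma exists_isInterOpen_le_mStab_of_mem_band [MeasurableSpace G] [BorelSpace G]
    {κ : Cardinal.{u}} (hκ : ℵ₀ ≤ κ)
    {ν : Meas 𝕜 G} (hν : ν ∈ band 𝕜 {H : CompactSubgroup G | cosetCharacter H ≤ κ}) :
    ∃ H : Subgroup G, IsClosed (H : Set G) ∧ IsInterOpen H κ ∧ H ≤ mStab ν := by
  let Y : Submodule 𝕜 (Meas 𝕜 G) :=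
    { carrier := {ν | ∃ H : Subgroup G, IsClosed (H : Set G) ∧ IsInterOpen H κ ∧ H ≤ mStab ν}
      add_mem' := by
        rintro a b ⟨H, hc, ho, hle⟩ ⟨H', hc', ho', hle'⟩
        exact ⟨H ⊓ H', hc.inter hc', ho.inf hκ ho',
          (inf_le_inf hle hle').trans (mStab_inf_le_add a b)⟩
      zero_mem' := ⟨⊤, isClosed_univ, ⟨∅, by simp, by simp, by simp⟩, mStab_zero.ge⟩
      smul_mem' := fun c a ⟨H, hc, ho, hle⟩ => ⟨H, hc, ho, hle.trans (mStab_le_smul c a)⟩ }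
  have hY : IsClosed (Y : Set (Meas 𝕜 G)) := by
    refine IsSeqClosed.isClosed fun νs ν hνs hlim => ?_
    choose H hc ho hle using hνs
    refine ⟨⨅ n : ULift.{u} ℕ, H n.down, ?_, IsInterOpen.iInf hκ (by simpa using hκ)
      fun n => ho n.down, ?_⟩
    · rw [Subgroup.coe_iInf]
      exact isClosed_iInter fun n => hc n.down
    · rw [iInf_ulift]
      exact (iInf_mono hle).trans (iInf_mStab_le_of_tendsto hlim)
  refine band_le (Y := Y) hY (fun H hH ρ φ hρ => ?_) hν
  exact ⟨H.1 ⊓ fStab φ, H.2.isClosed.inter (isClosed_fStab φ),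
    ((cosetCharacter_le_iff hκ).1 hH).inf hκ ((isInterOpen_fStab φ).mono hκ),
    (inf_le_inf_right _ hρ).trans (mStab_inf_fStab_le ρ φ)⟩

end Small

/-! ### Averages singular to invariant measures -/

section Averages

variable {𝕜 : Type*} [RCLike 𝕜] {G : Type u} [TopologicalSpace G] [Group G]
  [IsTopologicalGroup G] [T2Space G] [LocallyCompactSpace G] [MeasurableSpace G] [BorelSpace G]
  {𝓢 : Set (CompactSubgroup G)}

lemma norm_convHaar_sub_le {L L' : CompactSubgroup G} (h : L ≤ L') (μ : Meas 𝕜 G) :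
    ‖convHaar L' μ - convHaar L' (bandProj 𝕜 𝓢 (convHaar L μ))‖ ≤
      ‖convHaar L μ - bandProj 𝕜 𝓢 (convHaar L μ)‖ := by
  rw [← convHaar_convHaar_of_le h, ← map_sub]
  exact norm_convHaar_le _ _

/-- Further averaging is a contraction that maps the band to itself, so it cannot increase the
distance to the band. -/
lemma norm_sub_bandProj_convHaar_le {L L' : CompactSubgroup G} (h : L ≤ L')
    (hL' : ∀ H ∈ 𝓢, L' ≤ H) (μ : Meas 𝕜 G) :
    ‖convHaar L' μ - bandProj 𝕜 𝓢 (convHaar L' μ)‖ ≤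
      ‖convHaar L μ - bandProj 𝕜 𝓢 (convHaar L μ)‖ :=
  (norm_sub_bandProj_le _ (convHaar_mem_band hL' (bandProj_mem _))).trans (norm_convHaar_sub_le h μ)

lemma bandProj_eq_of_norm_sub_le {ν σ : Meas 𝕜 G} (hσ : σ ∈ band 𝕜 𝓢)
    (h : ‖ν - σ‖ ≤ ‖ν - bandProj 𝕜 𝓢 ν‖) : bandProj 𝕜 𝓢 ν = σ := by
  have hd : bandProj 𝕜 𝓢 ν - σ ∈ band 𝕜 𝓢 := Submodule.sub_mem _ (bandProj_mem ν) hσ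
  have h1 := (sing_sub_bandProj ν hd).1
  rw [add_comm (bandProj 𝕜 𝓢 ν - σ), sub_add_sub_cancel] at h1
  have := norm_nonneg (bandProj 𝕜 𝓢 ν - σ)
  exact sub_eq_zero.1 (norm_eq_zero.1 (by linarith))

/-- Two stabilizations along the countably codirected set of small subgroups: first the distance to
the band, then the projection itself. -/
lemma exists_bandProj_convHaar_eq {K H : CompactSubgroup G} {κ : Cardinal.{u}} (hκ : ℵ₀ ≤ κ)
    (hH : H ∈ small K κ) (μ : Meas 𝕜 G) : ∃ L ∈ small K κ, L ≤ H ∧ ∀ L' ∈ small K κ, L' ≤ L →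
      ‖convHaar L' μ - bandProj 𝕜 {H} (convHaar L' μ)‖ =
        ‖convHaar L μ - bandProj 𝕜 {H} (convHaar L μ)‖ ∧
      bandProj 𝕜 {H} (convHaar L' μ) = bandProj 𝕜 {H} (convHaar L μ) := by
  have hseq : ∀ (a : small K κ) (s : ℕ → small K κ), ∃ b ≤ a, ∀ n, b ≤ s n := fun a s => by
    obtain ⟨b, hb, h⟩ := exists_le_small hκ (ι := ULift.{u} ℕ) (by simpa using hκ) a
      fun n => s n.down
    exact ⟨b, hb, fun n => h ⟨n⟩⟩
  let P := bandProj 𝕜 ({H} : Set (CompactSubgroup G))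
  have hle : ∀ {L : CompactSubgroup G}, L ≤ H → ∀ H' ∈ ({H} : Set (CompactSubgroup G)), L ≤ H' :=
    fun h H' hH' => hH'.symm ▸ h
  obtain ⟨⟨L₁, hL₁⟩, hL₁H, h₁⟩ := exists_forall_le_eq
    (D := {L : small K κ // L ≤ ⟨H, hH⟩}) (E := ℝ)
    (fun s => by
      obtain ⟨b, hb, h⟩ := hseq ⟨H, hH⟩ fun n => (s n).1
      exact ⟨⟨b, hb⟩, h⟩)
    (fun L => ‖convHaar L.1.1 μ - P (convHaar L.1.1 μ)‖)
    (fun s hs => by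
      refine (tendsto_atTop_ciSup (fun m n hmn => ?_) ⟨‖μ‖, ?_⟩).cauchySeq
      · exact norm_sub_bandProj_convHaar_le (hs hmn) (hle (s m).2) μ
      · rintro _ ⟨n, rfl⟩
        have h1 := norm_eq_bandProj_add (𝓢 := {H}) (convHaar (s n).1.1 μ)
        have h2 := norm_convHaar_le (s n).1.1 μ
        have h3 := norm_nonneg (bandProj 𝕜 {H} (convHaar (s n).1.1 μ))
        change ‖convHaar (s n).1.1 μ - bandProj 𝕜 {H} (convHaar (s n).1.1 μ)‖ ≤ ‖μ‖
        linarith)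
    ⟨⟨H, hH⟩, le_rfl⟩
  -- With constant distance, averaging the projection for L gives a point of the band at minimal
  -- distance for L'; uniqueness of nearest points identifies it with the projection.
  have hP : ∀ L L' : small K κ, L ≤ L' → L' ≤ L₁ →
      P (convHaar L'.1 μ) = convHaar L'.1 (P (convHaar L.1 μ)) := fun L L' h h' => by
    refine bandProj_eq_of_norm_sub_le
      (convHaar_mem_band (hle (h'.trans hL₁)) (bandProj_mem _)) ?_
    refine (norm_convHaar_sub_le h μ).trans_eq ?_
    exact (h₁ ⟨L, h.trans (h'.trans hL₁)⟩ (h.trans h')).trans (h₁ ⟨L', h'.trans hL₁⟩ h').symm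
  obtain ⟨⟨L₂, hL₂⟩, -, h₂⟩ := exists_forall_le_eq
    (D := {L : small K κ // L ≤ L₁}) (E := Meas 𝕜 G)
    (fun s => by
      obtain ⟨b, hb, h⟩ := hseq L₁ fun n => (s n).1
      exact ⟨⟨b, hb⟩, h⟩)
    (fun L => P (convHaar L.1.1 μ))
    (fun s hs => by
      -- Along the sequence all projections are averages of one band element, the projection for the
      -- intersection M, so they converge in norm.
      let M := iInter fun n => (s n).1.1
      have hM : M ∈ small K κ :=
        ⟨le_iInf (α := Subgroup G) fun n => (s n).1.2.1, cosetCharacter_le_of_isInterOpen hκ (by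
          have := IsInterOpen.iInf (ι := ULift.{u} ℕ) hκ (by simpa using hκ)
            (H := fun n => (s n.down).1.1.1) fun n =>
              (cosetCharacter_le_iff hκ).1 (s n.down).1.2.2
          rwa [iInf_ulift] at this)⟩
      have h3 := tendsto_convHaar_of_mem_band (L := fun n => (s n).1.1) (fun m n h => hs h)
        (fun n => hle ((s n).2.trans hL₁)) (M := M) rfl (bandProj_mem (𝓢 := {H}) (convHaar M μ))
      refine (h3.congr fun n => ?_).cauchySeq
      exact (hP ⟨M, hM⟩ (s n).1 (iInter_le (fun n => (s n).1.1) n) (s n).2).symm)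
    ⟨L₁, le_rfl⟩
  refine ⟨L₂, L₂.2, hL₂.trans hL₁, fun L' hL' hle' => ⟨?_, h₂ ⟨⟨L', hL'⟩, hle'.trans hL₂⟩ hle'⟩⟩
  exact (h₁ ⟨⟨L', hL'⟩, (hle'.trans hL₂).trans hL₁⟩ (hle'.trans hL₂)).trans
    (h₁ ⟨L₂, hL₂.trans hL₁⟩ hL₂).symm

-- This is eventual constancy of the averages on each test function: by K-invariance f may be
-- replaced by its K-average, which L fixes.
omit [T2Space G] [LocallyCompactSpace G] in
lemma convHaar_apply_of_le_fStab {K L : CompactSubgroup G} {μ : Meas 𝕜 G} (hμ : K.1 ≤ mStab μ)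
    (hKL : K ≤ L) {f : C₀(G, 𝕜)} (hL : L.1 ≤ fStab (avg K f)) : convHaar L μ f = μ f := by
  rw [← apply_avg K hμ f, ← apply_avg K (le_trans hKL (le_mStab_convHaar L μ)) f, convHaar_apply,
    avg_eq_self hL]

/-- The stabilized projection p satisfies ‖μ‖ + ‖p‖ = ‖μ - p‖ ≤ ‖μ ⋆ λ_L - p‖. For smaller L' the
distance to the band is at least this large, but it equals ‖μ ⋆ λ_L'‖ minus the norm of the
projection, so that projection vanishes. -/
lemma exists_forall_sing_convHaar {K H : CompactSubgroup G} {κ : Cardinal.{u}} (hκ : ℵ₀ ≤ κ)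
    (hH : H ∈ small K κ) {μ : Meas 𝕜 G} (hμ : K.1 ≤ mStab μ)
    (hsing : ∀ σ ∈ band 𝕜 (small K κ), Sing σ μ) :
    ∃ L ∈ small K κ, L ≤ H ∧ ∀ L', K ≤ L' → L' ≤ L → ∀ σ ∈ band 𝕜 {H}, Sing σ (convHaar L' μ) := by
  obtain ⟨L, hL, hLH, h⟩ := exists_bandProj_convHaar_eq hκ hH μ
  refine ⟨L, hL, hLH, fun L' hKL' hL' σ hσ => sing_of_bandProj_eq_zero ?_ hσ⟩
  have h1 : ‖μ - bandProj 𝕜 {H} (convHaar L μ)‖ ≤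
      ‖convHaar L μ - bandProj 𝕜 {H} (convHaar L μ)‖ := by
    -- Each f is tested with a subgroup below L that fixes its K-average: there μ and its average
    -- agree on f, while p and the distance are unchanged.
    refine ContinuousLinearMap.opNorm_le_bound _ (norm_nonneg _) fun f => ?_
    have hf : infClosed L (fStab (avg K f)) (isClosed_fStab _) ∈ small K κ :=
      infClosed_mem_small hκ hL (le_fStab_avg K f) ((isInterOpen_fStab _).mono hκ)
    have hfL : infClosed L (fStab (avg K f)) (isClosed_fStab _) ≤ L := inf_le_left (α := Subgroup G)
    obtain ⟨h2, h3⟩ := h _ hf hfL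
    rw [← h2, ← h3, sub_apply, ← convHaar_apply_of_le_fStab hμ hf.1 (inf_le_right (α := Subgroup G)),
      ← sub_apply]
    exact ContinuousLinearMap.le_opNorm _ f
  have h2 := (hsing _ (band_mono (𝓢 := {H}) (fun H' hH' => ⟨H, hH, hH'.ge⟩)
    (bandProj_mem (convHaar L μ)))).2
  rw [norm_sub_rev] at h2
  have h3 := norm_eq_bandProj_add (𝓢 := {H}) (convHaar L μ)
  have h4 := norm_convHaar_le L μ
  have h5 := norm_nonneg (bandProj 𝕜 {H} (convHaar L μ))
  have h6 := norm_sub_bandProj_convHaar_le (𝓢 := {H}) hL' (fun H' hH' => hH'.symm ▸ hLH) μ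
  have h7 := norm_eq_bandProj_add (𝓢 := {H}) (convHaar L' μ)
  have h8 := norm_convHaar_le L' μ
  have h9 := norm_nonneg (bandProj 𝕜 {H} (convHaar L' μ))
  exact norm_eq_zero.1 (by linarith)

omit [MeasurableSpace G] [BorelSpace G] in
lemma exists_small_chain (K : CompactSubgroup G) {κ : Cardinal.{u}} (hκ : ℵ₀ ≤ κ)
    (g : small K κ → small K κ) (F : (Order.succ κ).ord.ToType → small K κ) :
    ∃ N : (Order.succ κ).ord.ToType → small K κ, ∀ ξ, N ξ ≤ F ξ ∧ ∀ η < ξ, N ξ ≤ g (N η) :=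
  exists_chain (fun ξ a s => exists_le_small hκ
    (Order.lt_succ_iff.1 (by simpa using mk_Iio_lt ξ (by simp))) a s) g F

/-- L is the intersection of a chain of length κ⁺ in which each step makes later averages singular
to measures invariant under the previous subgroup. Any projection onto the larger band would already
be invariant under a member of the chain. -/
lemma exists_convHaar_sing_band {K L₀ : CompactSubgroup G} {κ : Cardinal.{u}} (hκ : ℵ₀ ≤ κ)
    (hL₀ : L₀ ∈ small K κ) {μ : Meas 𝕜 G} (hμ : K.1 ≤ mStab μ)
    (hsing : ∀ σ ∈ band 𝕜 (small K κ), Sing σ μ) :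
    ∃ L ∈ small K (Order.succ κ), L ≤ L₀ ∧
      ∀ σ ∈ band 𝕜 {H : CompactSubgroup G | cosetCharacter H ≤ κ}, Sing σ (convHaar L μ) := by
  choose g hg hgle hgsing using fun H : small K κ => exists_forall_sing_convHaar hκ H.2 hμ hsing
  obtain ⟨N, hN⟩ := exists_small_chain K hκ (fun H => ⟨g H, hg H⟩) fun _ => ⟨L₀, hL₀⟩
  obtain ⟨ξ₀, -⟩ := exists_forall_lt_of_mk_le hκ (ι := PEmpty) (by simp) PEmpty.elim
  have : Nonempty (Order.succ κ).ord.ToType := ⟨ξ₀⟩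
  let L := iInter fun ξ => (N ξ).1
  have hL : L ∈ small K (Order.succ κ) := iInter_mem_small (hκ.trans (Order.le_succ κ)) (by simp)
    fun ξ => ⟨(N ξ).2.1, (N ξ).2.2.trans (Order.le_succ κ)⟩
  refine ⟨L, hL, (iInter_le _ ξ₀).trans (hN ξ₀).1, fun σ hσ => sing_of_bandProj_eq_zero ?_ hσ⟩
  set ν := bandProj 𝕜 {H : CompactSubgroup G | cosetCharacter H ≤ κ} (convHaar L μ) with hν
  by_contra hne
  -- The family of all subgroups of character at most κ is stable under conjugation, so the
  -- projection commutes with right translations.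
  have hLν : L.1 ≤ mStab ν := fun x hx => by
    have hc : ∀ x : G, ∀ H ∈ {H : CompactSubgroup G | cosetCharacter H ≤ κ},
        ∃ H' ∈ {H : CompactSubgroup G | cosetCharacter H ≤ κ}, ∀ y ∈ H'.1, x * y * x⁻¹ ∈ H.1 :=
      fun x H hH => ⟨conjSubgroup x H, cosetCharacter_conjSubgroup_le hκ hH, fun y hy => hy⟩
    rw [mem_mStab, hν, rMeas_bandProj (hc x) (by simpa using hc x⁻¹),
      mem_mStab.1 (le_mStab_convHaar L μ hx)]
  obtain ⟨H, hHc, hHo, hHν⟩ := exists_isInterOpen_le_mStab_of_mem_band hκ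
    (bandProj_mem (𝓢 := {H : CompactSubgroup G | cosetCharacter H ≤ κ}) (convHaar L μ))
  have hHcpt : IsCompact (H : Set G) := (isCompact_mStab hne).of_isClosed_subset hHc hHν
  have hS : IsInterOpen (mStab ν) κ := isInterOpen_of_cosetCharacter_le
    (cosetCharacter_le_of_isInterOpen hκ (L := ⟨H, hHcpt⟩) hHo) (isClosed_mStab ν) hHν
  have hanti : Antitone fun ξ => (N ξ).1 := fun η ξ h => by
    rcases h.eq_or_lt with rfl | h
    · exact le_rfl
    · exact ((hN ξ).2 η h).trans (hgle (N η))
  obtain ⟨ξ, hξ⟩ := exists_le_of_iInf_le hκ hanti hS hLν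
  obtain ⟨ξ', hξ'⟩ := exists_forall_lt_of_mk_le hκ (ι := PUnit) (by simpa using one_lt_aleph0.le.trans hκ)
    fun _ => ξ
  -- Invariance of ν under N ξ puts ν in the band of N ξ, to which the average over L is singular;
  -- thus ν is singular to the measure it is projected from.
  have h1 := hgsing (N ξ) L hL.1 ((iInter_le _ ξ').trans ((hN ξ').2 ξ (hξ' ⟨⟩))) ν
    (mem_band_of_le_mStab (Set.mem_singleton _) hξ)
  exact hne (bandProj_eq_zero_of_sing h1)

end Averages

/-! ### Convergence of the band part and oscillation of the singular part -/

section Above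

variable {𝕜 : Type*} [RCLike 𝕜] {G : Type u} [TopologicalSpace G] [Group G]
  [IsTopologicalGroup G] [T2Space G] [LocallyCompactSpace G]
  {K : CompactSubgroup G}

lemma infClosed_mem_subgroupsAbove (hK : ℵ₀ < cosetCharacter K) {L : CompactSubgroup G}
    (hL : L ∈ subgroupsAbove K) {S : Subgroup G} {κ : Cardinal.{u}} (hκ : κ < cosetCharacter K)
    (hS : IsInterOpen S κ) (hKS : K.1 ≤ S) (hSc : IsClosed (S : Set G)) :
    infClosed L S hSc ∈ subgroupsAbove K :=
  ⟨le_inf (α := Subgroup G) hL.1 hKS, (cosetCharacter_infClosed_le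
    (κ := max (cosetCharacter L) (max ℵ₀ κ)) ((le_max_left _ _).trans (le_max_right _ _))
    (le_max_left _ _) (hS.mono ((le_max_right _ _).trans (le_max_right _ _)))).trans_lt
    (max_lt hL.2 (max_lt hK hκ))⟩

lemma exists_le_subgroupsAbove (hK : ℵ₀ < cosetCharacter K) {L L' : CompactSubgroup G}
    (hL : L ∈ subgroupsAbove K) (hL' : L' ∈ subgroupsAbove K) :
    ∃ M ∈ subgroupsAbove K, M ≤ L ∧ M ≤ L' :=
  ⟨_, infClosed_mem_subgroupsAbove hK hL hL'.2
    (isInterOpen_of_cosetCharacter_le le_rfl L'.2.isClosed le_rfl) hL'.1 L'.2.isClosed,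
    inf_le_left (α := Subgroup G), inf_le_right (α := Subgroup G)⟩

variable [MeasurableSpace G] [BorelSpace G]

omit [T2Space G] in
lemma nonempty_subgroupsAbove (hK : ℵ₀ < cosetCharacter K) : (subgroupsAbove K).Nonempty :=
  let ⟨H, hKH, hH, _⟩ := exists_le_cosetCharacter_le_aleph0 K isOpen_univ (Set.subset_univ _)
  ⟨H, hKH, hH.trans_lt hK⟩

/-- Convolving φ·ρ with λ_K replaces φ by its K-average, whose stabilizer still has small character.
Hence ν = ν ⋆ λ_K is a norm limit of measures invariant under members of 𝒦_K. L need not contain K,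
as the definition of approximate invariance requires. -/
lemma exists_norm_convHaar_sub_le (hK : ℵ₀ < cosetCharacter K) {ν : Meas 𝕜 G}
    (hν : ν ∈ band 𝕜 (subgroupsAbove K)) (hKν : K.1 ≤ mStab ν) {ε : ℝ} (hε : 0 < ε) :
    ∃ L₀ ∈ subgroupsAbove K, ∀ L ≤ L₀, ‖convHaar L ν - ν‖ < ε := by
  let Z : Submodule 𝕜 (Meas 𝕜 G) :=
    { carrier := {σ | ∃ L ∈ subgroupsAbove K, L.1 ≤ mStab σ}
      add_mem' := by
        rintro a b ⟨L, hL, ha⟩ ⟨L', hL', hb⟩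
        obtain ⟨M, hM, h, h'⟩ := exists_le_subgroupsAbove hK hL hL'
        exact ⟨M, hM, (le_inf (le_trans h ha) (le_trans h' hb)).trans (mStab_inf_le_add a b)⟩
      zero_mem' :=
        let ⟨L, hL⟩ := nonempty_subgroupsAbove hK
        ⟨L, hL, by rw [mStab_zero]; exact le_top⟩
      smul_mem' := fun c a ⟨L, hL, ha⟩ => ⟨L, hL, ha.trans (mStab_le_smul c a)⟩ }
  have h1 : convHaar K ν ∈ Z.topologicalClosure :=
    map_mem_band (Submodule.isClosed_topologicalClosure _) (fun H hH ρ φ hρ => by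
      rw [convHaar_smulMeas (le_trans hH.1 hρ)]
      exact Submodule.le_topologicalClosure _ ⟨_, infClosed_mem_subgroupsAbove hK hH hK
        (isInterOpen_fStab (avg K φ)) (le_fStab_avg K φ) (isClosed_fStab _),
        (inf_le_inf_right _ hρ).trans (mStab_inf_fStab_le ρ (avg K φ))⟩) hν
  rw [convHaar_eq_self hKν] at h1
  obtain ⟨σ, ⟨L₀, hL₀, hσ⟩, hd⟩ := Metric.mem_closure_iff.1 h1 (ε / 2) (half_pos hε)
  refine ⟨L₀, hL₀, fun L hL => ?_⟩
  have h2 : convHaar L ν - ν = convHaar L (ν - σ) - (ν - σ) := by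
    rw [map_sub, convHaar_eq_self (le_trans hL hσ)]
    abel
  have h3 := norm_convHaar_le L (ν - σ)
  rw [dist_eq_norm] at hd
  rw [h2]
  refine (norm_sub_le _ _).trans_lt ?_
  linarith

lemma tendsto_convHaar_subgroupsAbove (hK : ℵ₀ < cosetCharacter K) {ν : Meas 𝕜 G}
    (hν : ν ∈ band 𝕜 (subgroupsAbove K)) (hKν : K.1 ≤ mStab ν) :
    Tendsto (fun L : subgroupsAbove K => convHaar L.1 ν) atBot (𝓝 ν) := by
  rw [Metric.tendsto_nhds]
  intro ε hε
  obtain ⟨L₀, hL₀, h⟩ := exists_norm_convHaar_sub_le hK hν hKν hε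
  filter_upwards [eventually_le_atBot (⟨L₀, hL₀⟩ : subgroupsAbove K)] with L hL
  rw [dist_eq_norm]
  exact h L.1 hL

lemma mem_approxInvariantCoset_of_mem_band (hK : ℵ₀ < cosetCharacter K) {ν : Meas 𝕜 G}
    (hν : ν ∈ band 𝕜 (subgroupsAbove K)) (hKν : K.1 ≤ mStab ν) :
    ν ∈ approxInvariantCoset 𝕜 K := by
  refine ⟨mem_cosetMeas_iff.2 hKν, Set.mem_biUnion (x := K) (Set.mem_ofPred_eq ▸ le_rfl)
    (mem_cosetMeas_iff.2 hKν), ?_⟩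
  rw [Metric.tendsto_nhds]
  intro ε hε
  obtain ⟨L₀, hL₀, h⟩ := exists_norm_convHaar_sub_le hK hν hKν hε
  filter_upwards [eventually_le_atBot (⟨L₀, hL₀.2⟩ : subgroupsBelow G (cosetCharacter K))]
    with L hL
  rw [dist_eq_norm, conv_haarMeas]
  exact h L.1 hL

lemma le_mStab_bandProj_subgroupsAbove {μ : Meas 𝕜 G} (hμ : K.1 ≤ mStab μ) :
    K.1 ≤ mStab (bandProj 𝕜 (subgroupsAbove K) μ) := fun x hx => by
  have hc : ∀ x ∈ K.1, ∀ H ∈ subgroupsAbove K, ∃ H' ∈ subgroupsAbove K,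
      ∀ y ∈ H'.1, x * y * x⁻¹ ∈ H.1 := fun x hx H hH => ⟨H, hH, fun y hy =>
    H.1.mul_mem (H.1.mul_mem (hH.1 hx) hy) (H.1.inv_mem (hH.1 hx))⟩
  rw [mem_mStab, rMeas_bandProj (hc x hx) (by simpa using hc x⁻¹ (K.1.inv_mem hx)),
    mem_mStab.1 (hμ hx)]

/-- The net of averages oscillates if two mutually singular sets of averages are cofinal. -/
lemma exists_not_tendsto_of_sing (hK : ℵ₀ < cosetCharacter K) {μ : Meas 𝕜 G}
    (hμ : K.1 ≤ mStab μ) (hμ0 : μ ≠ 0) {A B : Set (CompactSubgroup G)}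
    (hA : ∀ L ∈ subgroupsAbove K, ∃ M ∈ A, M ∈ subgroupsAbove K ∧ M ≤ L)
    (hB : ∀ L ∈ subgroupsAbove K, ∃ M ∈ B, M ∈ subgroupsAbove K ∧ M ≤ L)
    (hAB : ∀ L ∈ A, ∀ L' ∈ B, Sing (convHaar L μ) (convHaar L' μ)) :
    ∃ h : StrongDual 𝕜 (Meas 𝕜 G), ¬ ∃ c : 𝕜,
      Tendsto (fun L : subgroupsAbove K => h (convHaar L.1 μ)) atBot (𝓝 c) := by
  obtain ⟨f, hf⟩ : ∃ f, μ f = 1 := by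
    obtain ⟨f, hf⟩ : ∃ f, μ f ≠ 0 := by
      by_contra! h
      exact hμ0 (ContinuousLinearMap.ext h)
    exact ⟨(μ f)⁻¹ • f, by rw [map_smul, smul_eq_mul, inv_mul_cancel₀ hf]⟩
  let SA := Submodule.span 𝕜 ((fun L => convHaar L μ) '' A)
  let SB := Submodule.span 𝕜 ((fun L => convHaar L μ) '' B)
  -- The functional a + b ↦ a(f) is bounded because singularity gives ‖a‖ ≤ ‖a + b‖; the same bound
  -- makes it well defined.
  obtain ⟨h, hh⟩ := exists_strongDual_comp_eq (J := SA × SB)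
    (SA.subtype.coprod SB.subtype)
    ((ContinuousLinearMap.apply 𝕜 𝕜 f).toLinearMap ∘ₗ SA.subtype ∘ₗ LinearMap.fst 𝕜 SA SB) ‖f‖ (by
      rintro ⟨⟨a, ha⟩, ⟨b, hb⟩⟩
      have hs : Sing a b := sing_of_mem_span (by
        rintro _ ⟨L, hL, rfl⟩ _ ⟨L', hL', rfl⟩
        exact hAB L hL L' hL') ha hb
      change ‖a f‖ ≤ ‖f‖ * ‖a + b‖
      rw [hs.1, mul_comm]
      refine (a.le_opNorm f).trans ?_
      gcongr
      exact le_add_of_nonneg_right (norm_nonneg b))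
  have hhA : ∀ L ∈ A, h (convHaar L μ) = convHaar L μ f := fun L hL => by
    simpa using hh (⟨_, Submodule.subset_span ⟨L, hL, rfl⟩⟩, 0)
  have hhB : ∀ L ∈ B, h (convHaar L μ) = 0 := fun L hL => by
    simpa using hh (0, ⟨_, Submodule.subset_span ⟨L, hL, rfl⟩⟩)
  refine ⟨h, fun ⟨c, hc⟩ => ?_⟩
  have : Nonempty (subgroupsAbove K) := (nonempty_subgroupsAbove hK).to_subtype
  have : IsCodirectedOrder (subgroupsAbove K) := ⟨fun L L' =>
    let ⟨M, hM, h, h'⟩ := exists_le_subgroupsAbove hK L.2 L'.2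
    ⟨⟨M, hM⟩, h, h'⟩⟩
  obtain ⟨L₀, hL₀⟩ := eventually_atBot.1 (Metric.tendsto_nhds.1 hc (1 / 2) (by norm_num))
  -- Below this subgroup the averages over A give exactly μ(f) = 1 and those over B give 0, yet both
  -- would be within 1/2 of c.
  have hM : infClosed L₀.1 (fStab (avg K f)) (isClosed_fStab _) ∈ subgroupsAbove K :=
    infClosed_mem_subgroupsAbove hK L₀.2 hK (isInterOpen_fStab _) (le_fStab_avg K f) _
  have hML₀ : infClosed L₀.1 (fStab (avg K f)) (isClosed_fStab _) ≤ L₀.1 :=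
    inf_le_left (α := Subgroup G)
  obtain ⟨a, haA, ha, haM⟩ := hA _ hM
  obtain ⟨b, hbB, hb, hbM⟩ := hB _ hM
  have h1 := hL₀ ⟨a, ha⟩ (haM.trans hML₀)
  have h2 := hL₀ ⟨b, hb⟩ (hbM.trans hML₀)
  rw [hhA a haA, convHaar_apply_of_le_fStab hμ ha.1
    (le_trans haM (inf_le_right (α := Subgroup G))), hf] at h1
  rw [hhB b hbB] at h2
  have h3 := dist_triangle_right (1 : 𝕜) 0 c
  rw [dist_zero_right, norm_one] at h3
  linarith

/-- Each set of a neighbourhood base of K contains a subgroup above K of countable character; these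
intersect in K. A left inverse of an embedding of the base into κ⁺ supplies the indexing. -/
lemma exists_enum_small (K : CompactSubgroup G) {κ : Cardinal.{u}} (hκ : ℵ₀ ≤ κ)
    (hK : cosetCharacter K ≤ Order.succ κ) :
    ∃ F : (Order.succ κ).ord.ToType → small K κ, ⨅ ξ, (F ξ).1.1 ≤ K.1 := by
  obtain ⟨𝓤, h1, h2, h3⟩ := exists_basis_of_cosetCharacter_le K hK
  obtain ⟨U₀, hU₀, -⟩ := h3 _ isOpen_univ (Set.subset_univ _)
  have : Nonempty 𝓤 := ⟨⟨U₀, hU₀⟩⟩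
  rw [← mk_ord_toType (Order.succ κ)] at h1
  obtain ⟨e⟩ := Cardinal.le_def _ _ |>.1 h1
  choose H hKH hH hHU using fun U : 𝓤 =>
    exists_le_cosetCharacter_le_aleph0 K (h2 U U.2).1 (h2 U U.2).2
  refine ⟨fun ξ => ⟨H (Function.invFun e ξ), hKH _, (hH _).trans hκ⟩, fun x hx => ?_⟩
  by_contra hxK
  obtain ⟨U, hU, hUx⟩ := h3 {x}ᶜ isOpen_compl_singleton fun y hy hyx => hxK (hyx ▸ hy)
  rw [Subgroup.mem_iInf] at hx
  have h4 := hHU _ (hx (e ⟨U, hU⟩))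
  rw [Function.leftInverse_invFun e.injective] at h4
  exact hUx h4 rfl

lemma exists_not_tendsto_of_succ {κ : Cardinal.{u}} (hκ : ℵ₀ ≤ κ)
    (hK : cosetCharacter K = Order.succ κ) {μ : Meas 𝕜 G} (hμ : K.1 ≤ mStab μ) (hμ0 : μ ≠ 0)
    (hsing : ∀ σ ∈ band 𝕜 (subgroupsAbove K), Sing σ μ) :
    ∃ h : StrongDual 𝕜 (Meas 𝕜 G), ¬ ∃ c : 𝕜,
      Tendsto (fun L : subgroupsAbove K => h (convHaar L.1 μ)) atBot (𝓝 c) := by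
  have hs : small K κ = subgroupsAbove K := by
    ext L
    simp only [small, subgroupsAbove, hK, Order.lt_succ_iff]
  choose g hg hgle hgsing using fun H : small K κ =>
    exists_forall_sing_convHaar hκ H.2 hμ (by rwa [hs])
  let g' : small K κ → small K κ := fun H => ⟨g H, hg H⟩
  obtain ⟨F, hF⟩ := exists_enum_small K hκ hK.le
  -- Two applications of g' per step leave room for both sets: an average over N ξ must be singular
  -- to those over N η and over g'(N η) for earlier η.
  obtain ⟨N, hN⟩ := exists_small_chain K hκ (fun H => g' (g' H)) F
  have hg'le : ∀ H, g' H ≤ H := hgle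
  have hanti : Antitone fun ξ => (N ξ).1 := fun η ξ h => by
    rcases h.eq_or_lt with rfl | h
    · exact le_rfl
    · exact ((hN ξ).2 η h).trans ((hg'le _).trans (hg'le _))
  have hcof : ∀ L ∈ subgroupsAbove K, ∃ ξ, (N ξ).1 ≤ L := fun L hL =>
    exists_le_of_iInf_le hκ hanti
      (isInterOpen_of_cosetCharacter_le (hs.ge hL).2 L.2.isClosed le_rfl)
      (le_trans (iInf_mono fun ξ => (hN ξ).1) (hF.trans hL.1))
  have hsg : ∀ (H M : small K κ), M ≤ g' H → Sing (convHaar H.1 μ) (convHaar M.1 μ) :=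
    fun H M h => hgsing H M.1 M.2.1 h _
      (mem_band_of_le_mStab (Set.mem_singleton _) (le_mStab_convHaar H.1 μ))
  refine exists_not_tendsto_of_sing (hK.symm ▸ Order.lt_succ_of_le hκ) hμ hμ0
    (A := Set.range fun ξ => (N ξ).1) (B := Set.range fun ξ => (g' (N ξ)).1) ?_ ?_ ?_
  · intro L hL
    obtain ⟨ξ, hξ⟩ := hcof L hL
    exact ⟨_, ⟨ξ, rfl⟩, hs.le (N ξ).2, hξ⟩
  · intro L hL
    obtain ⟨ξ, hξ⟩ := hcof L hL
    exact ⟨_, ⟨ξ, rfl⟩, hs.le (g' (N ξ)).2, le_trans (hg'le _) hξ⟩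
  · rintro _ ⟨ξ, rfl⟩ _ ⟨η, rfl⟩
    rcases lt_trichotomy η ξ with h | rfl | h
    · exact (hsg (g' (N η)) (N ξ) ((hN ξ).2 η h)).symm
    · exact hsg (N η) (g' (N η)) le_rfl
    · exact hsg (N ξ) (g' (N η)) ((hg'le _).trans (((hN η).2 ξ h).trans (hg'le _)))

lemma succ_mod_two_eq_zero {α : Ordinal.{u}} (h : α % 2 ≠ 0) : (α + 1) % 2 = 0 := by
  have h1 : α % 2 = 1 := by
    have : α % 2 < 1 + 1 := by
      rw [one_add_one_eq_two]
      exact Ordinal.mod_lt α two_ne_zero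
    exact le_antisymm (Order.lt_add_one_iff.1 this) (Order.one_le_iff_ne_zero.2 h)
  have h2 := Ordinal.div_add_mod α 2
  rw [h1] at h2
  rw [← h2, add_assoc, one_add_one_eq_two, Ordinal.mul_add_mod_self, Ordinal.mod_self]

lemma succ_mod_two_ne_zero {α : Ordinal.{u}} (h : α % 2 = 0) : (α + 1) % 2 ≠ 0 := by
  have h2 := Ordinal.div_add_mod α 2
  rw [h, add_zero] at h2
  rw [← h2, Ordinal.mul_add_mod_self, Ordinal.mod_eq_of_lt one_lt_two]
  exact one_ne_zero

lemma exists_not_tendsto_of_limit (hK : ℵ₀ < cosetCharacter K)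
    (hlim : ∀ κ < cosetCharacter K, Order.succ κ < cosetCharacter K) {μ : Meas 𝕜 G}
    (hμ : K.1 ≤ mStab μ) (hμ0 : μ ≠ 0)
    (hsing : ∀ σ ∈ band 𝕜 (subgroupsAbove K), Sing σ μ) :
    ∃ h : StrongDual 𝕜 (Meas 𝕜 G), ¬ ∃ c : 𝕜,
      Tendsto (fun L : subgroupsAbove K => h (convHaar L.1 μ)) atBot (𝓝 c) := by
  -- Averages on level α are singular to the band for ℵ_α and lie in the band for ℵ_(α+1), so
  -- different levels are mutually singular even for subgroups not related by inclusion.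
  let Lev : Ordinal.{u} → Set (CompactSubgroup G) := fun α =>
    {L | L ∈ small K (Order.succ (ℵ_ α)) ∧
      ∀ σ ∈ band 𝕜 {H : CompactSubgroup G | cosetCharacter H ≤ ℵ_ α}, Sing σ (convHaar L μ)}
  have hsucc : ∀ α, ℵ_ (α + 1) = Order.succ (ℵ_ α) := fun α => (succ_aleph α).symm
  have hLev : ∀ α, ℵ_ α < cosetCharacter K → ∀ L ∈ subgroupsAbove K, cosetCharacter L ≤ ℵ_ α →
      ∃ M ∈ Lev α, M ∈ subgroupsAbove K ∧ M ≤ L := by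
    intro α hα L hL hLα
    obtain ⟨M, hM, hML, hMs⟩ := exists_convHaar_sing_band (aleph0_le_aleph α) ⟨hL.1, hLα⟩ hμ
      fun σ hσ => hsing σ (band_mono (𝓣 := subgroupsAbove K) (fun H (hH : H ∈ small K _) => ⟨H, ⟨hH.1, hH.2.trans_lt hα⟩, le_rfl⟩) hσ)
    exact ⟨M, ⟨hM, hMs⟩, ⟨hM.1, hM.2.trans_lt (hlim _ hα)⟩, hML⟩
  have hcof : ∀ P : Ordinal.{u} → Prop, (∀ α, P α ∨ P (α + 1)) → ∀ L ∈ subgroupsAbove K,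
      ∃ M ∈ ⋃ α ∈ {α | P α}, Lev α, M ∈ subgroupsAbove K ∧ M ≤ L := by
    intro P hP L hL
    obtain ⟨α, hα⟩ := mem_range_aleph_iff.2 (le_max_left ℵ₀ (cosetCharacter L))
    have hαK : ℵ_ α < cosetCharacter K := hα ▸ max_lt hK hL.2
    have hLα : cosetCharacter L ≤ ℵ_ α := hα ▸ le_max_right _ _
    -- Either α or α + 1 has the required parity, and both ℵ_α and its successor are below τ, so
    -- each parity class is cofinal.
    rcases hP α with h | h
    · obtain ⟨M, hM, h'⟩ := hLev α hαK L hL hLα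
      exact ⟨M, Set.mem_biUnion h hM, h'⟩
    · obtain ⟨M, hM, h'⟩ := hLev (α + 1) ((hsucc α).trans_lt (hlim _ hαK)) L hL
        (hLα.trans ((Order.le_succ _).trans (hsucc α).ge))
      exact ⟨M, Set.mem_biUnion h hM, h'⟩
  have hlt : ∀ α β, α < β → ∀ L ∈ Lev α, ∀ L' ∈ Lev β,
      Sing (convHaar L μ) (convHaar L' μ) := fun α β h L hL L' hL' =>
    hL'.2 _ (mem_band_of_le_mStab (show cosetCharacter L ≤ ℵ_ β from hL.1.2.trans
      ((hsucc α).ge.trans (aleph_le_aleph.2 (Order.add_one_le_of_lt h)))) (le_mStab_convHaar L μ))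
  refine exists_not_tendsto_of_sing hK hμ hμ0
    (hcof (fun α => α % 2 = 0) fun α => or_iff_not_imp_left.2 succ_mod_two_eq_zero)
    (hcof (fun α => α % 2 ≠ 0) fun α =>
      or_iff_not_imp_left.2 fun h => succ_mod_two_ne_zero (not_not.1 h)) fun L hL L' hL' => ?_
  obtain ⟨α, hα, hLα⟩ := Set.mem_iUnion₂.1 hL
  obtain ⟨β, hβ, hLβ⟩ := Set.mem_iUnion₂.1 hL'
  rcases lt_trichotomy α β with h | rfl | h
  · exact hlt α β h L hLα L' hLβ
  · exact absurd hα hβ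
  · exact (hlt β α h L' hLβ L hLα).symm

lemma exists_not_tendsto_convHaar (hK : ℵ₀ < cosetCharacter K) {μ : Meas 𝕜 G}
    (hμ : K.1 ≤ mStab μ) (hμ' : μ ∉ approxInvariantCoset 𝕜 K) :
    ∃ h : StrongDual 𝕜 (Meas 𝕜 G), ¬ ∃ c : 𝕜,
      Tendsto (fun L : subgroupsAbove K => h (convHaar L.1 μ)) atBot (𝓝 c) := by
  set μa := bandProj 𝕜 (subgroupsAbove K) μ with hμa
  have hKa : K.1 ≤ mStab μa := le_mStab_bandProj_subgroupsAbove hμ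
  have hKs : K.1 ≤ mStab (μ - μa) := fun x hx => by
    rw [mem_mStab, map_sub, mem_mStab.1 (hμ hx), mem_mStab.1 (hKa hx)]
  have hne : μ - μa ≠ 0 := fun h => hμ' (by
    rw [sub_eq_zero.1 h]
    exact mem_approxInvariantCoset_of_mem_band hK (bandProj_mem μ) hKa)
  have hsing : ∀ σ ∈ band 𝕜 (subgroupsAbove K), Sing σ (μ - μa) := fun σ hσ =>
    sing_sub_bandProj μ hσ
  obtain ⟨h, hh⟩ : ∃ h : StrongDual 𝕜 (Meas 𝕜 G), ¬ ∃ c : 𝕜,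
      Tendsto (fun L : subgroupsAbove K => h (convHaar L.1 (μ - μa))) atBot (𝓝 c) := by
    by_cases hlim : ∀ κ < cosetCharacter K, Order.succ κ < cosetCharacter K
    · exact exists_not_tendsto_of_limit hK hlim hKs hne hsing
    · push Not at hlim
      obtain ⟨κ, hκ, hκ'⟩ := hlim
      have he : cosetCharacter K = Order.succ κ := le_antisymm hκ' (Order.succ_le_of_lt hκ)
      refine exists_not_tendsto_of_succ (Order.lt_succ_iff.1 (he ▸ hK)) he hKs hne hsing
  -- The band part contributes a convergent net, so convergence for μ would force it for the
  -- singular part.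
  refine ⟨h, fun ⟨c, hc⟩ => hh ⟨c - h μa, ?_⟩⟩
  refine (hc.sub ((h.continuous.tendsto μa).comp
    (tendsto_convHaar_subgroupsAbove hK (bandProj_mem μ) hKa))).congr fun L => ?_
  rw [Function.comp_apply, ← map_sub, ← map_sub]

end Above

end GroupMeas

end

theorem mainTheorem11 {𝕜 : Type*} [RCLike 𝕜] {G : Type*} [TopologicalSpace G] [Group G]
    [IsTopologicalGroup G] [LocallyCompactSpace G] [T2Space G]
    [MeasurableSpace G] [BorelSpace G]
    (K : GroupMeas.CompactSubgroup G)
    (hK : ¬ TopologicalSpace.MetrizableSpace (G ⧸ K.1))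
    (μ : GroupMeas.Meas 𝕜 G) (hμ : μ ∈ GroupMeas.cosetMeas 𝕜 K)
    (hμ' : μ ∉ GroupMeas.approxInvariantCoset 𝕜 K) :
    (¬ ∃ m : WeakDual 𝕜 (StrongDual 𝕜 (GroupMeas.Meas 𝕜 G)),
      Tendsto (fun L : GroupMeas.subgroupsAbove K =>
        StrongDual.toWeakDual (NormedSpace.inclusionInDoubleDual 𝕜 (GroupMeas.Meas 𝕜 G)
          (GroupMeas.conv μ (GroupMeas.haarMeas 𝕜 L.1)))) atBot (𝓝 m)) ∧
    (∃ h : StrongDual 𝕜 (GroupMeas.Meas 𝕜 G),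
      ¬ ∃ c : 𝕜, Tendsto (fun L : GroupMeas.subgroupsAbove K =>
        h (GroupMeas.conv μ (GroupMeas.haarMeas 𝕜 L.1))) atBot (𝓝 c)) := by
  have hK' : ℵ₀ < GroupMeas.cosetCharacter K := by
    by_contra h
    exact hK (GroupMeas.metrizableSpace_of_cosetCharacter_le K (not_lt.1 h))
  obtain ⟨h, hh⟩ := GroupMeas.exists_not_tendsto_convHaar hK'
    (GroupMeas.mem_cosetMeas_iff.1 hμ) hμ'
  refine ⟨fun ⟨m, hm⟩ => hh ⟨m h, ?_⟩, h, hh⟩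
  exact ((WeakDual.eval_continuous h).tendsto m).comp hm
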